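/- Let $d\in\{2,3\}$ and $\alpha>\frac12-\frac d4$. There is a rational number $m\ge \frac d2+1$, depending only on $d$ and $\alpha$, such that the following holds for every $r^*\in(-\frac d2,\infty)$ and all $c,\kappa_0,M>0$. Consider any $0<\kappa\le\kappa_0$, any $\theta_0\in L^2(\mathbb R^d)$ with decay character $r^*$, i.e. such that $\lim_{\delta\to0}\delta^{-2r^*-d}\int_{|\xi|\le\delta}|\hat\theta_0(\xi)|^2\,d\xi$ exists and lies in $(0,\infty)$, where $\hat\theta_0(\xi)=\int e^{-2\pi i x\cdot\xi}\theta_0(x)\,dx$, any measurable (weakly) divergence-free vector field $u$ on $\mathbb R^d\times(0,\infty)$ with $u(t)\in L^2$ and $\|u(t)\|_2\sim(1+t)^{-\alpha}$ for all $t>0$, and any weak solution $\theta\in C([0,\infty);L^2)\cap L^2_{loc}([0,\infty);H^1)$ of $$\partial_t\theta+u\cdot\nabla\theta-\kappa\Delta\theta=0\ \text{ in }\mathbb R^d\times(0,\infty),\qquad \theta(0)=\theta_0 .$$ Here $f(t)\sim g(t)$ means $c^{-1}g(t)\le f(t)\le c\,g(t)$ for all $t>0$. Assume moreover that $\theta_0\in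 H^1(\mathbb R^d)$, with $\|\theta_0\|_2\le M$, $\|\nabla\theta_0\|_2\le M$ and $\sup_{0<\delta\le1}\delta^{-2r^*-d}\int_{|\xi|\le\delta}|\hat\theta_0|^2\,d\xi\le M$ (every $\theta_0\in H^1$ with decay character $r^*$ satisfies this for some $M$). Put $n=\max\{\frac d4+\frac{r^*}2,m\}$. Then $\theta(t)\in H^1$ for every $t\ge0$, and there are constants $C',C'',C'''>0$ depending only on $d,\alpha,r^*,\nu,c,\kappa_0,M$ (in particular not on $\kappa$, $t$, $u$, $\theta_0$, $\theta$ otherwise) such that, for all $t\ge 0$: 1. if $\|\nabla u(t)\|_\infty\sim(1+t)^{-\nu}$ with $\nu>1$, then $$\|\nabla\theta(t)\|_2\le C'\kappa^{-n-\frac12}(1+t)^{-\min\{\frac d4+\frac{r^*}2+\frac12,\ \frac d4+1\}}\,e^{\frac{(1+t)^{-\nu+1}-1}{-\nu+1}};$$ 2. if $\|\nabla u(t)\|_\infty\sim(1+t)^{-1}$, then $$\|\nabla\theta(t)\|_2\le C''\kappa^{-n-\frac12}(1+t)^{-\min\{\frac d4+\frac{r^*}2+\frac12,\ \frac d4+1\}};$$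 3. if $\|\nabla u(t)\|_\infty\sim(1+t)^{-\nu}$ with $0\le\nu<1$, then $$\|\nabla\theta(t)\|_2\le C'''\kappa^{-n-\frac12}(1+t)^{-\min\{\frac d4+\frac{r^*}2+\frac32,\ \frac d4+2\}}\,e^{\frac{(1+t)^{-\nu+1}-1}{-\nu+1}}.$$ -/

import Mathlib

open Set Filter Topology MeasureTheory
open scoped ENNReal ContDiff FourierTransform

namespace AdvDiff

/-- The Euclidean space `ℝ^d`. -/
abbrev E (d : ℕ) : Type := EuclideanSpace ℝ (Fin d)

/-- Real-valued `L²(ℝ^d)`. -/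
abbrev L2 (d : ℕ) : Type := Lp ℝ 2 (volume : Measure (E d))

/-- Test functions: smooth with compact support. -/
def IsTest {d : ℕ} (φ : E d → ℝ) : Prop :=
  ContDiff ℝ ∞ φ ∧ HasCompactSupport φ

/-- `A` is the weak (distributional) derivative of `f` on `ℝ^d`: both are locally integrable and
`∫ (∂_v φ) f = - ∫ φ (A v)` for all test functions `φ` and all directions `v`. -/
def HasWeakFDeriv {d : ℕ} {F : Type*} [NormedAddCommGroup F] [NormedSpace ℝ F]
    (f : E d → F) (A : E d → (E d →L[ℝ] F)) : Prop :=
  LocallyIntegrable f volume ∧ LocallyIntegrable A volume ∧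
    ∀ φ : E d → ℝ, IsTest φ → ∀ v : E d,
      ∫ x, (fderiv ℝ φ x v) • f x = - ∫ x, φ x • A x v

/-- `‖∇f‖_p`, with value `∞` if `f` has no weak derivative. The weak derivative is unique up to
null sets, so the infimum is over equal numbers. For scalar `f` the pointwise norm is the
Euclidean length of the gradient; for vector fields it is the operator norm of the Jacobian. -/
noncomputable def gradNorm {d : ℕ} {F : Type*} [NormedAddCommGroup F] [NormedSpace ℝ F]
    (p : ℝ≥0∞) (f : E d → F) : ℝ≥0∞ :=
  ⨅ (A : E d → (E d →L[ℝ] F)) (_ : HasWeakFDeriv f A), eLpNorm A p volume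

/-- The `L²` Fourier transform (normalised as `∫ e^{-2πi x·ξ} f(x) dx`) of a real `L²` function. -/
noncomputable def fourierL2 {d : ℕ} (f : L2 d) : Lp ℂ 2 (volume : Measure (E d)) :=
  𝓕 (Complex.ofRealCLM.compLp f)

/-- `∫_{|ξ| ≤ δ} |f̂(ξ)|² dξ`. -/
noncomputable def lowFreqEnergy {d : ℕ} (f : L2 d) (δ : ℝ) : ℝ :=
  ∫ ξ in Metric.closedBall (0 : E d) δ, ‖fourierL2 f ξ‖ ^ 2

/-- `r` is the decay character of `f`. (A rescaling of the frequency variable, i.e. another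
normalisation of the Fourier transform, only multiplies the limit by a positive constant.) -/
def IsDecayCharacter {d : ℕ} (f : L2 d) (r : ℝ) : Prop :=
  -((d : ℝ) / 2) < r ∧ ∃ L : ℝ, 0 < L ∧
    Tendsto (fun δ : ℝ => δ ^ (-2 * r - (d : ℝ)) * lowFreqEnergy f δ) (𝓝[>] 0) (𝓝 L)

/-- `sup_{0 < δ ≤ 1} δ^{-2r-d} ∫_{|ξ| ≤ δ} |f̂(ξ)|² dξ`. It is finite whenever `r` is the decay
character of `f`, and serves only to express how constants depend on `f`. -/
noncomputable def lowFreqSize {d : ℕ} (r : ℝ) (f : L2 d) : ℝ≥0∞ :=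
  ⨆ δ ∈ Ioc (0 : ℝ) 1, ENNReal.ofReal (δ ^ (-2 * r - (d : ℝ)) * lowFreqEnergy f δ)

/-- `N(t) ∼ (1+t)^{-a}` for `t > 0`, with comparison constant `c` in both directions. -/
def DecaysLike (c : ℝ) (N : ℝ → ℝ≥0∞) (a : ℝ) : Prop :=
  ∀ t : ℝ, 0 < t → ENNReal.ofReal (c⁻¹ * (1 + t) ^ (-a)) ≤ N t ∧
    N t ≤ ENNReal.ofReal (c * (1 + t) ^ (-a))

/-- Weakly divergence-free vector field. -/
def IsDivFree {d : ℕ} (v : E d → E d) : Prop :=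
  ∀ φ : E d → ℝ, IsTest φ → ∫ x, fderiv ℝ φ x (v x) = 0

/-- A measurable time-dependent divergence-free vector field with `u(t) ∈ L²` for every `t > 0`. -/
structure IsVelocity {d : ℕ} (u : ℝ → E d → E d) : Prop where
  meas : AEStronglyMeasurable (Function.uncurry u)
    ((volume.restrict (Ioi (0 : ℝ))).prod (volume : Measure (E d)))
  memLp : ∀ t : ℝ, 0 < t → MemLp (u t) 2 volume
  divFree : ∀ t : ℝ, 0 < t → IsDivFree (u t)

/-- `θ` is a weak solution (in the energy class `C([0,∞); L²) ∩ L²_loc([0,∞); H¹)`) of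
`∂_t θ + u · ∇θ - κ Δθ = 0` on `ℝ^d × (0,∞)` with `θ(0) = θ₀`. Here `G t x` is the spatial weak
derivative of `θ` at `(x,t)`, so `G s x (u s x)` is `u · ∇θ` and
`G s x (gradient φ x)` is `∇θ · ∇φ`. -/
structure IsSolution {d : ℕ} (κ : ℝ) (u : ℝ → E d → E d) (θ₀ : L2 d) (θ : ℝ → L2 d) : Prop where
  cont : ContinuousOn θ (Ici 0)
  init : θ 0 = θ₀
  eqn : ∃ G : ℝ → E d → (E d →L[ℝ] ℝ),
    AEStronglyMeasurable (Function.uncurry G)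
      ((volume.restrict (Ioi (0 : ℝ))).prod (volume : Measure (E d))) ∧
    (∀ᵐ t ∂(volume.restrict (Ioi (0 : ℝ))), HasWeakFDeriv (θ t) (G t)) ∧
    (∀ T : ℝ, ∫⁻ t in Ioc 0 T, (eLpNorm (G t) 2 volume) ^ 2 < ⊤) ∧
    ∀ φ : E d → ℝ, IsTest φ → ∀ t : ℝ, 0 ≤ t →
      (∫ x, θ t x * φ x) - ∫ x, θ₀ x * φ x =
        ∫ s in (0 : ℝ)..t, ∫ x, (-(G s x (u s x) * φ x) - κ * G s x (gradient φ x))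

/-- The assumptions on the diffusivity `κ`, the datum `θ₀` (with decay character `r`), the velocity
`u` (with `‖u(t)‖₂ ∼ (1+t)^{-α}`) and the solution `θ`. The numbers `κ₀` and `M` are arbitrary upper
bounds for `κ` and for the sizes of `θ₀`; the constants in the estimates may depend on them. -/
structure Setting (d : ℕ) (α r c κ₀ M κ : ℝ) (u : ℝ → E d → E d) (θ₀ : L2 d) (θ : ℝ → L2 d) :
    Prop where
  kappa_pos : 0 < κ
  kappa_le : κ ≤ κ₀
  decay : IsDecayCharacter θ₀ r
  norm_le : ‖θ₀‖ ≤ M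
  grad_le : gradNorm 2 (θ₀ : E d → ℝ) ≤ ENNReal.ofReal M
  lowFreq_le : lowFreqSize r θ₀ ≤ ENNReal.ofReal M
  velocity : IsVelocity u
  velocity_decay : DecaysLike c (fun t => eLpNorm (u t) 2 volume) α
  solution : IsSolution κ u θ₀ θ

end AdvDiff

namespace AdvDiff

variable {d : ℕ}

/-! Two inequalities for the gradient carry the theorem. The energy inequality (`Flow.energy`)
bounds `2κ ∫_s^t ‖∇θ‖²` by `‖θ(s)‖²`. Testing the equation with `-Δθ` and integrating by parts,
using `div u = 0`, leaves only the quadratic form of the Jacobian of `u`. Hence `‖∇θ(t)‖² ≤ ‖∇θ(s)‖²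
+ 2a ∫_s^t ‖∇θ‖²` when the Jacobian is bounded by `a` on `(s,t]` (`Flow.exists_grad`). The last
integral is already controlled by the energy, so no Gronwall factor arises.

If `ν < 1`, the choice `s = 0` bounds `‖∇θ(t)‖` uniformly in time by a multiple of `κ^{-1/2}`. This
suffices because the stretched exponential in the claim beats every power of `1 + t`. If `ν ≥ 1`,
some `s` in `(t/2, t]` satisfies `‖∇θ(s)‖² ≤ ‖θ(t/2)‖²/(κt)`, and the Jacobian is `O(1/t)` on that
interval. So `‖∇θ(t)‖` is at most a constant times `(κ(1+t))^{-1/2} ‖θ(t/2)‖`, and decay of the `L²`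
norm remains to be shown. For `ν > 1` the exponential factor is at least one and costs nothing.

The `L²` decay is Fourier splitting with a mollifier `k_ε` in place of a sharp frequency cut. High
frequencies obey `‖θ - k_ε*θ‖ ≤ ε‖∇θ‖`. Low frequencies come from the datum, which contributes
`ε^{-p}` to the square with `p = d + 2 min(r,1)`, and from transport. The latter is `∇k_ε * (uθ)`,
of `L²` norm at most a multiple of `ε^{-(d+2)/2} ‖u‖ ‖θ‖`. With `ε² = κt/30` the energy inequality
on `[t/2, t]` closes by halving `t`. A rate `b` improves to `min(p/4, (d+2)/4 - max(1-α-b, 0))`, so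
the hypothesis on `α` gives a fixed gain per step. Finitely many steps reach `p/4`, each costing
`κ^{-(d+2)/4}`; this fixes `m`.

Since `u` and `θ` are rough, every computation is made for `k*θ` with `k` a test function. A square
integrable field with bounded Jacobian is bounded, so `u·∇θ` lies in `L²` for almost every time. The
commutator of mollification and transport therefore tends to zero in `L²` by plain approximation.
Applying the gradient inequality to differences of mollifiers gives a Cauchy sequence of gradients,
hence `θ(t) ∈ H¹` at every time. -/

/-- `∫ f²`. -/
noncomputable def sqInt (f : E d → ℝ) : ℝ := ∫ x, f x ^ 2

/-- The standard basis vectors. -/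
noncomputable def stdE (i : Fin d) : E d := EuclideanSpace.single i 1

/-- The `i`-th partial derivative. -/
noncomputable def pd (i : Fin d) (φ : E d → ℝ) : E d → ℝ := fun x => fderiv ℝ φ x (stdE i)

/-- Convolution of scalar functions. -/
noncomputable def cv (k h : E d → ℝ) : E d → ℝ := fun x => ∫ y, k (x - y) * h y

/-! ### Convolution with test functions and Hilbert space calculus for `sqInt`. -/

theorem cv_eq_convolution (k h : E d → ℝ) :
    cv k h = convolution k h (ContinuousLinearMap.lsmul ℝ ℝ) volume := by
  funext x
  rw [convolution_lsmul_swap]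
  rfl

theorem cv_comm (k h : E d → ℝ) : cv k h = cv h k := by
  funext x
  unfold cv
  rw [← integral_sub_left_eq_self (fun y => k (x - y) * h y) volume x]
  simp [mul_comm]

theorem IsTest.continuous {k : E d → ℝ} (hk : IsTest k) : Continuous k := hk.1.continuous

theorem IsTest.memLp {k : E d → ℝ} (hk : IsTest k) (p : ℝ≥0∞) : MemLp k p volume :=
  hk.continuous.memLp_of_hasCompactSupport hk.2

theorem IsTest.integrable {k : E d → ℝ} (hk : IsTest k) : Integrable k volume :=
  hk.continuous.integrable_of_hasCompactSupport hk.2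

theorem IsTest.pd {k : E d → ℝ} (hk : IsTest k) (i : Fin d) : IsTest (pd i k) := by
  constructor
  · exact (hk.1.fderiv_right (m := ∞) (by simp)).clm_apply contDiff_const
  · exact (hk.2.fderiv (𝕜 := ℝ)).comp_left (g := fun L : E d →L[ℝ] ℝ => L (stdE i)) (by simp)

theorem IsTest.sub {k l : E d → ℝ} (hk : IsTest k) (hl : IsTest l) :
    IsTest (fun x => k x - l x) :=
  ⟨hk.1.sub hl.1, hk.2.sub hl.2⟩

theorem IsTest.mul_left {k l : E d → ℝ} (hk : IsTest k) (hl : ContDiff ℝ ∞ l) :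
    IsTest (fun x => l x * k x) :=
  ⟨hl.mul hk.1, hk.2.mul_left⟩

theorem IsTest.comp_sub {k : E d → ℝ} (hk : IsTest k) (x : E d) :
    IsTest (fun y => k (x - y)) := by
  constructor
  · exact hk.1.comp (contDiff_const.sub contDiff_id)
  · exact hk.2.comp_homeomorph (Homeomorph.subLeft x)

theorem pd_comp_sub {k : E d → ℝ} (hk : IsTest k) (x : E d) (i : Fin d) (y : E d) :
    AdvDiff.pd i (fun y => k (x - y)) y = - AdvDiff.pd i k (x - y) := by
  have h1 : HasFDerivAt k (fderiv ℝ k (x - y)) (x - y) :=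
    (hk.1.differentiable (by simp) _).hasFDerivAt
  have h2 : HasFDerivAt (fun y : E d => x - y) (-ContinuousLinearMap.id ℝ (E d)) y :=
    (hasFDerivAt_id y).const_sub x
  have := (h1.comp y h2).fderiv
  unfold AdvDiff.pd
  change fderiv ℝ (k ∘ fun y => x - y) y (stdE i) = _
  rw [this]
  simp

theorem contDiff_cv {k h : E d → ℝ} (hk : IsTest k) (hh : LocallyIntegrable h volume) :
    ContDiff ℝ ∞ (cv k h) := by
  rw [cv_eq_convolution]
  exact hk.2.contDiff_convolution_left _ hk.1 hh

theorem integrable_cv_integrand {k h : E d → ℝ} (hk : IsTest k) (hh : LocallyIntegrable h volume)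
    (x : E d) : Integrable (fun y => k (x - y) * h y) volume := by
  have := hh.integrable_smul_left_of_hasCompactSupport (hk.comp_sub x).continuous (hk.comp_sub x).2
  exact this

theorem hasFDerivAt_cv {k h : E d → ℝ} (hk : IsTest k) (hh : LocallyIntegrable h volume)
    (x : E d) : fderiv ℝ (cv k h) x = convolution (fderiv ℝ k) h
      ((ContinuousLinearMap.lsmul ℝ ℝ).precompL (E d)) volume x := by
  rw [cv_eq_convolution]
  exact (hk.2.hasFDerivAt_convolution_left _ (hk.1.of_le (by simp)) hh x).fderiv

theorem pd_cv {k h : E d → ℝ} (hk : IsTest k) (hh : LocallyIntegrable h volume) (i : Fin d) :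
    pd i (cv k h) = cv (pd i k) h := by
  funext x
  unfold AdvDiff.pd
  rw [hasFDerivAt_cv hk hh]
  rw [convolution_eq_swap, ContinuousLinearMap.integral_apply]
  · rfl
  · have hc : Continuous (fun y => fderiv ℝ k (x - y)) :=
      (hk.1.continuous_fderiv (by simp)).comp (continuous_const.sub continuous_id)
    have hs : HasCompactSupport (fun y => fderiv ℝ k (x - y)) :=
      (hk.2.fderiv (𝕜 := ℝ)).comp_homeomorph (Homeomorph.subLeft x)
    have := hh.integrable_smul_right_of_hasCompactSupport hc hs
    refine this.congr (ae_of_all _ fun y => ?_)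
    ext v
    simp [mul_comm]

/-- Cauchy–Schwarz for the split `a b = a^{1/2} (a^{1/2} b)`. With `a` a kernel of known mass it
plays the role of Jensen's inequality, and in `ℝ≥0∞` it needs no integrability. -/
theorem sq_lintegral_mul_le {X : Type*} [MeasurableSpace X] {μ : Measure X} {a b : X → ℝ≥0∞}
    (ha : AEMeasurable a μ) (hb : AEMeasurable b μ) :
    (∫⁻ x, a x * b x ∂μ) ^ 2 ≤ (∫⁻ x, a x ∂μ) * ∫⁻ x, a x * b x ^ 2 ∂μ := by
  have key := ENNReal.lintegral_mul_le_Lp_mul_Lq μ Real.HolderConjugate.two_two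
    (f := fun x => a x ^ (1 / 2 : ℝ)) (g := fun x => a x ^ (1 / 2 : ℝ) * b x)
    (ha.pow_const _) ((ha.pow_const _).mul hb)
  have e1 : ∀ x : ℝ≥0∞, x ^ (1 / 2 : ℝ) * x ^ (1 / 2 : ℝ) = x := fun x => by
    rw [← ENNReal.rpow_add_of_nonneg _ _ (by norm_num) (by norm_num)]; norm_num
  have e2 : ∀ x : ℝ≥0∞, (x ^ (1 / 2 : ℝ)) ^ (2 : ℝ) = x := fun x => by
    rw [← ENNReal.rpow_mul]; norm_num
  have e3 : ∀ x : ℝ≥0∞, (x ^ (1 / 2 : ℝ)) ^ 2 = x := fun x => by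
    rw [sq, e1]
  simp only [Pi.mul_apply, ← mul_assoc, e1, e2, ENNReal.mul_rpow_of_nonneg _ _ zero_le_two] at key
  calc _ ≤ _ := pow_le_pow_left' key 2
    _ = _ := by
      rw [mul_pow, e3, e3]
      simp

/-- Young's inequality `L¹ * L² → L²`, asking only for measurability so that either factor can take
the `L¹` role. -/
theorem lintegral_enorm_cv_sq_le {k h : E d → ℝ} (hk : AEStronglyMeasurable k volume)
    (hh : AEStronglyMeasurable h volume) :
    ∫⁻ x, ‖cv k h x‖ₑ ^ 2 ≤ (∫⁻ x, ‖k x‖ₑ) ^ 2 * ∫⁻ x, ‖h x‖ₑ ^ 2 := by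
  have hsub : ∀ x : E d, Measure.QuasiMeasurePreserving (fun y => x - y)
      (volume : Measure (E d)) volume := fun x =>
    (Measure.measurePreserving_sub_left volume x).quasiMeasurePreserving
  have h1 : ∀ x, ‖cv k h x‖ₑ ^ 2 ≤
      (∫⁻ y, ‖k y‖ₑ) * ∫⁻ y, ‖k (x - y)‖ₑ * ‖h y‖ₑ ^ 2 := fun x => by
    have : ‖cv k h x‖ₑ ≤ ∫⁻ y, ‖k (x - y)‖ₑ * ‖h y‖ₑ := by
      refine (enorm_integral_le_lintegral_enorm _).trans_eq ?_
      simp only [enorm_mul]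
    calc _ ≤ (∫⁻ y, ‖k (x - y)‖ₑ * ‖h y‖ₑ) ^ 2 := pow_le_pow_left' this 2
      _ ≤ _ := sq_lintegral_mul_le (hk.comp_quasiMeasurePreserving (hsub x)).enorm hh.enorm
      _ = _ := by rw [lintegral_sub_left_eq_self (fun y => ‖k y‖ₑ) x]
  have hm : AEMeasurable (fun p : E d × E d => ‖k (p.1 - p.2)‖ₑ * ‖h p.2‖ₑ ^ 2)
      (volume.prod volume) :=
    (hk.comp_quasiMeasurePreserving
      (quasiMeasurePreserving_sub_of_right_invariant volume volume)).enorm.fun_mul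
      ((hh.comp_quasiMeasurePreserving Measure.quasiMeasurePreserving_snd).enorm.pow_const _)
  calc _ ≤ ∫⁻ x, (∫⁻ y, ‖k y‖ₑ) * ∫⁻ y, ‖k (x - y)‖ₑ * ‖h y‖ₑ ^ 2 := lintegral_mono h1
    _ ≤ (∫⁻ y, ‖k y‖ₑ) * ∫⁻ x, ∫⁻ y, ‖k (x - y)‖ₑ * ‖h y‖ₑ ^ 2 := by
      rw [lintegral_const_mul'' _ hm.lintegral_prod_right']
    _ = (∫⁻ y, ‖k y‖ₑ) * ∫⁻ y, ∫⁻ x, ‖k (x - y)‖ₑ * ‖h y‖ₑ ^ 2 := by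
      rw [lintegral_lintegral_swap hm]
    _ = _ := by
      have : ∀ y, ∫⁻ x, ‖k (x - y)‖ₑ * ‖h y‖ₑ ^ 2 = (∫⁻ x, ‖k x‖ₑ) * ‖h y‖ₑ ^ 2 := fun y => by
        rw [lintegral_mul_const' _ _ (by simp),
          lintegral_sub_right_eq_self (fun x => ‖k x‖ₑ) y]
      simp only [this]
      rw [lintegral_const_mul'' _ (hh.enorm.pow_const _), sq, mul_assoc]

theorem ofReal_sqInt {f : E d → ℝ} (hf : MemLp f 2 volume) :
    ENNReal.ofReal (sqInt f) = ∫⁻ x, ‖f x‖ₑ ^ 2 := by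
  unfold sqInt
  rw [ofReal_integral_eq_lintegral_ofReal hf.integrable_sq (ae_of_all _ fun _ => sq_nonneg _)]
  refine lintegral_congr fun x => ?_
  rw [← Real.enorm_of_nonneg (sq_nonneg _), enorm_pow]

theorem sqInt_nonneg (f : E d → ℝ) : 0 ≤ sqInt f := integral_nonneg fun _ => sq_nonneg _

theorem memLp_two_iff {f : E d → ℝ} (hf : AEStronglyMeasurable f volume) :
    MemLp f 2 volume ↔ ∫⁻ x, ‖f x‖ₑ ^ 2 < ⊤ := by
  rw [MemLp, eLpNorm_lt_top_iff_lintegral_rpow_enorm_lt_top (by simp) (by simp)]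
  simp [hf]

theorem MemLp.locInt {h : E d → ℝ} (hh : MemLp h 2 volume) : LocallyIntegrable h volume :=
  hh.locallyIntegrable (by norm_num)

theorem memLp_cv {k h : E d → ℝ} (hk : IsTest k) (hh : MemLp h 2 volume) :
    MemLp (cv k h) 2 volume := by
  rw [memLp_two_iff (contDiff_cv hk (MemLp.locInt hh)).continuous.aestronglyMeasurable]
  refine (lintegral_enorm_cv_sq_le hk.continuous.aestronglyMeasurable hh.1).trans_lt ?_
  exact ENNReal.mul_lt_top (ENNReal.pow_lt_top hk.integrable.2) ((memLp_two_iff hh.1).1 hh)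

theorem sqInt_cv_le {k h : E d → ℝ} (hk : IsTest k) (hh : MemLp h 2 volume) :
    sqInt (cv k h) ≤ (∫ x, ‖k x‖) ^ 2 * sqInt h := by
  rw [← ENNReal.ofReal_le_ofReal_iff (mul_nonneg (sq_nonneg _) (sqInt_nonneg _)),
    ofReal_sqInt (memLp_cv hk hh), ENNReal.ofReal_mul (sq_nonneg _), ofReal_sqInt hh,
    ENNReal.ofReal_pow (integral_nonneg fun x => norm_nonneg _),
    ofReal_integral_norm_eq_lintegral_enorm hk.integrable]
  exact lintegral_enorm_cv_sq_le hk.continuous.aestronglyMeasurable hh.1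

theorem memLp_cv_integrable {k h : E d → ℝ} (hk : IsTest k) (hh : Integrable h volume) :
    MemLp (cv k h) 2 volume := by
  rw [memLp_two_iff (contDiff_cv hk hh.locallyIntegrable).continuous.aestronglyMeasurable, cv_comm]
  refine (lintegral_enorm_cv_sq_le hh.1 hk.continuous.aestronglyMeasurable).trans_lt ?_
  exact ENNReal.mul_lt_top (ENNReal.pow_lt_top hh.2)
    ((memLp_two_iff (hk.memLp 2).1).1 (hk.memLp 2))

/-- The `L²` norm falls on the kernel here. This is the form needed for `∇k * (θu)`, since a product
of two `L²` functions is only known to be in `L¹`. -/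
theorem sqInt_cv_le_integrable {k h : E d → ℝ} (hk : IsTest k) (hh : Integrable h volume) :
    sqInt (cv k h) ≤ (∫ x, ‖h x‖) ^ 2 * sqInt k := by
  rw [← ENNReal.ofReal_le_ofReal_iff (mul_nonneg (sq_nonneg _) (sqInt_nonneg _)),
    ofReal_sqInt (memLp_cv_integrable hk hh), ENNReal.ofReal_mul (sq_nonneg _),
    ofReal_sqInt (hk.memLp 2), ENNReal.ofReal_pow (integral_nonneg fun x => norm_nonneg _),
    ofReal_integral_norm_eq_lintegral_enorm hh, cv_comm]
  exact lintegral_enorm_cv_sq_le hh.1 hk.continuous.aestronglyMeasurable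

theorem MemLp.integrable_mul' {f g : E d → ℝ} (hf : MemLp f 2 volume) (hg : MemLp g 2 volume) :
    Integrable (fun x => f x * g x) volume := MemLp.integrable_mul hf hg

theorem two_mul_integral_mul_le {f g : E d → ℝ} (hf : MemLp f 2 volume) (hg : MemLp g 2 volume)
    {η : ℝ} (hη : 0 < η) : 2 * ∫ x, f x * g x ≤ η * sqInt f + η⁻¹ * sqInt g := by
  unfold sqInt
  rw [← integral_const_mul, ← integral_const_mul, ← integral_const_mul, ← integral_add
    (hf.integrable_sq.const_mul _) (hg.integrable_sq.const_mul _)]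
  refine integral_mono ((MemLp.integrable_mul' hf hg).const_mul _)
    ((hf.integrable_sq.const_mul _).add (hg.integrable_sq.const_mul _)) fun x => ?_
  have : η * f x ^ 2 + η⁻¹ * g x ^ 2 - 2 * (f x * g x) = η * (f x - η⁻¹ * g x) ^ 2 := by
    field_simp; ring
  have h2 : 0 ≤ η * (f x - η⁻¹ * g x) ^ 2 := by positivity
  simp only
  linarith

theorem sq_integral_mul_le {f g : E d → ℝ} (hf : MemLp f 2 volume) (hg : MemLp g 2 volume) :
    (∫ x, f x * g x) ^ 2 ≤ sqInt f * sqInt g := by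
  have hq : ∀ t : ℝ, 0 ≤ sqInt f * (t * t) + (2 * ∫ x, f x * g x) * t + sqInt g := fun t => by
    have : sqInt (fun x => t * f x + g x) =
        sqInt f * (t * t) + (2 * ∫ x, f x * g x) * t + sqInt g := by
      unfold sqInt
      have : ∀ x, (t * f x + g x) ^ 2 = (t * t) * f x ^ 2 + (2 * t) * (f x * g x) + g x ^ 2 :=
        fun x => by ring
      simp only [this]
      rw [integral_add _ hg.integrable_sq, integral_add (hf.integrable_sq.const_mul _)
        ((MemLp.integrable_mul' hf hg).const_mul _), integral_const_mul, integral_const_mul]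
      · ring
      · exact (hf.integrable_sq.const_mul _).add ((MemLp.integrable_mul' hf hg).const_mul _)
    rw [← this]; exact sqInt_nonneg _
  have := discrim_le_zero hq
  unfold discrim at this
  nlinarith

theorem sqInt_comp_sub (k : E d → ℝ) (x : E d) : sqInt (fun y => k (x - y)) = sqInt k :=
  integral_sub_left_eq_self (fun y => k y ^ 2) volume x

theorem sq_cv_le {k h : E d → ℝ} (hk : IsTest k) (hh : MemLp h 2 volume) (x : E d) :
    (cv k h x) ^ 2 ≤ sqInt k * sqInt h := by
  rw [← sqInt_comp_sub k x]
  exact sq_integral_mul_le ((hk.comp_sub x).memLp 2) hh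

/-- The test function is `y ↦ k (x - y)`; the sign from the reflection cancels the sign in the weak
derivative. -/
theorem cv_pd_eq {h : E d → ℝ} {A : E d → (E d →L[ℝ] ℝ)} (hA : HasWeakFDeriv h A) {k : E d → ℝ}
    (hk : IsTest k) (i : Fin d) : cv (pd i k) h = cv k (fun y => A y (stdE i)) := by
  funext x
  have := hA.2.2 _ (hk.comp_sub x) (stdE i)
  have h2 : ∀ y, fderiv ℝ (fun y => k (x - y)) y (stdE i) = - pd i k (x - y) := pd_comp_sub hk x i
  simp only [h2, smul_eq_mul, neg_mul] at this
  rw [integral_neg, neg_inj] at this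
  exact this

theorem cv_sub_left {k l h : E d → ℝ} (hk : IsTest k) (hl : IsTest l)
    (hh : LocallyIntegrable h volume) (x : E d) :
    cv (fun x => k x - l x) h x = cv k h x - cv l h x := by
  unfold cv
  rw [← integral_sub (integrable_cv_integrand hk hh x) (integrable_cv_integrand hl hh x)]
  simp [sub_mul]

theorem cv_congr {k h h' : E d → ℝ} (hh : h =ᵐ[volume] h') : cv k h = cv k h' := by
  funext x
  exact integral_congr_ae (by filter_upwards [hh] with y hy; simp [hy])

theorem sqInt_congr {h h' : E d → ℝ} (hh : h =ᵐ[volume] h') : sqInt h = sqInt h' :=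
  integral_congr_ae (by filter_upwards [hh] with y hy; simp [hy])

theorem sqInt_add_le {f g : E d → ℝ} (hf : MemLp f 2 volume) (hg : MemLp g 2 volume) :
    sqInt (fun x => f x + g x) ≤ 2 * sqInt f + 2 * sqInt g := by
  unfold sqInt
  rw [← integral_const_mul, ← integral_const_mul, ← integral_add
    (hf.integrable_sq.const_mul _) (hg.integrable_sq.const_mul _)]
  refine integral_mono (hf.add hg).integrable_sq
    ((hf.integrable_sq.const_mul _).add (hg.integrable_sq.const_mul _)) fun x => ?_
  nlinarith [sq_nonneg (f x - g x)]

theorem sqInt_sub_le {f g : E d → ℝ} (hf : MemLp f 2 volume) (hg : MemLp g 2 volume) :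
    sqInt (fun x => f x - g x) ≤ 2 * sqInt f + 2 * sqInt g := by
  have := sqInt_add_le hf hg.neg
  simpa [sqInt, sub_eq_add_neg] using this

theorem eLpNorm_sq_eq {f : E d → ℝ} (hf : MemLp f 2 volume) :
    (eLpNorm f 2 volume) ^ 2 = ENNReal.ofReal (sqInt f) := by
  rw [ofReal_sqInt hf, eLpNorm_eq_lintegral_rpow_enorm_toReal (by simp) (by simp)]
  rw [← ENNReal.rpow_natCast, ← ENNReal.rpow_mul]
  simp

theorem sqInt_eq_norm_sq (h : L2 d) : sqInt (h : E d → ℝ) = ‖h‖ ^ 2 := by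
  rw [Lp.norm_def, ← ENNReal.toReal_pow, eLpNorm_sq_eq (Lp.memLp h),
    ENNReal.toReal_ofReal (sqInt_nonneg _)]

theorem eLpNorm_eq_sqrt {f : E d → ℝ} (hf : MemLp f 2 volume) :
    eLpNorm f 2 volume = ENNReal.ofReal (√(sqInt f)) := by
  have h := eLpNorm_sq_eq hf
  rw [← Real.sq_sqrt (sqInt_nonneg f), ENNReal.ofReal_pow (Real.sqrt_nonneg _)] at h
  exact (ENNReal.pow_right_strictMono two_ne_zero).injective h

theorem memLp_sub {f g : E d → ℝ} (hf : MemLp f 2 volume) (hg : MemLp g 2 volume) :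
    MemLp (fun x => f x - g x) 2 volume := hf.sub hg

theorem sqInt_eq_norm_toLp_sq {f : E d → ℝ} (hf : MemLp f 2 volume) :
    sqInt f = ‖hf.toLp f‖ ^ 2 := by
  rw [← sqInt_eq_norm_sq]
  exact sqInt_congr hf.coeFn_toLp.symm

theorem tendsto_sqInt {ι : Type*} {l : Filter ι} {f : ι → E d → ℝ} {g : E d → ℝ}
    (hf : ∀ n, MemLp (f n) 2 volume) (hg : MemLp g 2 volume)
    (h : Tendsto (fun n => sqInt (fun x => f n x - g x)) l (𝓝 0)) :
    Tendsto (fun n => sqInt (f n)) l (𝓝 (sqInt g)) := by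
  have h1 : Tendsto (fun n => (hf n).toLp (f n)) l (𝓝 (hg.toLp g)) := by
    rw [tendsto_iff_norm_sub_tendsto_zero]
    have : ∀ n, ‖(hf n).toLp (f n) - hg.toLp g‖ = √(sqInt (fun x => f n x - g x)) := fun n => by
      rw [← MemLp.toLp_sub]
      have := sqInt_eq_norm_toLp_sq ((hf n).sub hg)
      change sqInt (fun x => f n x - g x) = _ at this
      rw [this, Real.sqrt_sq (norm_nonneg _)]
    simp only [this]
    simpa using h.sqrt
  have h2 := h1.norm.pow 2
  simpa only [← sqInt_eq_norm_toLp_sq] using h2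

/-! ### Approximate identities and the first-order mollification error. -/

/-- `k*h - h` is the `k`-average of the differences `h(· - y) - h`, and `k` is a probability
density, so the average inherits any bound valid for `y` in the support of `k`. -/
theorem sqInt_cv_sub_self_le {k h : E d → ℝ} (hk : IsTest k) (hk0 : ∀ x, 0 ≤ k x)
    (hk1 : ∫ x, k x = 1) (hh : MemLp h 2 volume) {δ : ℝ} (hδ : 0 ≤ δ)
    (H : ∀ y, k y ≠ 0 → sqInt (fun x => h (x - y) - h x) ≤ δ) :
    sqInt (fun x => cv k h x - h x) ≤ δ := by
  have hτ : ∀ y, MemLp (fun x => h (x - y)) 2 volume := fun y =>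
    hh.comp_measurePreserving (measurePreserving_sub_right volume y)
  have hkl : ∫⁻ y, ‖k y‖ₑ = 1 := by
    rw [← ofReal_integral_norm_eq_lintegral_enorm hk.integrable]
    simp only [Real.norm_of_nonneg (hk0 _), hk1, ENNReal.ofReal_one]
  have hsub : ∀ x : E d, Measure.QuasiMeasurePreserving (fun y => x - y)
      (volume : Measure (E d)) volume := fun x =>
    (Measure.measurePreserving_sub_left volume x).quasiMeasurePreserving
  have hm : AEMeasurable (fun p : E d × E d => ‖k p.2‖ₑ * ‖h (p.1 - p.2) - h p.1‖ₑ ^ 2)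
      (volume.prod volume) := by
    refine (hk.continuous.comp continuous_snd).measurable.enorm.aemeasurable.fun_mul ?_
    refine (AEStronglyMeasurable.sub ?_ ?_).enorm.pow_const _
    · exact (hh.1.comp_quasiMeasurePreserving
        (quasiMeasurePreserving_sub_of_right_invariant volume volume))
    · exact hh.1.comp_quasiMeasurePreserving Measure.quasiMeasurePreserving_fst
  rw [← ENNReal.ofReal_le_ofReal_iff hδ, ofReal_sqInt (memLp_sub (memLp_cv hk hh) hh)]
  have h1 : ∀ x, ‖cv k h x - h x‖ₑ ^ 2 ≤ ∫⁻ y, ‖k y‖ₑ * ‖h (x - y) - h x‖ₑ ^ 2 := fun x => by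
    have e : cv k h x - h x = ∫ y, k y * (h (x - y) - h x) := by
      have i1 : Integrable (fun y => k y * h (x - y)) volume := by
        have := (integrable_cv_integrand hk (MemLp.locInt hh) x).comp_sub_left x
        simpa using this
      simp only [mul_sub]
      rw [integral_sub i1 (hk.integrable.mul_const _), integral_mul_const, hk1, one_mul, cv_comm]
      congr 1
      exact integral_congr_ae (ae_of_all _ fun y => mul_comm _ _)
    calc _ ≤ (∫⁻ y, ‖k y‖ₑ * ‖h (x - y) - h x‖ₑ) ^ 2 := by
          refine pow_le_pow_left' ?_ 2
          rw [e]
          refine (enorm_integral_le_lintegral_enorm _).trans_eq ?_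
          simp only [enorm_mul]
      _ ≤ _ := sq_lintegral_mul_le hk.continuous.measurable.enorm.aemeasurable
          ((hh.1.comp_quasiMeasurePreserving (hsub x)).sub aestronglyMeasurable_const).enorm
      _ = _ := by rw [hkl, one_mul]
  calc _ ≤ ∫⁻ x, ∫⁻ y, ‖k y‖ₑ * ‖h (x - y) - h x‖ₑ ^ 2 := lintegral_mono h1
    _ = ∫⁻ y, ∫⁻ x, ‖k y‖ₑ * ‖h (x - y) - h x‖ₑ ^ 2 := lintegral_lintegral_swap hm
    _ ≤ ∫⁻ y, ‖k y‖ₑ * ENNReal.ofReal δ := by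
      refine lintegral_mono fun y => ?_
      rw [lintegral_const_mul' _ _ (by simp)]
      by_cases hy : k y = 0
      · simp [hy]
      · gcongr
        rw [← ofReal_sqInt (memLp_sub (hτ y) hh)]
        exact ENNReal.ofReal_le_ofReal (H y hy)
    _ = _ := by rw [lintegral_mul_const' _ _ (by simp), hkl, one_mul]

theorem tendsto_sqInt_translate {h : E d → ℝ} (hh : MemLp h 2 volume) :
    Tendsto (fun y => sqInt (fun x => h (x - y) - h x)) (𝓝 0) (𝓝 0) := by
  let g : E d → C(E d, E d) := fun y => ⟨fun x => x - y, by fun_prop⟩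
  have hgc : Continuous g := by
    refine ContinuousMap.continuous_of_continuous_uncurry _ ?_
    exact (continuous_snd.sub continuous_fst)
  have hmp : ∀ y, MeasurePreserving (g y) (volume : Measure (E d)) volume := fun y =>
    measurePreserving_sub_right volume y
  have hc : Continuous (fun y => Lp.compMeasurePreserving (g y) (hmp y) (hh.toLp h)) :=
    continuous_const.compMeasurePreservingLp hgc hmp (by simp)
  have h1 : Tendsto (fun y => ‖Lp.compMeasurePreserving (g y) (hmp y) (hh.toLp h) - hh.toLp h‖ ^ 2)
      (𝓝 0) (𝓝 0) := by
    have := (((hc.sub continuous_const).norm.pow 2 : Continuous (fun y =>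
      ‖Lp.compMeasurePreserving (g y) (hmp y) (hh.toLp h) - hh.toLp h‖ ^ 2))).tendsto 0
    have e : Lp.compMeasurePreserving (g 0) (hmp 0) (hh.toLp h) = hh.toLp h := by
      rw [Lp.toLp_compMeasurePreserving]
      congr 1
      funext x; simp [g]
    simp only [Pi.pow_apply, Pi.sub_apply] at this
    rwa [e, sub_self, norm_zero, zero_pow two_ne_zero] at this
  refine h1.congr fun y => ?_
  rw [Lp.toLp_compMeasurePreserving, ← MemLp.toLp_sub, ← sqInt_eq_norm_toLp_sq]
  rfl

/-- A fixed smooth nonnegative kernel of integral one supported in the unit ball. -/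
noncomputable def kern₁ (d : ℕ) : E d → ℝ :=
  (⟨1 / 2, 1, by norm_num, by norm_num⟩ : ContDiffBump (0 : E d)).normed volume

/-- The kernel `ε^{-d} k(x/ε)`. -/
noncomputable def kern (d : ℕ) (ε : ℝ) : E d → ℝ := fun x => (ε ^ d)⁻¹ * kern₁ d (ε⁻¹ • x)

theorem isTest_kern₁ (d : ℕ) : IsTest (kern₁ d) :=
  ⟨ContDiffBump.contDiff_normed _, ContDiffBump.hasCompactSupport_normed _⟩

theorem isTest_kern {ε : ℝ} (hε : 0 < ε) : IsTest (kern d ε) := by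
  constructor
  · exact contDiff_const.mul ((isTest_kern₁ d).1.comp (contDiff_const_smul _))
  · exact ((isTest_kern₁ d).2.comp_smul (inv_ne_zero hε.ne')).mul_left

theorem kern_nonneg {ε : ℝ} (hε : 0 < ε) (x : E d) : 0 ≤ kern d ε x :=
  mul_nonneg (by positivity) (ContDiffBump.nonneg_normed _ _)

theorem integral_comp_inv_smul' {ε : ℝ} (hε : 0 < ε) (f : E d → ℝ) :
    ∫ x, f (ε⁻¹ • x) = ε ^ d * ∫ x, f x := by
  rw [Measure.integral_comp_inv_smul_of_nonneg _ _ hε.le]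
  simp

theorem integral_kern {ε : ℝ} (hε : 0 < ε) : ∫ x, kern d ε x = 1 := by
  unfold kern
  rw [integral_const_mul, integral_comp_inv_smul' hε, kern₁, ContDiffBump.integral_normed]
  have : ε ^ d ≠ 0 := by positivity
  field_simp

theorem norm_le_of_kern_ne_zero {ε : ℝ} (hε : 0 < ε) {x : E d} (hx : kern d ε x ≠ 0) :
    ‖x‖ ≤ ε := by
  have h1 : kern₁ d (ε⁻¹ • x) ≠ 0 := fun h => hx (by simp [kern, h])
  have h2 : ε⁻¹ • x ∈ Function.support (kern₁ d) := h1
  rw [kern₁, ContDiffBump.support_normed_eq] at h2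
  simp only [Metric.mem_ball, dist_zero_right, norm_smul, norm_inv, Real.norm_of_nonneg hε.le] at h2
  rw [inv_mul_lt_iff₀ hε] at h2
  linarith

theorem pd_kern {ε : ℝ} (i : Fin d) (x : E d) :
    pd i (kern d ε) x = (ε ^ d)⁻¹ * ε⁻¹ * pd i (kern₁ d) (ε⁻¹ • x) := by
  have h1 : HasFDerivAt (kern₁ d) (fderiv ℝ (kern₁ d) (ε⁻¹ • x)) (ε⁻¹ • x) :=
    ((isTest_kern₁ d).1.differentiable (by simp) _).hasFDerivAt
  have h2 : HasFDerivAt (fun y : E d => ε⁻¹ • y) (ε⁻¹ • ContinuousLinearMap.id ℝ (E d)) x :=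
    (hasFDerivAt_id x).const_smul ε⁻¹
  have h3 := ((h1.comp x h2).const_mul (ε ^ d)⁻¹).fderiv
  unfold pd
  change fderiv ℝ (fun y => (ε ^ d)⁻¹ * (kern₁ d ∘ fun y => ε⁻¹ • y) y) x (stdE i) = _
  rw [h3]
  simp [mul_assoc]

/-- The power is `ε^{-2d-2}` from the square of the prefactor times `ε^d` from the change of
variables. It limits the decay caused by transport to the rate `(d+2)/4`. -/
theorem sqInt_pd_kern {ε : ℝ} (hε : 0 < ε) (i : Fin d) :
    sqInt (pd i (kern d ε)) = (ε ^ (d + 2))⁻¹ * sqInt (pd i (kern₁ d)) := by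
  unfold sqInt
  simp only [pd_kern, mul_pow]
  rw [integral_const_mul, integral_comp_inv_smul' hε (fun x => pd i (kern₁ d) x ^ 2)]
  field_simp
  ring

/-- Mollification kernels. -/
noncomputable def mol (d n : ℕ) : E d → ℝ := kern d (1 / ((n : ℝ) + 1))

theorem isTest_mol (n : ℕ) : IsTest (mol d n) := isTest_kern (by positivity)

theorem integral_norm_kern {ε : ℝ} (hε : 0 < ε) : ∫ x, ‖kern d ε x‖ = 1 := by
  simp only [Real.norm_of_nonneg (kern_nonneg hε _), integral_kern hε]

theorem sqInt_cv_kern_le {ε : ℝ} (hε : 0 < ε) {h : E d → ℝ} (hh : MemLp h 2 volume) :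
    sqInt (cv (kern d ε) h) ≤ sqInt h := by
  have := sqInt_cv_le (isTest_kern hε) hh
  rwa [integral_norm_kern hε, one_pow, one_mul] at this

theorem sqInt_cv_mol_le (n : ℕ) {h : E d → ℝ} (hh : MemLp h 2 volume) :
    sqInt (cv (mol d n) h) ≤ sqInt h := sqInt_cv_kern_le (by positivity) hh

theorem tendsto_sqInt_cv_mol_sub {h : E d → ℝ} (hh : MemLp h 2 volume) :
    Tendsto (fun n => sqInt (fun x => cv (mol d n) h x - h x)) atTop (𝓝 0) := by
  rw [Metric.tendsto_atTop]
  intro δ hδ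
  have h1 := (tendsto_sqInt_translate hh).eventually (gt_mem_nhds (half_pos hδ))
  obtain ⟨η, hη, H⟩ := Metric.eventually_nhds_iff.1 h1
  obtain ⟨N, hN⟩ := exists_nat_one_div_lt hη
  refine ⟨N, fun n hn => ?_⟩
  have hε : (0 : ℝ) < 1 / ((n : ℝ) + 1) := by positivity
  have hlt : 1 / ((n : ℝ) + 1) < η := by
    refine lt_of_le_of_lt ?_ hN
    have : (N : ℝ) ≤ n := by exact_mod_cast hn
    gcongr
  have := sqInt_cv_sub_self_le (isTest_mol n) (kern_nonneg hε) (integral_kern hε) hh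
    (half_pos hδ).le (fun y hy => (H (by
      rw [dist_zero_right]; exact (norm_le_of_kern_ne_zero hε hy).trans_lt hlt)).le)
  rw [Real.dist_eq, sub_zero, abs_of_nonneg (sqInt_nonneg _)]
  linarith

theorem tendsto_sqInt_cv_mol {h : E d → ℝ} (hh : MemLp h 2 volume) :
    Tendsto (fun n => sqInt (cv (mol d n) h)) atTop (𝓝 (sqInt h)) :=
  tendsto_sqInt (fun n => memLp_cv (isTest_mol n) hh) hh (tendsto_sqInt_cv_mol_sub hh)

theorem sum_smul_stdE (y : E d) : ∑ i, y i • stdE i = y := by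
  have := (EuclideanSpace.basisFun (Fin d) ℝ).sum_repr y
  simpa [stdE] using this

theorem fderiv_apply_eq_sum (w : E d → ℝ) (x y : E d) :
    fderiv ℝ w x y = ∑ i, y i * pd i w x := by
  conv_lhs => rw [← sum_smul_stdE y]
  simp [pd]

theorem sq_sum_mul_le (y : E d) (a : Fin d → ℝ) :
    (∑ i, y i * a i) ^ 2 ≤ ‖y‖ ^ 2 * ∑ i, a i ^ 2 := by
  rw [EuclideanSpace.real_norm_sq_eq]
  exact Finset.sum_mul_sq_le_sq_mul_sq _ _ _

/-- The difference is the integral of the directional derivative along a segment. Cauchy–Schwarz in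
the segment parameter and translation invariance in `x` finish. -/
theorem sqInt_translate_sub_le_of_smooth {w : E d → ℝ} (hw : ContDiff ℝ ∞ w)
    (hw2 : MemLp w 2 volume) (hi : ∀ i, MemLp (pd i w) 2 volume) (y : E d) :
    sqInt (fun x => w (x - y) - w x) ≤ ‖y‖ ^ 2 * ∑ i, sqInt (pd i w) := by
  have hτ : MemLp (fun x => w (x - y)) 2 volume :=
    hw2.comp_measurePreserving (measurePreserving_sub_right volume y)
  have hS : 0 ≤ ∑ i, sqInt (pd i w) := Finset.sum_nonneg fun i _ => sqInt_nonneg _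
  have hfc : Continuous (fun x => fderiv ℝ w x y) :=
    (hw.continuous_fderiv (by simp)).clm_apply continuous_const
  rw [← ENNReal.ofReal_le_ofReal_iff (by positivity), ofReal_sqInt (memLp_sub hτ hw2)]
  have h1 : ∀ x, ‖w (x - y) - w x‖ₑ ^ 2 ≤
      ∫⁻ s in Ioc (0 : ℝ) 1, ‖fderiv ℝ w (x - s • y) y‖ₑ ^ 2 := fun x => by
    have hd : ∀ s ∈ uIcc (0 : ℝ) 1, HasDerivAt (fun s : ℝ => w (x - s • y))
        (-(fderiv ℝ w (x - s • y) y)) s := fun s _ => by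
      have a1 : HasFDerivAt w (fderiv ℝ w (x - s • y)) (x - s • y) :=
        (hw.differentiable (by simp) _).hasFDerivAt
      have a2 : HasDerivAt (fun s : ℝ => x - s • y) (-y) s := by
        simpa using ((hasDerivAt_id s).smul_const y).const_sub x
      have a3 := a1.comp_hasDerivAt s a2
      rw [map_neg] at a3
      exact a3
    have hcs : Continuous (fun s : ℝ => -(fderiv ℝ w (x - s • y) y)) :=
      (hfc.comp (by fun_prop : Continuous fun s : ℝ => x - s • y)).neg
    have e := intervalIntegral.integral_eq_sub_of_hasDerivAt hd (hcs.intervalIntegrable _ _)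
    simp only [one_smul, zero_smul, sub_zero] at e
    rw [← e, intervalIntegral.integral_of_le zero_le_one]
    calc _ ≤ (∫⁻ s in Ioc (0 : ℝ) 1, 1 * ‖fderiv ℝ w (x - s • y) y‖ₑ) ^ 2 := by
          refine pow_le_pow_left' ?_ 2
          refine (enorm_integral_le_lintegral_enorm _).trans_eq ?_
          simp
      _ ≤ _ := sq_lintegral_mul_le aemeasurable_const
          (hfc.comp (by fun_prop : Continuous fun s : ℝ => x - s • y)).measurable.enorm.aemeasurable
      _ = _ := by simp
  calc _ ≤ ∫⁻ x, ∫⁻ s in Ioc (0 : ℝ) 1, ‖fderiv ℝ w (x - s • y) y‖ₑ ^ 2 := lintegral_mono h1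
    _ = ∫⁻ s in Ioc (0 : ℝ) 1, ∫⁻ x, ‖fderiv ℝ w (x - s • y) y‖ₑ ^ 2 := by
      refine lintegral_lintegral_swap ?_
      exact ((hfc.comp (by fun_prop : Continuous fun p : E d × ℝ =>
        p.1 - p.2 • y)).measurable.enorm.pow_const _).aemeasurable
    _ = ∫⁻ x, ‖fderiv ℝ w x y‖ₑ ^ 2 := by
      have : ∀ s : ℝ, ∫⁻ x, ‖fderiv ℝ w (x - s • y) y‖ₑ ^ 2 = ∫⁻ x, ‖fderiv ℝ w x y‖ₑ ^ 2 :=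
        fun s => lintegral_sub_right_eq_self (fun x => ‖fderiv ℝ w x y‖ₑ ^ 2) _
      simp [this]
    _ ≤ ∫⁻ x, ENNReal.ofReal (‖y‖ ^ 2 * ∑ i, pd i w x ^ 2) := by
      refine lintegral_mono fun x => ?_
      rw [← enorm_pow, Real.enorm_of_nonneg (sq_nonneg _), fderiv_apply_eq_sum]
      exact ENNReal.ofReal_le_ofReal (sq_sum_mul_le _ _)
    _ = _ := by
      rw [← ofReal_integral_eq_lintegral_ofReal]
      · rw [integral_const_mul, integral_finsetSum _ fun i _ => (hi i).integrable_sq]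
        rfl
      · exact (integrable_finsetSum _ fun i _ => (hi i).integrable_sq).const_mul _
      · exact ae_of_all _ fun x => mul_nonneg (sq_nonneg _)
          (Finset.sum_nonneg fun i _ => sq_nonneg _)

/-- `g` is the weak gradient of `h`, expressed through mollifications. -/
def IsWeakGrad (h : E d → ℝ) (g : Fin d → E d → ℝ) : Prop :=
  ∀ k, IsTest k → ∀ i, cv (pd i k) h = cv k (g i)

theorem pd_cv_of_weak {h : E d → ℝ} {g : Fin d → E d → ℝ} (hg : IsWeakGrad h g)
    (hh : MemLp h 2 volume) {k : E d → ℝ} (hk : IsTest k) (i : Fin d) :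
    pd i (cv k h) = cv k (g i) := by
  rw [pd_cv hk (MemLp.locInt hh), hg k hk]

theorem sqInt_translate_sub_le {h : E d → ℝ} {g : Fin d → E d → ℝ} (hg : IsWeakGrad h g)
    (hh : MemLp h 2 volume) (hgi : ∀ i, MemLp (g i) 2 volume) (y : E d) :
    sqInt (fun x => h (x - y) - h x) ≤ ‖y‖ ^ 2 * ∑ i, sqInt (g i) := by
  have hτ : ∀ {h : E d → ℝ}, MemLp h 2 volume → MemLp (fun x => h (x - y)) 2 volume := fun hh =>
    hh.comp_measurePreserving (measurePreserving_sub_right volume y)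
  have hw : ∀ n, MemLp (cv (mol d n) h) 2 volume := fun n => memLp_cv (isTest_mol n) hh
  have h1 : Tendsto (fun n => sqInt (fun x => cv (mol d n) h (x - y) - cv (mol d n) h x)) atTop
      (𝓝 (sqInt (fun x => h (x - y) - h x))) := by
    refine tendsto_sqInt (fun n => (hτ (hw n)).sub (hw n)) ((hτ hh).sub hh) ?_
    have h4 := (tendsto_sqInt_cv_mol_sub hh).const_mul 4
    rw [mul_zero] at h4
    refine squeeze_zero (fun n => sqInt_nonneg _) (fun n => ?_) h4
    have e1 : (fun x => cv (mol d n) h (x - y) - cv (mol d n) h x - (h (x - y) - h x)) =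
      fun x => (cv (mol d n) h (x - y) - h (x - y)) - (cv (mol d n) h x - h x) := by
      funext x; ring
    rw [e1]
    refine (sqInt_sub_le ((hτ (hw n)).sub (hτ hh)) ((hw n).sub hh)).trans_eq ?_
    have : sqInt (fun x => cv (mol d n) h (x - y) - h (x - y)) =
        sqInt (fun x => cv (mol d n) h x - h x) :=
      integral_sub_right_eq_self (fun x => (cv (mol d n) h x - h x) ^ 2) y
    change 2 * sqInt (fun x => cv (mol d n) h (x - y) - h (x - y)) +
      2 * sqInt (fun x => cv (mol d n) h x - h x) = _
    rw [this]; ring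
  refine le_of_tendsto' h1 fun n => ?_
  have hp := pd_cv_of_weak hg hh (isTest_mol n)
  refine (sqInt_translate_sub_le_of_smooth (contDiff_cv (isTest_mol n) (MemLp.locInt hh)) (hw n)
    (fun i => ?_) y).trans ?_
  · rw [hp]; exact memLp_cv (isTest_mol n) (hgi i)
  · gcongr with i
    rw [hp]; exact sqInt_cv_mol_le n (hgi i)

/-- The high frequency half of Fourier splitting: what mollification at scale `ε` discards is paid
for by the dissipation. -/
theorem sqInt_cv_kern_sub_le {h : E d → ℝ} {g : Fin d → E d → ℝ} (hg : IsWeakGrad h g)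
    (hh : MemLp h 2 volume) (hgi : ∀ i, MemLp (g i) 2 volume) {ε : ℝ} (hε : 0 < ε) :
    sqInt (fun x => cv (kern d ε) h x - h x) ≤ ε ^ 2 * ∑ i, sqInt (g i) := by
  have hS : 0 ≤ ∑ i, sqInt (g i) := Finset.sum_nonneg fun i _ => sqInt_nonneg _
  refine sqInt_cv_sub_self_le (isTest_kern hε) (kern_nonneg hε) (integral_kern hε) hh
    (by positivity) fun y hy => ?_
  refine (sqInt_translate_sub_le hg hh hgi y).trans ?_
  gcongr
  exact norm_le_of_kern_ne_zero hε hy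

/-! ### Divergence-free fields with bounded Jacobian: boundedness and integration by parts. -/

theorem norm_fderiv_apply_le (w : E d → ℝ) (x v : E d) :
    ‖fderiv ℝ w x v‖ ≤ ‖v‖ * ∑ i, |pd i w x| := by
  rw [fderiv_apply_eq_sum, Finset.mul_sum]
  refine (norm_sum_le _ _).trans (Finset.sum_le_sum fun i _ => ?_)
  rw [norm_mul]
  exact mul_le_mul_of_nonneg_right (PiLp.norm_apply_le v i) (abs_nonneg _)

theorem contDiff_pd {w : E d → ℝ} (hw : ContDiff ℝ ∞ w) (i : Fin d) : ContDiff ℝ ∞ (pd i w) :=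
  (hw.fderiv_right (m := ∞) (by simp)).clm_apply contDiff_const

theorem pd_mul {v w : E d → ℝ} (hv : ContDiff ℝ ∞ v) (hw : ContDiff ℝ ∞ w) (i : Fin d) (x : E d) :
    pd i (fun x => v x * w x) x = v x * pd i w x + w x * pd i v x := by
  unfold pd
  rw [fderiv_fun_mul (hv.differentiable (by simp) _) (hw.differentiable (by simp) _)]
  simp

theorem pd_comm {w : E d → ℝ} (hw : ContDiff ℝ ∞ w) (i j : Fin d) : pd i (pd j w) = pd j (pd i w) := by
  have hd : Differentiable ℝ (fderiv ℝ w) :=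
    (hw.fderiv_right (m := ∞) (by simp)).differentiable (by simp)
  have h : ∀ (i j : Fin d) x, pd i (pd j w) x = fderiv ℝ (fderiv ℝ w) x (stdE i) (stdE j) :=
    fun i j x => by
      change fderiv ℝ (fun x => fderiv ℝ w x (stdE j)) x (stdE i) = _
      rw [fderiv_clm_apply (hd x) (differentiableAt_const _)]
      simp
  funext x
  rw [h, h]
  exact ((contDiff_infty.1 hw 2).contDiffAt.isSymmSndFDerivAt (by simp)).eq _ _

/-- A weak identity tested with compactly supported functions extends to integrable functions with
integrable gradient when the coefficients are bounded. -/
theorem integral_eq_zero_of_test {b : E d → E d} {c : E d → ℝ} {K K' : ℝ}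
    (hb : AEStronglyMeasurable b volume) (hbK : ∀ᵐ x, ‖b x‖ ≤ K)
    (hc : AEStronglyMeasurable c volume) (hcK : ∀ᵐ x, ‖c x‖ ≤ K')
    (H : ∀ φ, IsTest φ → ∫ x, (fderiv ℝ φ x (b x) + φ x * c x) = 0)
    {ψ : E d → ℝ} (hψ : ContDiff ℝ ∞ ψ) (hψi : Integrable ψ volume)
    (hψd : ∀ i, Integrable (pd i ψ) volume) :
    ∫ x, (fderiv ℝ ψ x (b x) + ψ x * c x) = 0 := by
  let χ : ContDiffBump (0 : E d) := ⟨1, 2, by norm_num, by norm_num⟩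
  have hχ : ContDiff ℝ ∞ χ := χ.contDiff
  have hχs : HasCompactSupport χ := χ.hasCompactSupport
  obtain ⟨C, hC⟩ := (hχ.continuous_fderiv (by simp)).bounded_above_of_compact_support
    (hχs.fderiv (𝕜 := ℝ))
  have hC0 : 0 ≤ C := (norm_nonneg _).trans (hC 0)
  let s : ℕ → ℝ := fun n => 1 / ((n : ℝ) + 1)
  -- The cutoffs `χ(s n • x)` have gradient of order `s n`, so the term in which the derivative hits
  -- the cutoff vanishes in the limit.
  have hs0 : ∀ n, 0 < s n := fun n => by positivity
  have hs1 : ∀ n, s n ≤ 1 := fun n => by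
    simp only [s]; rw [div_le_one (by positivity)]; linarith [(n.cast_nonneg : (0 : ℝ) ≤ n)]
  have hs : Tendsto s atTop (𝓝 0) := tendsto_one_div_add_atTop_nhds_zero_nat
  let φ : ℕ → E d → ℝ := fun n x => χ (s n • x)
  have hφc : ∀ n, ContDiff ℝ ∞ (φ n) := fun n => hχ.comp (contDiff_const_smul _)
  have hφt : ∀ n, IsTest (φ n) := fun n => ⟨hφc n, hχs.comp_smul (hs0 n).ne'⟩
  have hφd : ∀ n x v, fderiv ℝ (φ n) x v = s n * fderiv ℝ χ (s n • x) v := fun n x v => by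
    have h1 : HasFDerivAt χ (fderiv ℝ χ (s n • x)) (s n • x) :=
      (hχ.differentiable (by simp) _).hasFDerivAt
    have h2 : HasFDerivAt (fun y : E d => s n • y) (s n • ContinuousLinearMap.id ℝ (E d)) x :=
      (hasFDerivAt_id x).const_smul (s n)
    change fderiv ℝ (χ ∘ fun y => s n • y) x v = _
    rw [(h1.comp x h2).fderiv]
    simp
  have hprod : ∀ n x v, fderiv ℝ (fun x => ψ x * φ n x) x v =
      ψ x * (s n * fderiv ℝ χ (s n • x) v) + φ n x * fderiv ℝ ψ x v := fun n x v => by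
    rw [fderiv_fun_mul (hψ.differentiable (by simp) _) ((hφc n).differentiable (by simp) _)]
    simp [hφd]
  have hlim : Tendsto (fun n => ∫ x, (fderiv ℝ (fun x => ψ x * φ n x) x (b x)
      + (ψ x * φ n x) * c x)) atTop (𝓝 (∫ x, (fderiv ℝ ψ x (b x) + ψ x * c x))) := by
    refine tendsto_integral_of_dominated_convergence
      (fun x => |ψ x| * (C * K) + K * ∑ i, |pd i ψ x| + |ψ x| * K') (fun n => ?_) ?_ (fun n => ?_) ?_
    · refine AEStronglyMeasurable.add ?_ ?_
      · have : Continuous (fderiv ℝ (fun x => ψ x * φ n x)) :=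
          (hψ.mul (hφc n)).continuous_fderiv (by simp)
        exact isBoundedBilinearMap_apply.continuous.comp_aestronglyMeasurable
          (this.aestronglyMeasurable.prodMk hb)
      · exact (hψ.continuous.mul (hφc n).continuous).aestronglyMeasurable.mul hc
    · exact ((hψi.abs.mul_const _).add ((integrable_finsetSum _ fun i _ =>
        (hψd i).abs).const_mul _)).add (hψi.abs.mul_const _)
    · filter_upwards [hbK, hcK] with x hbx hcx
      have hφ1 : |φ n x| ≤ 1 := by
        rw [abs_of_nonneg χ.nonneg]; exact χ.le_one
      have hK : 0 ≤ K := (norm_nonneg _).trans hbx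
      rw [hprod]
      have t1 : ‖ψ x * (s n * fderiv ℝ χ (s n • x) (b x))‖ ≤ |ψ x| * (C * K) := by
        rw [norm_mul, norm_mul, Real.norm_of_nonneg (hs0 n).le]
        refine mul_le_mul_of_nonneg_left ?_ (abs_nonneg _)
        calc s n * ‖fderiv ℝ χ (s n • x) (b x)‖ ≤ 1 * (C * K) := by
              refine mul_le_mul (hs1 n) ?_ (norm_nonneg _) zero_le_one
              refine (ContinuousLinearMap.le_opNorm _ _).trans ?_
              exact mul_le_mul (hC _) hbx (norm_nonneg _) hC0
          _ = _ := one_mul _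
      have t2 : ‖φ n x * fderiv ℝ ψ x (b x)‖ ≤ K * ∑ i, |pd i ψ x| := by
        rw [norm_mul]
        calc |φ n x| * ‖fderiv ℝ ψ x (b x)‖ ≤ 1 * ‖fderiv ℝ ψ x (b x)‖ :=
              mul_le_mul_of_nonneg_right hφ1 (norm_nonneg _)
          _ ≤ ‖b x‖ * ∑ i, |pd i ψ x| := by rw [one_mul]; exact norm_fderiv_apply_le _ _ _
          _ ≤ _ := mul_le_mul_of_nonneg_right hbx (Finset.sum_nonneg fun i _ => abs_nonneg _)
      have t3 : ‖ψ x * φ n x * c x‖ ≤ |ψ x| * K' := by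
        rw [norm_mul, norm_mul]
        refine mul_le_mul ?_ hcx (norm_nonneg _) (abs_nonneg _)
        exact mul_le_of_le_one_right (abs_nonneg _) hφ1
      exact (norm_add_le _ _).trans (add_le_add ((norm_add_le _ _).trans (add_le_add t1 t2)) t3)
    · refine ae_of_all _ fun x => ?_
      have hsx : Tendsto (fun n => s n • x) atTop (𝓝 0) := by simpa using hs.smul_const x
      have a1 : Tendsto (fun n => φ n x) atTop (𝓝 1) := by
        have := (χ.continuous.tendsto 0).comp hsx
        have h0 : χ 0 = 1 := χ.one_of_mem_closedBall (by simp [χ])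
        rwa [h0] at this
      have a2 : Tendsto (fun n => s n * fderiv ℝ χ (s n • x) (b x)) atTop (𝓝 0) := by
        have hcc : Continuous fun y => fderiv ℝ χ y (b x) :=
          (hχ.continuous_fderiv (by simp)).clm_apply continuous_const
        have := hs.mul ((hcc.tendsto 0).comp hsx)
        simpa using this
      simp only [hprod]
      have := ((a2.const_mul (ψ x)).add (a1.mul_const (fderiv ℝ ψ x (b x)))).add
        ((a1.const_mul (ψ x)).mul_const (c x))
      simpa using this
  have hz : ∀ n, ∫ x, (fderiv ℝ (fun x => ψ x * φ n x) x (b x) + (ψ x * φ n x) * c x) = 0 :=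
    fun n => H _ ((hφt n).mul_left hψ)
  simp only [hz] at hlim
  exact (tendsto_nhds_unique hlim tendsto_const_nhds)

/-- A square integrable divergence-free field with weak Jacobian bounded by `a`. -/
structure RegVel (V : E d → E d) (a : ℝ) : Prop where
  memLp : MemLp V 2 volume
  div : IsDivFree V
  grad : ∃ A : E d → (E d →L[ℝ] E d), HasWeakFDeriv V A ∧ ∀ᵐ x, ‖A x‖ ≤ a

theorem abs_apply_le_norm (y : E d) (i : Fin d) : |y i| ≤ ‖y‖ := PiLp.norm_apply_le y i

theorem memLp_coord {V : E d → E d} (hV : MemLp V 2 volume) (i : Fin d) :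
    MemLp (fun x => V x i) 2 volume :=
  (EuclideanSpace.proj (𝕜 := ℝ) i).comp_memLp' hV

theorem aesm_coord {V : E d → E d} (hV : AEStronglyMeasurable V volume) (i : Fin d) :
    AEStronglyMeasurable (fun x => V x i) volume :=
  (EuclideanSpace.proj (𝕜 := ℝ) i).continuous.comp_aestronglyMeasurable hV

theorem weakFDeriv_coord {V : E d → E d} {A : E d → (E d →L[ℝ] E d)} (hA : HasWeakFDeriv V A)
    {φ : E d → ℝ} (hφ : IsTest φ) (i j : Fin d) :
    ∫ x, pd j φ x * V x i = - ∫ x, φ x * A x (stdE j) i := by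
  have h := congrArg (EuclideanSpace.proj (𝕜 := ℝ) i) (hA.2.2 φ hφ (stdE j))
  have i1 : Integrable (fun x => fderiv ℝ φ x (stdE j) • V x) volume :=
    hA.1.integrable_smul_left_of_hasCompactSupport (hφ.pd j).continuous (hφ.pd j).2
  have i2 : Integrable (fun x => φ x • A x (stdE j)) volume := by
    have := (hA.2.1.integrable_smul_left_of_hasCompactSupport hφ.continuous hφ.2)
    exact (ContinuousLinearMap.apply ℝ (E d) (stdE j)).integrable_comp this
  rw [map_neg, ← ContinuousLinearMap.integral_comp_comm _ i1,
    ← ContinuousLinearMap.integral_comp_comm _ i2] at h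
  simpa [pd] using h

/-- A function with bounded gradient differs from its average at unit scale by a bounded amount, and
that average is controlled by the `L²` norm. The argument is run on mollifications with bounds
independent of `n`. -/
theorem ae_abs_le_of_bounded_weakGrad {v : E d → ℝ} {b : Fin d → E d → ℝ} {a : ℝ}
    (hv : MemLp v 2 volume) (hb : IsWeakGrad v b) (ha : ∀ j, ∀ᵐ x, |b j x| ≤ a) (ha0 : 0 ≤ a) :
    ∀ᵐ x, |v x| ≤ d * a + √(sqInt (kern d 1) * sqInt v) := by
  have hn : ∀ n x, |cv (mol d n) v x| ≤ d * a + √(sqInt (kern d 1) * sqInt v) := fun n x => by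
    have hε : (0 : ℝ) < 1 / ((n : ℝ) + 1) := by positivity
    set w := cv (mol d n) v with hw
    have hws : ContDiff ℝ ∞ w := contDiff_cv (isTest_mol n) (MemLp.locInt hv)
    have hw2 : MemLp w 2 volume := memLp_cv (isTest_mol n) hv
    have hwd : ∀ j x, |pd j w x| ≤ a := fun j x => by
      rw [hw, pd_cv_of_weak hb hv (isTest_mol n)]
      have : ∀ᵐ y, ‖mol d n (x - y) * b j y‖ ≤ mol d n (x - y) * a := by
        filter_upwards [ha j] with y hy
        rw [norm_mul, mol, Real.norm_of_nonneg (kern_nonneg hε _)]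
        exact mul_le_mul_of_nonneg_left hy (kern_nonneg hε _)
      have h2 := norm_integral_le_of_norm_le
        (((isTest_mol n).comp_sub x).integrable.mul_const a) this
      rw [integral_mul_const, integral_sub_left_eq_self (fun y => mol d n y) volume x] at h2
      rw [mol, integral_kern hε, one_mul] at h2
      exact h2
    have hwf : ∀ x, ‖fderiv ℝ w x‖ ≤ d * a := fun x => by
      refine ContinuousLinearMap.opNorm_le_bound _ (by positivity) fun v => ?_
      refine (norm_fderiv_apply_le w x v).trans ?_
      rw [mul_comm]
      refine mul_le_mul_of_nonneg_right ?_ (norm_nonneg _)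
      refine (Finset.sum_le_sum fun j _ => hwd j x).trans_eq ?_
      simp
    have hLip : ∀ x y, ‖w y - w x‖ ≤ d * a * ‖y - x‖ := fun x y =>
      convex_univ.norm_image_sub_le_of_norm_fderiv_le
        (fun x _ => hws.differentiable (by simp) x) (fun x _ => hwf x) (mem_univ _) (mem_univ _)
    have hk := isTest_kern (d := d) (zero_lt_one)
    have e : w x - cv (kern d 1) w x = ∫ y, kern d 1 (x - y) * (w x - w y) := by
      simp only [mul_sub]
      rw [integral_sub ((hk.comp_sub x).integrable.mul_const _)
        (integrable_cv_integrand hk (MemLp.locInt hw2) x), integral_mul_const,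
        integral_sub_left_eq_self (fun y => kern d 1 y) volume x, integral_kern zero_lt_one, one_mul]
      rfl
    have h3 : |w x - cv (kern d 1) w x| ≤ d * a := by
      rw [e]
      have h4 := norm_integral_le_of_norm_le (f := fun y => kern d 1 (x - y) * (w x - w y))
        (((hk.comp_sub x).integrable.mul_const ((d : ℝ) * a)))
        (ae_of_all _ fun y => by
          rw [norm_mul, Real.norm_of_nonneg (kern_nonneg zero_lt_one _)]
          by_cases hz : kern d 1 (x - y) = 0
          · simp [hz]
          · refine mul_le_mul_of_nonneg_left ?_ (kern_nonneg zero_lt_one _)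
            refine (hLip y x).trans ?_
            exact mul_le_of_le_one_right (by positivity) (norm_le_of_kern_ne_zero zero_lt_one hz))
      rwa [integral_mul_const, integral_sub_left_eq_self (fun y => kern d 1 y) volume x,
        integral_kern zero_lt_one, one_mul] at h4
    have h5 : |cv (kern d 1) w x| ≤ √(sqInt (kern d 1) * sqInt v) := by
      refine Real.abs_le_sqrt ((sq_cv_le hk hw2 x).trans ?_)
      exact mul_le_mul_of_nonneg_left (sqInt_cv_mol_le n hv) (sqInt_nonneg _)
    have := abs_add_le (w x - cv (kern d 1) w x) (cv (kern d 1) w x)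
    rw [sub_add_cancel] at this
    linarith
  -- `L²` convergence yields almost everywhere convergence along a subsequence, which transfers the
  -- uniform bound to `v`.
  have hm : TendstoInMeasure volume (fun n => cv (mol d n) v) atTop v := by
    refine tendstoInMeasure_of_tendsto_eLpNorm (p := 2) (by simp)
      (fun n => (memLp_cv (isTest_mol n) hv).1) hv.1 ?_
    have : ∀ n, eLpNorm (cv (mol d n) v - v) 2 volume =
        ENNReal.ofReal (√(sqInt (fun x => cv (mol d n) v x - v x))) := fun n =>
      eLpNorm_eq_sqrt (memLp_sub (memLp_cv (isTest_mol n) hv) hv)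
    simp only [this]
    rw [← ENNReal.ofReal_zero, ← Real.sqrt_zero]
    exact ENNReal.tendsto_ofReal (tendsto_sqInt_cv_mol_sub hv).sqrt
  obtain ⟨ns, -, hns⟩ := hm.exists_seq_tendsto_ae
  filter_upwards [hns] with x hx
  exact le_of_tendsto' hx.abs fun n => hn _ x

theorem isWeakGrad_of_hasWeakFDeriv {h : E d → ℝ} {A : E d → (E d →L[ℝ] ℝ)}
    (hA : HasWeakFDeriv h A) : IsWeakGrad h (fun i x => A x (stdE i)) :=
  fun _ hk i => cv_pd_eq hA hk i

theorem isWeakGrad_coord {V : E d → E d} {A : E d → (E d →L[ℝ] E d)} (hA : HasWeakFDeriv V A)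
    (i : Fin d) : IsWeakGrad (fun x => V x i) (fun j x => A x (stdE j) i) := by
  intro k hk j
  funext x
  have := weakFDeriv_coord hA (hk.comp_sub x) i j
  simp only [pd_comp_sub hk, neg_mul] at this
  rw [integral_neg, neg_inj] at this
  exact this

theorem norm_stdE (i : Fin d) : ‖(stdE i : E d)‖ = 1 := by simp [stdE]

theorem abs_coord_apply_le (L : E d →L[ℝ] E d) (i j : Fin d) : |L (stdE j) i| ≤ ‖L‖ := by
  refine (abs_apply_le_norm _ i).trans ((L.le_opNorm _).trans_eq ?_)
  rw [norm_stdE, mul_one]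

/-- The bound involves only the Jacobian bound and the `L²` norms of the components, hence is
uniform over bounded time intervals. It makes the transport term square integrable. -/
theorem ae_norm_le_sum {V : E d → E d} {a : ℝ} (hV : RegVel V a) (ha : 0 ≤ a) :
    ∀ᵐ x, ‖V x‖ ≤ ∑ i : Fin d, (d * a + √(sqInt (kern d 1) * sqInt (fun x => V x i))) := by
  obtain ⟨A, hA, hAa⟩ := hV.grad
  have h : ∀ i : Fin d, ∀ᵐ x, |V x i| ≤ d * a + √(sqInt (kern d 1) * sqInt (fun x => V x i)) :=
    fun i => ae_abs_le_of_bounded_weakGrad (memLp_coord hV.memLp i) (isWeakGrad_coord hA i)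
      (fun j => by
        filter_upwards [hAa] with x hx
        exact (abs_coord_apply_le _ i j).trans hx) ha
  filter_upwards [ae_all_iff.2 h] with x hx
  calc ‖V x‖ = ‖∑ i, V x i • stdE i‖ := by rw [sum_smul_stdE]
    _ ≤ ∑ i, |V x i| := by
      refine (norm_sum_le _ _).trans_eq ?_
      simp [norm_smul, norm_stdE]
    _ ≤ _ := Finset.sum_le_sum fun i _ => hx i

/-- `V · g`. -/
noncomputable def adv (V : E d → E d) (g : Fin d → E d → ℝ) : E d → ℝ :=
  fun x => ∑ i, V x i * g i x

theorem memLp_coord_mul {V : E d → E d} {K : ℝ} (hV : AEStronglyMeasurable V volume)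
    (hK : ∀ᵐ x, ‖V x‖ ≤ K) {h : E d → ℝ} (hh : MemLp h 2 volume) (i : Fin d) :
    MemLp (fun x => V x i * h x) 2 volume := by
  refine MemLp.of_le_mul (c := K) hh ((aesm_coord hV i).mul hh.1) ?_
  filter_upwards [hK] with x hx
  rw [norm_mul]
  exact mul_le_mul_of_nonneg_right ((abs_apply_le_norm _ i).trans hx) (norm_nonneg _)

theorem memLp_adv {V : E d → E d} {K : ℝ} (hV : AEStronglyMeasurable V volume)
    (hK : ∀ᵐ x, ‖V x‖ ≤ K) {g : Fin d → E d → ℝ} (hg : ∀ i, MemLp (g i) 2 volume) :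
    MemLp (adv V g) 2 volume :=
  memLp_finsetSum (f := fun i x => V x i * g i x) _ fun i _ => memLp_coord_mul hV hK (hg i) i

theorem sqInt_adv_le {V : E d → E d} {K : ℝ} (hV : AEStronglyMeasurable V volume)
    (hK : ∀ᵐ x, ‖V x‖ ≤ K) {g : Fin d → E d → ℝ} (hg : ∀ i, MemLp (g i) 2 volume) :
    sqInt (adv V g) ≤ K ^ 2 * ∑ i, sqInt (g i) := by
  unfold sqInt
  rw [← integral_finsetSum _ fun i _ => (hg i).integrable_sq, ← integral_const_mul]
  refine integral_mono_ae (memLp_adv hV hK hg).integrable_sq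
    ((integrable_finsetSum _ fun i _ => (hg i).integrable_sq).const_mul _) ?_
  filter_upwards [hK] with x hx
  refine (sq_sum_mul_le _ _).trans ?_
  exact mul_le_mul_of_nonneg_right (pow_le_pow_left₀ (norm_nonneg _) hx 2)
    (Finset.sum_nonneg fun i _ => sq_nonneg _)

theorem integral_mul_pd {p q : E d → ℝ} (hp : ContDiff ℝ ∞ p) (hq : ContDiff ℝ ∞ q)
    (hp2 : MemLp p 2 volume) (hq2 : MemLp q 2 volume) (j : Fin d)
    (hpj : MemLp (pd j p) 2 volume) (hqj : MemLp (pd j q) 2 volume) :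
    ∫ x, p x * pd j q x = - ∫ x, pd j p x * q x :=
  integral_mul_fderiv_eq_neg_fderiv_mul_of_integrable (MemLp.integrable_mul' hpj hq2)
    (MemLp.integrable_mul' hp2 hqj) (MemLp.integrable_mul' hp2 hq2)
    (fun x _ => hp.differentiable (by simp) x) (fun x _ => hq.differentiable (by simp) x)

/-- Incompressibility tested with `w²`, which is integrable with integrable gradient but need not
have compact support. -/
theorem integral_mul_adv_eq_zero {V : E d → E d} {a K : ℝ} (hV : RegVel V a)
    (hK : ∀ᵐ x, ‖V x‖ ≤ K) {w : E d → ℝ} (hw : ContDiff ℝ ∞ w) (hw2 : MemLp w 2 volume)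
    (hwd : ∀ i, MemLp (pd i w) 2 volume) :
    ∫ x, w x * adv V (fun i => pd i w) x = 0 := by
  have h := integral_eq_zero_of_test (b := V) (c := fun _ => 0) (K' := 0) hV.memLp.1 hK
    aestronglyMeasurable_const (by simp) (fun φ hφ => by simpa using hV.div φ hφ)
    (ψ := fun x => w x * w x) (hw.mul hw) (MemLp.integrable_mul' hw2 hw2) (fun i => by
      have : pd i (fun x => w x * w x) = fun x => w x * pd i w x + w x * pd i w x := by
        funext x; rw [pd_mul hw hw]
      rw [this]
      exact (MemLp.integrable_mul' hw2 (hwd i)).add (MemLp.integrable_mul' hw2 (hwd i)))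
  have e : ∀ x, fderiv ℝ (fun x => w x * w x) x (V x) + w x * w x * 0 =
      2 * (w x * adv V (fun i => pd i w) x) := fun x => by
    rw [fderiv_apply_eq_sum, mul_zero, add_zero, adv, Finset.mul_sum, Finset.mul_sum]
    refine Finset.sum_congr rfl fun i _ => ?_
    rw [pd_mul hw hw]; ring
  simp only [e, integral_const_mul] at h
  linarith

theorem abs_quadratic_le (L : E d →L[ℝ] E d) (p : Fin d → ℝ) :
    |∑ i, ∑ j, p j * p i * L (stdE j) i| ≤ ‖L‖ * ∑ i, p i ^ 2 := by
  let P : E d := WithLp.toLp 2 p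
  have hP : ‖P‖ ^ 2 = ∑ i, p i ^ 2 := EuclideanSpace.real_norm_sq_eq P
  have h1 : L P = ∑ j, p j • L (stdE j) := by
    conv_lhs => rw [← sum_smul_stdE P]
    rw [map_sum]
    simp [P]
  have h2 : ∑ i, ∑ j, p j * p i * L (stdE j) i = inner ℝ P (L P) := by
    rw [h1, PiLp.inner_apply]
    refine Finset.sum_congr rfl fun i _ => ?_
    simp [P, Finset.sum_mul]
    refine Finset.sum_congr rfl fun j _ => ?_
    ring
  rw [h2, ← hP]
  refine (abs_real_inner_le_norm _ _).trans ?_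
  calc ‖P‖ * ‖L P‖ ≤ ‖P‖ * (‖L‖ * ‖P‖) := by gcongr; exact L.le_opNorm _
    _ = _ := by ring

/-- Integration by parts moves one derivative from `Δw` onto `V·∇w`. When it hits `∇w`, the result
is transport of `|∇w|²/2`, which vanishes since `div V = 0`. When it hits `V`, the Jacobian appears
as a quadratic form in `∇w`, bounded by its operator norm. Only the weak Jacobian of `V` is
available, so its defining identity is tested with products of derivatives of `w`. -/
theorem integral_laplacian_mul_adv_le {V : E d → E d} {a K : ℝ} (hV : RegVel V a)
    (hK : ∀ᵐ x, ‖V x‖ ≤ K) {w : E d → ℝ} (hw : ContDiff ℝ ∞ w)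
    (hwd : ∀ i, MemLp (pd i w) 2 volume) (hwdd : ∀ i j, MemLp (pd j (pd i w)) 2 volume) :
    ∫ x, (∑ j, pd j (pd j w) x) * adv V (fun i => pd i w) x ≤ a * ∑ i, sqInt (pd i w) := by
  obtain ⟨A, hA, hAa⟩ := hV.grad
  have hd := contDiff_pd hw
  have hVm := hV.memLp.1
  have hprod : ∀ i j, Integrable (fun x => pd j w x * pd i w x) volume := fun i j =>
    MemLp.integrable_mul' (hwd j) (hwd i)
  have hprodd : ∀ i j l, pd l (fun x => pd j w x * pd i w x) =
      fun x => pd j w x * pd l (pd i w) x + pd i w x * pd l (pd j w) x := fun i j l => by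
    funext x; rw [pd_mul (hd j) (hd i)]
  have hprodi : ∀ i j l, Integrable (pd l (fun x => pd j w x * pd i w x)) volume := fun i j l => by
    rw [hprodd]
    exact (MemLp.integrable_mul' (hwd j) (hwdd i l)).add (MemLp.integrable_mul' (hwd i) (hwdd j l))
  have hVij : ∀ i j l (m : Fin d), Integrable (fun x => V x m * (pd i w x * pd l (pd j w) x)) volume :=
    fun i j l m => by
      have := MemLp.integrable_mul' (memLp_coord_mul hVm hK (hwd i) m) (hwdd j l)
      simpa [mul_assoc] using this
  have hAm : ∀ i j, AEStronglyMeasurable (fun x => A x (stdE j) i) volume := fun i j =>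
    aesm_coord (hA.2.1.aestronglyMeasurable.apply_continuousLinearMap _) i
  have hAi : ∀ i j, Integrable (fun x => pd j w x * pd i w x * A x (stdE j) i) volume :=
    fun i j => by
      refine (hprod i j).mul_bdd (c := a) (hAm i j) ?_
      filter_upwards [hAa] with x hx
      exact (abs_coord_apply_le _ i j).trans hx
  -- the weak Jacobian of `V` tested with `∂_j w ∂_i w`
  have key1 : ∀ i j, (∫ x, V x i * (pd i w x * pd j (pd j w) x)) +
      (∫ x, V x i * (pd j w x * pd j (pd i w) x)) +
      (∫ x, pd j w x * pd i w x * A x (stdE j) i) = 0 := fun i j => by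
    have h := integral_eq_zero_of_test (b := fun x => V x i • stdE j)
      (c := fun x => A x (stdE j) i) (K := K) (K' := a)
      ((aesm_coord hVm i).smul_const _)
      (by
        filter_upwards [hK] with x hx
        rw [norm_smul, norm_stdE, mul_one]
        exact (abs_apply_le_norm _ i).trans hx)
      (hAm i j)
      (by
        filter_upwards [hAa] with x hx
        exact (abs_coord_apply_le _ i j).trans hx)
      (fun φ hφ => by
        have e := weakFDeriv_coord hA hφ i j
        have i1 : Integrable (fun x => pd j φ x * V x i) volume :=
          MemLp.integrable_mul' ((hφ.pd j).memLp 2) (memLp_coord hV.memLp i)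
        have i2 : Integrable (fun x => φ x * A x (stdE j) i) volume := by
          refine hφ.integrable.mul_bdd (c := a) (hAm i j) ?_
          filter_upwards [hAa] with x hx
          exact (abs_coord_apply_le _ i j).trans hx
        have e2 : ∀ x, fderiv ℝ φ x (V x i • stdE j) + φ x * A x (stdE j) i =
            pd j φ x * V x i + φ x * A x (stdE j) i := fun x => by
          simp [pd, mul_comm]
        simp only [e2]
        rw [integral_add i1 i2, e, neg_add_cancel])
      (ψ := fun x => pd j w x * pd i w x) ((hd j).mul (hd i)) (hprod i j)
      (fun l => hprodi i j l)
    have e3 : ∀ x, fderiv ℝ (fun x => pd j w x * pd i w x) x (V x i • stdE j) +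
        pd j w x * pd i w x * A x (stdE j) i = V x i * (pd i w x * pd j (pd j w) x) +
        V x i * (pd j w x * pd j (pd i w) x) + pd j w x * pd i w x * A x (stdE j) i := fun x => by
      have := congrFun (hprodd i j j) x
      rw [map_smul]
      change V x i • pd j (fun x => pd j w x * pd i w x) x + _ = _
      rw [this, smul_eq_mul]; ring
    simp only [e3] at h
    rw [integral_add ((hVij i j j i).fun_add (hVij j i j i)) (hAi i j),
      integral_add (hVij i j j i) (hVij j i j i)] at h
    exact h
  -- incompressibility tested with `(∂_j w)²`
  have key2 : ∀ j, ∑ i, ∫ x, V x i * (pd j w x * pd j (pd i w) x) = 0 := fun j => by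
    have h := integral_eq_zero_of_test (b := V) (c := fun _ => 0) (K' := 0) hV.memLp.1 hK
      aestronglyMeasurable_const (by simp) (fun φ hφ => by simpa using hV.div φ hφ)
      (ψ := fun x => pd j w x * pd j w x) ((hd j).mul (hd j)) (hprod j j) (fun l => hprodi j j l)
    have e : ∀ x, fderiv ℝ (fun x => pd j w x * pd j w x) x (V x) + pd j w x * pd j w x * 0 =
        2 * ∑ i, V x i * (pd j w x * pd j (pd i w) x) := fun x => by
      rw [fderiv_apply_eq_sum, mul_zero, add_zero, Finset.mul_sum]
      refine Finset.sum_congr rfl fun i _ => ?_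
      rw [hprodd, pd_comm hw i j]; ring
    simp only [e, integral_const_mul] at h
    rw [integral_finsetSum _ fun i _ => hVij j i j i] at h
    linarith
  have e1 : ∫ x, (∑ j, pd j (pd j w) x) * adv V (fun i => pd i w) x =
      ∑ i, ∑ j, ∫ x, V x i * (pd i w x * pd j (pd j w) x) := by
    have : ∀ x, (∑ j, pd j (pd j w) x) * adv V (fun i => pd i w) x =
        ∑ i, ∑ j, V x i * (pd i w x * pd j (pd j w) x) := fun x => by
      rw [adv, Finset.sum_mul_sum, Finset.sum_comm]
      refine Finset.sum_congr rfl fun i _ => Finset.sum_congr rfl fun j _ => ?_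
      ring
    simp only [this]
    rw [integral_finsetSum _ fun i _ => integrable_finsetSum _ fun j _ => hVij i j j i]
    exact Finset.sum_congr rfl fun i _ => integral_finsetSum _ fun j _ => hVij i j j i
  have e2 : ∑ i, ∑ j, ∫ x, V x i * (pd j w x * pd j (pd i w) x) = 0 := by
    rw [Finset.sum_comm]
    exact Finset.sum_eq_zero fun j _ => key2 j
  have e3 : ∑ i, ∑ j, ((∫ x, V x i * (pd i w x * pd j (pd j w) x)) +
      (∫ x, V x i * (pd j w x * pd j (pd i w) x)) +
      (∫ x, pd j w x * pd i w x * A x (stdE j) i)) = 0 :=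
    Finset.sum_eq_zero fun i _ => Finset.sum_eq_zero fun j _ => key1 i j
  simp only [Finset.sum_add_distrib] at e3
  rw [e2, add_zero] at e3
  rw [e1, eq_neg_of_add_eq_zero_left e3]
  have e4 : ∑ i, ∑ j, ∫ x, pd j w x * pd i w x * A x (stdE j) i =
      ∫ x, ∑ i, ∑ j, pd j w x * pd i w x * A x (stdE j) i := by
    rw [integral_finsetSum _ fun i _ => integrable_finsetSum _ fun j _ => hAi i j]
    exact Finset.sum_congr rfl fun i _ => (integral_finsetSum _ fun j _ => hAi i j).symm
  rw [e4, ← integral_neg]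
  unfold sqInt
  rw [← integral_finsetSum _ fun i _ => (hwd i).integrable_sq, ← integral_const_mul]
  refine integral_mono_ae (integrable_finsetSum _ fun i _ => integrable_finsetSum _ fun j _ =>
    hAi i j).neg ((integrable_finsetSum _ fun i _ => (hwd i).integrable_sq).const_mul _) ?_
  filter_upwards [hAa] with x hx
  refine (neg_le_abs _).trans ((abs_quadratic_le (A x) (fun i => pd i w x)).trans ?_)
  exact mul_le_mul_of_nonneg_right hx (Finset.sum_nonneg fun i _ => sq_nonneg _)

theorem tendsto_integral_mul {ι : Type*} {l : Filter ι} {f : E d → ℝ} {h : ι → E d → ℝ}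
    {g : E d → ℝ} (hf : MemLp f 2 volume) (hh : ∀ n, MemLp (h n) 2 volume) (hg : MemLp g 2 volume)
    (H : Tendsto (fun n => sqInt (fun x => h n x - g x)) l (𝓝 0)) :
    Tendsto (fun n => ∫ x, f x * h n x) l (𝓝 (∫ x, f x * g x)) := by
  rw [tendsto_iff_norm_sub_tendsto_zero]
  have h1 := (H.const_mul (sqInt f)).sqrt
  rw [mul_zero, Real.sqrt_zero] at h1
  refine squeeze_zero (fun n => norm_nonneg _) (fun n => ?_) h1
  rw [← integral_sub (MemLp.integrable_mul' hf (hh n)) (MemLp.integrable_mul' hf hg)]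
  refine Real.abs_le_sqrt ?_
  simp only [← mul_sub]
  exact sq_integral_mul_le hf (memLp_sub (hh n) hg)

/-- For a divergence-free `V`, `∫ φ V·∇h = -∫ h V·∇φ`. -/
theorem integral_test_mul_adv {V : E d → E d} {a K : ℝ} (hV : RegVel V a)
    (hK : ∀ᵐ x, ‖V x‖ ≤ K) {h : E d → ℝ} {g : Fin d → E d → ℝ} (hh : MemLp h 2 volume)
    (hg : ∀ i, MemLp (g i) 2 volume) (hw : IsWeakGrad h g) {φ : E d → ℝ} (hφ : IsTest φ) :
    ∫ x, φ x * adv V g x = - ∑ i, ∫ x, pd i φ x * (h x * V x i) := by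
  have hVm := hV.memLp.1
  have hL : ∀ {q : E d → ℝ}, MemLp q 2 volume → ∀ n, MemLp (cv (mol d n) q) 2 volume :=
    fun hq n => memLp_cv (isTest_mol n) hq
  -- Incompressibility is tested with `φ` times the mollified `h`, which is an admissible smooth
  -- function; `n → ∞` follows afterwards.
  have hn : ∀ n, (∑ i, ∫ x, (V x i * φ x) * cv (mol d n) (g i) x) +
      ∑ i, ∫ x, (V x i * pd i φ x) * cv (mol d n) h x = 0 := fun n => by
    have hws : ContDiff ℝ ∞ (cv (mol d n) h) := contDiff_cv (isTest_mol n) (MemLp.locInt hh)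
    have h1 := hV.div _ (hφ.mul_left hws)
    have e : ∀ x, fderiv ℝ (fun x => cv (mol d n) h x * φ x) x (V x) =
        (∑ i, (V x i * φ x) * cv (mol d n) (g i) x) +
        ∑ i, (V x i * pd i φ x) * cv (mol d n) h x := fun x => by
      rw [fderiv_apply_eq_sum, ← Finset.sum_add_distrib]
      refine Finset.sum_congr rfl fun i _ => ?_
      rw [pd_mul hws hφ.1, pd_cv_of_weak hw hh (isTest_mol n)]; ring
    simp only [e] at h1
    have i1 : ∀ i, Integrable (fun x => (V x i * φ x) * cv (mol d n) (g i) x) volume := fun i =>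
      MemLp.integrable_mul' (memLp_coord_mul hVm hK (hφ.memLp 2) i) (hL (hg i) n)
    have i2 : ∀ i, Integrable (fun x => (V x i * pd i φ x) * cv (mol d n) h x) volume := fun i =>
      MemLp.integrable_mul' (memLp_coord_mul hVm hK ((hφ.pd i).memLp 2) i) (hL hh n)
    rw [integral_add (integrable_finsetSum _ fun i _ => i1 i)
      (integrable_finsetSum _ fun i _ => i2 i), integral_finsetSum _ fun i _ => i1 i,
      integral_finsetSum _ fun i _ => i2 i] at h1
    exact h1
  have hl : Tendsto (fun n => (∑ i, ∫ x, (V x i * φ x) * cv (mol d n) (g i) x) +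
      ∑ i, ∫ x, (V x i * pd i φ x) * cv (mol d n) h x) atTop
      (𝓝 ((∑ i, ∫ x, (V x i * φ x) * g i x) + ∑ i, ∫ x, (V x i * pd i φ x) * h x)) := by
    refine Tendsto.add (tendsto_finsetSum _ fun i _ => ?_) (tendsto_finsetSum _ fun i _ => ?_)
    · exact tendsto_integral_mul (memLp_coord_mul hVm hK (hφ.memLp 2) i) (hL (hg i)) (hg i)
        (tendsto_sqInt_cv_mol_sub (hg i))
    · exact tendsto_integral_mul (memLp_coord_mul hVm hK ((hφ.pd i).memLp 2) i) (hL hh) hh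
        (tendsto_sqInt_cv_mol_sub hh)
  simp only [hn] at hl
  have h0 := tendsto_nhds_unique hl tendsto_const_nhds
  have e1 : ∫ x, φ x * adv V g x = ∑ i, ∫ x, (V x i * φ x) * g i x := by
    rw [← integral_finsetSum _ fun i _ =>
      MemLp.integrable_mul' (memLp_coord_mul hVm hK (hφ.memLp 2) i) (hg i)]
    refine integral_congr_ae (ae_of_all _ fun x => ?_)
    simp only [adv, Finset.mul_sum]
    exact Finset.sum_congr rfl fun i _ => by ring
  have e2 : ∀ i, ∫ x, pd i φ x * (h x * V x i) = ∫ x, (V x i * pd i φ x) * h x := fun i =>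
    integral_congr_ae (ae_of_all _ fun x => by ring)
  rw [e1]
  simp only [e2]
  linarith

/-! ### The mollified equation at a fixed time. -/

/-- The mollified right-hand side of the equation. -/
noncomputable def rhs (κ : ℝ) (k f : E d → ℝ) (g : Fin d → E d → ℝ) : E d → ℝ :=
  fun x => cv k f x + κ * ∑ i, cv (pd i k) (g i) x

/-- The commutator between mollification and transport. -/
noncomputable def comm (V : E d → E d) (k f : E d → ℝ) (g : Fin d → E d → ℝ) : E d → ℝ :=
  fun x => cv k f x + adv V (fun i => cv k (g i)) x

/-- The relations at a fixed time between the velocity `V`, the solution `h`, its weak gradient `g`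
and the transport term `f = -V·g`. -/
structure Slice (V : E d → E d) (a K : ℝ) (h f : E d → ℝ) (g : Fin d → E d → ℝ) : Prop where
  vel : RegVel V a
  bdd : ∀ᵐ x, ‖V x‖ ≤ K
  memh : MemLp h 2 volume
  memg : ∀ i, MemLp (g i) 2 volume
  grad : IsWeakGrad h g
  feq : ∀ᵐ x, f x = - adv V g x

theorem memLp_add {f g : E d → ℝ} (hf : MemLp f 2 volume) (hg : MemLp g 2 volume) :
    MemLp (fun x => f x + g x) 2 volume := hf.add hg

theorem memLp_sum_cv {k : E d → ℝ} (hk : IsTest k) {g : Fin d → E d → ℝ}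
    (hg : ∀ i, MemLp (g i) 2 volume) : MemLp (fun x => ∑ i, cv (pd i k) (g i) x) 2 volume :=
  memLp_finsetSum (f := fun i x => cv (pd i k) (g i) x) _ fun i _ => memLp_cv (hk.pd i) (hg i)

theorem memLp_rhs {κ : ℝ} {k f : E d → ℝ} {g : Fin d → E d → ℝ} (hk : IsTest k)
    (hf : MemLp f 2 volume) (hg : ∀ i, MemLp (g i) 2 volume) : MemLp (rhs κ k f g) 2 volume :=
  memLp_add (memLp_cv hk hf) ((memLp_sum_cv hk hg).const_mul κ)

namespace Slice

variable {V : E d → E d} {a K : ℝ} {h f : E d → ℝ} {g : Fin d → E d → ℝ}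

theorem memf (S : Slice V a K h f g) : MemLp f 2 volume := by
  refine (memLp_congr_ae (g := fun x => - adv V g x) S.feq).2 ?_
  exact (memLp_adv S.vel.memLp.1 S.bdd S.memg).neg

theorem memLp_comm (S : Slice V a K h f g) {k : E d → ℝ} (hk : IsTest k) :
    MemLp (comm V k f g) 2 volume :=
  memLp_add (memLp_cv hk S.memf)
    (memLp_adv S.vel.memLp.1 S.bdd fun i => memLp_cv hk (S.memg i))

/-- Since `V` is bounded, no cancellation in the commutator is required. This version, with `k` a
difference of two mollifiers, serves the Cauchy argument. -/
theorem sqInt_comm_le (S : Slice V a K h f g) {k : E d → ℝ} (hk : IsTest k) :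
    sqInt (comm V k f g) ≤ 2 * sqInt (cv k f) + 2 * (K ^ 2 * ∑ i, sqInt (cv k (g i))) := by
  refine (sqInt_add_le (memLp_cv hk S.memf)
    (memLp_adv S.vel.memLp.1 S.bdd fun i => memLp_cv hk (S.memg i))).trans ?_
  gcongr
  exact sqInt_adv_le S.vel.memLp.1 S.bdd fun i => memLp_cv hk (S.memg i)

/-- Inserting `f + V·g = 0` turns the commutator into mollification errors, which tend to zero along
`mol`. -/
theorem sqInt_comm_le' (S : Slice V a K h f g) {k : E d → ℝ} (hk : IsTest k) :
    sqInt (comm V k f g) ≤ 2 * sqInt (fun x => cv k f x - f x) +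
      2 * (K ^ 2 * ∑ i, sqInt (fun x => cv k (g i) x - g i x)) := by
  have hm : ∀ i, MemLp (fun x => cv k (g i) x - g i x) 2 volume := fun i =>
    memLp_sub (memLp_cv hk (S.memg i)) (S.memg i)
  have e : sqInt (comm V k f g) = sqInt (fun x => (cv k f x - f x) +
      adv V (fun i x => cv k (g i) x - g i x) x) := by
    refine sqInt_congr ?_
    filter_upwards [S.feq] with x hx
    rw [hx, comm, adv, adv, adv]
    simp only [mul_sub, Finset.sum_sub_distrib]
    ring
  rw [e]
  refine (sqInt_add_le (memLp_sub (memLp_cv hk S.memf) S.memf)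
    (memLp_adv S.vel.memLp.1 S.bdd hm)).trans ?_
  gcongr
  exact sqInt_adv_le S.vel.memLp.1 S.bdd hm

theorem pd_cv_eq (S : Slice V a K h f g) {k : E d → ℝ} (hk : IsTest k) (i : Fin d) :
    pd i (cv k h) = cv k (g i) := pd_cv_of_weak S.grad S.memh hk i

theorem contDiff_w (S : Slice V a K h f g) {k : E d → ℝ} (hk : IsTest k) :
    ContDiff ℝ ∞ (cv k h) := contDiff_cv hk (MemLp.locInt S.memh)

theorem contDiff_wg (S : Slice V a K h f g) {k : E d → ℝ} (hk : IsTest k) (i : Fin d) :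
    ContDiff ℝ ∞ (cv k (g i)) := contDiff_cv hk (MemLp.locInt (S.memg i))

theorem pd_cv_g (S : Slice V a K h f g) {k : E d → ℝ} (hk : IsTest k) (i j : Fin d) :
    pd j (cv k (g i)) = cv (pd j k) (g i) := pd_cv hk (MemLp.locInt (S.memg i)) j

/-- The dissipation term in the energy balance. -/
theorem integral_mul_rhs (S : Slice V a K h f g) {k : E d → ℝ} (hk : IsTest k) (κ : ℝ) :
    ∫ x, cv k h x * rhs κ k f g x =
      (∫ x, cv k h x * cv k f x) - κ * ∑ i, sqInt (cv k (g i)) := by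
  have hw2 := memLp_cv hk S.memh
  have hg2 := fun i => memLp_cv hk (S.memg i)
  have hgg2 := fun i => memLp_cv (hk.pd i) (S.memg i)
  have e : ∀ x, cv k h x * rhs κ k f g x =
      cv k h x * cv k f x + κ * ∑ i, cv k h x * cv (pd i k) (g i) x := fun x => by
    rw [rhs, mul_add, Finset.mul_sum, Finset.mul_sum, Finset.mul_sum]
    congr 1
    exact Finset.sum_congr rfl fun i _ => by ring
  simp only [e]
  have hi : ∀ i, Integrable (fun x => cv k h x * cv (pd i k) (g i) x) volume := fun i =>
    MemLp.integrable_mul' hw2 (hgg2 i)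
  rw [integral_add (MemLp.integrable_mul' hw2 (memLp_cv hk S.memf))
    ((integrable_finsetSum _ fun i _ => hi i).const_mul κ), integral_const_mul,
    integral_finsetSum _ fun i _ => hi i, sub_eq_add_neg, ← mul_neg, ← Finset.sum_neg_distrib]
  congr 2
  refine Finset.sum_congr rfl fun i _ => ?_
  have := integral_mul_pd (S.contDiff_w hk) (S.contDiff_wg hk i) hw2 (hg2 i) i
    (by rw [S.pd_cv_eq hk]; exact hg2 i) (by rw [S.pd_cv_g hk]; exact hgg2 i)
  rw [S.pd_cv_eq hk, S.pd_cv_g hk] at this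
  rw [this, sqInt]
  simp only [sq]

/-- Transport does no work on `k*h`, so `k*f` may be replaced by the commutator. The parameter `η`
lets the commutator vanish before the remaining `η`-term is removed. -/
theorem energy_le (S : Slice V a K h f g) {k : E d → ℝ} (hk : IsTest k) (κ : ℝ) {η : ℝ}
    (hη : 0 < η) :
    2 * (∫ x, cv k h x * rhs κ k f g x) + 2 * κ * ∑ i, sqInt (cv k (g i)) ≤
      η * sqInt (cv k h) + η⁻¹ * sqInt (comm V k f g) := by
  have hw2 := memLp_cv hk S.memh
  have hg2 := fun i => memLp_cv hk (S.memg i)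
  have hz := integral_mul_adv_eq_zero S.vel S.bdd (S.contDiff_w hk) hw2
    (fun i => by rw [S.pd_cv_eq hk]; exact hg2 i)
  simp only [S.pd_cv_eq hk] at hz
  have e : ∫ x, cv k h x * comm V k f g x = ∫ x, cv k h x * cv k f x := by
    simp only [comm, mul_add]
    rw [integral_add (MemLp.integrable_mul' hw2 (memLp_cv hk S.memf))
      (MemLp.integrable_mul' hw2 (memLp_adv S.vel.memLp.1 S.bdd hg2)), hz, add_zero]
  have h1 := two_mul_integral_mul_le hw2 (S.memLp_comm hk) hη
  rw [e] at h1
  rw [S.integral_mul_rhs hk]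
  linarith

/-- With `w = k*h`, the left side is `-2 ∫ Δw · rhs`, where `rhs` equals the commutator minus `V·∇w`
plus `κΔw`. The transport part is `integral_laplacian_mul_adv_le`, and the dissipation absorbs the
commutator part. -/
theorem gradient_le (S : Slice V a K h f g) {k : E d → ℝ} (hk : IsTest k) {κ : ℝ} (hκ : 0 < κ) :
    2 * ∑ j, ∫ x, cv (pd j k) h x * rhs κ (pd j k) f g x ≤
      2 * a * ∑ i, sqInt (cv k (g i)) + (2 * κ)⁻¹ * sqInt (comm V k f g) := by
  have hg2 := fun i => memLp_cv hk (S.memg i)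
  have hgg2 := fun i j => memLp_cv (hk.pd j) (S.memg i)
  have hF2 := memLp_rhs (κ := κ) hk S.memf S.memg
  have hfs : ContDiff ℝ ∞ (cv k f) := contDiff_cv hk (MemLp.locInt S.memf)
  have hgs : ∀ i j, ContDiff ℝ ∞ (cv (pd j k) (g i)) := fun i j => S.contDiff_wg (hk.pd j) i
  have hFs : ContDiff ℝ ∞ (rhs κ k f g) :=
    hfs.add (contDiff_const.mul (ContDiff.sum fun i _ => hgs i i))
  have hFd : ∀ j, pd j (rhs κ k f g) = rhs κ (pd j k) f g := fun j => by
    funext x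
    have dd : ∀ {q : E d → ℝ}, ContDiff ℝ ∞ q → DifferentiableAt ℝ q x := fun hq =>
      hq.differentiable (by simp) x
    have h1 : fderiv ℝ (rhs κ k f g) x =
        fderiv ℝ (cv k f) x + κ • ∑ i, fderiv ℝ (cv (pd i k) (g i)) x := by
      unfold rhs
      rw [fderiv_fun_add (dd hfs) ((DifferentiableAt.fun_sum fun i _ => dd (hgs i i)).const_mul κ),
        fderiv_const_mul (DifferentiableAt.fun_sum fun i _ => dd (hgs i i)),
        fderiv_fun_sum fun i _ => dd (hgs i i)]
    have h2 : ∀ i, fderiv ℝ (cv (pd i k) (g i)) x (stdE j) = cv (pd i (pd j k)) (g i) x :=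
      fun i => by
        rw [← pd_comm hk.1 j i]
        exact congrFun (S.pd_cv_g (hk.pd i) i j) x
    have h3 : fderiv ℝ (cv k f) x (stdE j) = cv (pd j k) f x :=
      congrFun (pd_cv hk (MemLp.locInt S.memf) j) x
    rw [pd, h1, rhs]
    simp [h2, h3]
  set w := cv k h with hwdef
  have hwp : ∀ i, pd i w = cv k (g i) := S.pd_cv_eq hk
  have hwpp : ∀ i j, pd j (pd i w) = cv (pd j k) (g i) := fun i j => by rw [hwp, S.pd_cv_g hk]
  have hL2 : MemLp (fun x => ∑ j, pd j (pd j w) x) 2 volume := by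
    simp only [hwpp]; exact memLp_sum_cv hk S.memg
  have e1 : ∑ j, ∫ x, cv (pd j k) h x * rhs κ (pd j k) f g x =
      - ∫ x, (∑ j, pd j (pd j w) x) * rhs κ k f g x := by
    have : ∀ j, ∫ x, cv (pd j k) h x * rhs κ (pd j k) f g x =
        - ∫ x, pd j (pd j w) x * rhs κ k f g x := fun j => by
      have := integral_mul_pd (contDiff_pd (S.contDiff_w hk) j) hFs
        (by rw [← hwdef, hwp]; exact hg2 j) hF2 j
        (by rw [← hwdef, hwpp]; exact hgg2 j j)
        (by rw [hFd]; exact memLp_rhs (hk.pd j) S.memf S.memg)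
      rw [← hwdef, hFd] at this
      rw [← this, hwp, S.grad k hk j]
    simp only [this, Finset.sum_neg_distrib, Finset.sum_mul]
    rw [integral_finsetSum _ fun j _ => MemLp.integrable_mul'
      (by rw [hwpp]; exact hgg2 j j) hF2]
  have hadv := memLp_adv S.vel.memLp.1 S.bdd hg2
  have e2 : ∀ x, (∑ j, pd j (pd j w) x) * rhs κ k f g x =
      (∑ j, pd j (pd j w) x) * comm V k f g x -
      (∑ j, pd j (pd j w) x) * adv V (fun i => pd i w) x +
      κ * (∑ j, pd j (pd j w) x) ^ 2 := fun x => by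
    simp only [hwpp, rhs, comm]
    simp only [hwp]
    ring
  have hadv' : MemLp (adv V (fun i => pd i w)) 2 volume := by simpa only [hwp] using hadv
  have e3 : ∫ x, (∑ j, pd j (pd j w) x) * rhs κ k f g x =
      (∫ x, (∑ j, pd j (pd j w) x) * comm V k f g x) -
      (∫ x, (∑ j, pd j (pd j w) x) * adv V (fun i => pd i w) x) +
      κ * sqInt (fun x => ∑ j, pd j (pd j w) x) := by
    simp only [e2]
    have i1 := MemLp.integrable_mul' hL2 (S.memLp_comm hk)
    have i2 := MemLp.integrable_mul' hL2 hadv'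
    have i3 : Integrable (fun x => (∑ j, pd j (pd j w) x) * comm V k f g x -
        (∑ j, pd j (pd j w) x) * adv V (fun i => pd i w) x) volume := i1.sub i2
    rw [integral_add i3 (hL2.integrable_sq.const_mul κ), integral_sub i1 i2,
      integral_const_mul]
    rfl
  have h4 := integral_laplacian_mul_adv_le S.vel S.bdd (S.contDiff_w hk)
    (fun i => by rw [← hwdef, hwp]; exact hg2 i) (fun i j => by rw [← hwdef, hwpp]; exact hgg2 i j)
  rw [← hwdef] at h4
  -- The weight `2κ` makes the `‖Δw‖²` term cancel the dissipation exactly.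
  have h5 := two_mul_integral_mul_le hL2 (S.memLp_comm hk).neg (η := 2 * κ) (by positivity)
  have h6 : ∫ x, (∑ j, pd j (pd j w) x) * (-comm V k f g) x =
      - ∫ x, (∑ j, pd j (pd j w) x) * comm V k f g x := by
    rw [← integral_neg]
    exact integral_congr_ae (ae_of_all _ fun x => by simp)
  have h7 : sqInt (-comm V k f g) = sqInt (comm V k f g) := by simp [sqInt]
  rw [h6, h7] at h5
  have h8 : ∑ i, sqInt (pd i w) = ∑ i, sqInt (cv k (g i)) := by simp only [hwp]
  rw [h8] at h4
  rw [e1, e3]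
  linarith

theorem cv_f_eq (S : Slice V a K h f g) {k : E d → ℝ} (hk : IsTest k) (x : E d) :
    cv k f x = - ∑ i, cv (pd i k) (fun y => h y * V y i) x := by
  have h1 : cv k f x = - ∫ y, k (x - y) * adv V g y := by
    rw [← integral_neg]
    refine integral_congr_ae ?_
    filter_upwards [S.feq] with y hy
    rw [hy]; ring
  rw [h1, integral_test_mul_adv S.vel S.bdd S.memh S.memg S.grad (hk.comp_sub x)]
  simp only [pd_comp_sub hk, neg_mul, integral_neg, Finset.sum_neg_distrib, neg_neg]
  rfl

/-- In divergence form the derivative sits on the kernel, so only `‖V‖₂` and `‖h‖₂` enter, and not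
the gradient of `h`. -/
theorem sqInt_cv_f_le (S : Slice V a K h f g) {k : E d → ℝ} (hk : IsTest k) :
    sqInt (cv k f) ≤ d * (∑ i, sqInt (pd i k)) * (sqInt h * ∑ i, sqInt (fun x => V x i)) := by
  have hVi := fun i => memLp_coord S.vel.memLp i
  have hi : ∀ i, Integrable (fun y => h y * V y i) volume := fun i =>
    MemLp.integrable_mul' S.memh (hVi i)
  have hm := fun i => memLp_cv_integrable (hk.pd i) (hi i)
  have h1 : sqInt (cv k f) ≤ d * ∑ i, sqInt (cv (pd i k) (fun y => h y * V y i)) := by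
    unfold sqInt
    rw [← integral_finsetSum _ fun i _ => (hm i).integrable_sq, ← integral_const_mul]
    refine integral_mono (memLp_cv hk S.memf).integrable_sq
      ((integrable_finsetSum _ fun i _ => (hm i).integrable_sq).const_mul _) fun x => ?_
    simp only
    rw [S.cv_f_eq hk, neg_sq]
    simpa using sq_sum_le_card_mul_sum_sq (s := Finset.univ)
      (f := fun i => cv (pd i k) (fun y => h y * V y i) x)
  have h2 : ∀ i, sqInt (cv (pd i k) (fun y => h y * V y i)) ≤
      sqInt (pd i k) * (sqInt h * ∑ i, sqInt (fun x => V x i)) := fun i => by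
    refine (sqInt_cv_le_integrable (hk.pd i) (hi i)).trans ?_
    rw [mul_comm]
    refine mul_le_mul_of_nonneg_left ?_ (sqInt_nonneg _)
    have h3 := sq_integral_mul_le S.memh.norm (hVi i).norm
    have h4 : ∀ q : E d → ℝ, sqInt (fun x => ‖q x‖) = sqInt q := fun q => by simp [sqInt]
    rw [h4, h4] at h3
    simp only [norm_mul]
    refine h3.trans (mul_le_mul_of_nonneg_left ?_ (sqInt_nonneg _))
    exact Finset.single_le_sum (f := fun i => sqInt (fun x => V x i))
      (fun i _ => sqInt_nonneg _) (Finset.mem_univ i)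
  refine h1.trans ?_
  rw [mul_assoc, Finset.sum_mul]
  exact mul_le_mul_of_nonneg_left (Finset.sum_le_sum fun i _ => h2 i) (Nat.cast_nonneg _)

theorem lowFreq_le (S : Slice V a K h f g) {k : E d → ℝ} (hk : IsTest k) {κ : ℝ} (hκ : 0 ≤ κ) :
    ∫ x, cv k h x * rhs κ k f g x ≤ √(sqInt (cv k h)) * √(sqInt (cv k f)) := by
  rw [S.integral_mul_rhs hk]
  have h1 : ∫ x, cv k h x * cv k f x ≤ √(sqInt (cv k h)) * √(sqInt (cv k f)) := by
    rw [← Real.sqrt_mul (sqInt_nonneg _)]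
    exact Real.le_sqrt_of_sq_le (sq_integral_mul_le (memLp_cv hk S.memh) (memLp_cv hk S.memf))
  have h2 : 0 ≤ κ * ∑ i, sqInt (cv k (g i)) :=
    mul_nonneg hκ (Finset.sum_nonneg fun i _ => sqInt_nonneg _)
  linarith

end Slice

/-! ### The weak evolution equation and the `L²` balance of its mollifications. -/

/-- A continuous curve in `L²` solving `∂_t θ = f + κ Δθ` weakly, with `g` in the role of `∇θ`. -/
structure Evol (κ : ℝ) (θ : ℝ → L2 d) (f : ℝ → E d → ℝ) (g : Fin d → ℝ → E d → ℝ) : Prop where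
  cont : Continuous θ
  fm : StronglyMeasurable (Function.uncurry f)
  gm : ∀ i, StronglyMeasurable (Function.uncurry (g i))
  f2 : ∀ᵐ s ∂(volume.restrict (Ioi (0 : ℝ))), MemLp (f s) 2 volume
  g2 : ∀ i, ∀ᵐ s ∂(volume.restrict (Ioi (0 : ℝ))), MemLp (g i s) 2 volume
  fi : ∀ T : ℝ, IntegrableOn (fun s => sqInt (f s)) (Ioc 0 T)
  gi : ∀ i, ∀ T : ℝ, IntegrableOn (fun s => sqInt (g i s)) (Ioc 0 T)
  eqn : ∀ φ : E d → ℝ, IsTest φ → ∀ t : ℝ, 0 ≤ t →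
    (∫ x, θ t x * φ x) - ∫ x, θ 0 x * φ x =
      ∫ s in (0 : ℝ)..t, ∫ x, (f s x * φ x - κ * ∑ i, pd i φ x * g i s x)

theorem sq_sub_sq_eq_intervalIntegral {F φ : ℝ → ℝ} {s t : ℝ} (hst : s ≤ t)
    (hF : IntervalIntegrable F volume s t)
    (hφ : ∀ τ ∈ Icc s t, φ τ - φ s = ∫ σ in s..τ, F σ) :
    φ t ^ 2 - φ s ^ 2 = ∫ τ in s..t, 2 * (φ τ * F τ) := by
  -- `φ` is prescribed only on `[s,t]`, so the product rule is applied to the primitive that agrees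
  -- with it there.
  have hac : AbsolutelyContinuousOnInterval (fun τ => φ s + ∫ σ in s..τ, F σ) s t :=
    ((LipschitzWith.const (φ s)).lipschitzOnWith).absolutelyContinuousOnInterval.add
      (hF.absolutelyContinuousOnInterval_intervalIntegral left_mem_uIcc)
  have h := hac.integral_deriv_mul_eq_sub hac
  have e : ∀ τ ∈ Icc s t, φ s + ∫ σ in s..τ, F σ = φ τ := fun τ hτ => by rw [← hφ τ hτ]; ring
  rw [e t ⟨hst, le_rfl⟩, e s ⟨le_rfl, hst⟩] at h
  rw [sq, sq, ← h]
  refine intervalIntegral.integral_congr_ae ?_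
  filter_upwards [hF.ae_hasDerivAt_integral] with τ hτ hm
  have hm' : τ ∈ uIcc s t := uIoc_subset_uIcc hm
  have hd := ((hτ hm' s left_mem_uIcc).const_add (φ s)).deriv
  rw [hd, e τ (by rwa [uIcc_of_le hst] at hm')]
  ring

theorem stronglyMeasurable_cv {k : E d → ℝ} (hk : IsTest k) {f : ℝ → E d → ℝ}
    (hf : StronglyMeasurable (Function.uncurry f)) :
    StronglyMeasurable (Function.uncurry (fun s => cv k (f s))) := by
  have h : StronglyMeasurable (fun p : (ℝ × E d) × E d =>
      k (p.1.2 - p.2) * Function.uncurry f (p.1.1, p.2)) := by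
    refine StronglyMeasurable.mul ?_ ?_
    · exact (hk.continuous.comp (by fun_prop)).stronglyMeasurable
    · exact hf.comp_measurable (by fun_prop)
  exact h.integral_prod_right'

theorem stronglyMeasurable_sqInt {f : ℝ → E d → ℝ} (hf : StronglyMeasurable (Function.uncurry f)) :
    StronglyMeasurable (fun s => sqInt (f s)) :=
  StronglyMeasurable.integral_prod_right' (f := fun p : ℝ × E d => Function.uncurry f p ^ 2)
    (hf.pow 2)

theorem stronglyMeasurable_rhs {κ : ℝ} {k : E d → ℝ} (hk : IsTest k) {f : ℝ → E d → ℝ}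
    (hf : StronglyMeasurable (Function.uncurry f)) {g : Fin d → ℝ → E d → ℝ}
    (hg : ∀ i, StronglyMeasurable (Function.uncurry (g i))) :
    StronglyMeasurable (Function.uncurry (fun s => rhs κ k (f s) (fun i => g i s))) := by
  have h2 : StronglyMeasurable (fun p : ℝ × E d => ∑ i, cv (pd i k) (g i p.1) p.2) :=
    Finset.stronglyMeasurable_fun_sum _ fun i _ => stronglyMeasurable_cv (hk.pd i) (hg i)
  exact (stronglyMeasurable_cv hk hf).add (h2.const_mul κ)

theorem continuous_cv_apply {θ : ℝ → L2 d} (hθ : Continuous θ) {k : E d → ℝ} (hk : IsTest k)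
    (x : E d) : Continuous (fun t => cv k (θ t) x) := by
  have h : ∀ t, cv k (θ t) x = inner ℝ (((hk.comp_sub x).memLp 2).toLp _) (θ t) := fun t => by
    rw [L2.inner_def]
    refine integral_congr_ae ?_
    filter_upwards [((hk.comp_sub x).memLp 2).coeFn_toLp] with y hy
    rw [hy]
    simp [mul_comm]
  simp only [h]
  exact continuous_const.inner hθ

/-- Joint measurability follows from continuity in time for fixed `x` and measurability in `x` for
fixed time, although the curve itself consists of equivalence classes. -/
theorem stronglyMeasurable_cv_curve {θ : ℝ → L2 d} (hθ : Continuous θ) {k : E d → ℝ}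
    (hk : IsTest k) : StronglyMeasurable (Function.uncurry (fun s => cv k (θ s))) :=
  stronglyMeasurable_uncurry_of_continuous_of_stronglyMeasurable
    (fun x => continuous_cv_apply hθ hk x) fun s =>
    (contDiff_cv hk (MemLp.locInt (Lp.memLp (θ s)))).continuous.stronglyMeasurable

theorem sqInt_cv_le_norm {k : E d → ℝ} (hk : IsTest k) (h : L2 d) :
    sqInt (cv k h) ≤ (∫ x, ‖k x‖) ^ 2 * ‖h‖ ^ 2 := by
  rw [← sqInt_eq_norm_sq]
  exact sqInt_cv_le hk (Lp.memLp h)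

theorem sq_add_mul_sum_le (a κ : ℝ) (b : Fin d → ℝ) :
    (a + κ * ∑ i, b i) ^ 2 ≤ 2 * a ^ 2 + 2 * κ ^ 2 * (d * ∑ i, b i ^ 2) := by
  have h1 : (∑ i, b i) ^ 2 ≤ d * ∑ i, b i ^ 2 := by
    simpa using sq_sum_le_card_mul_sum_sq (s := Finset.univ) (f := b)
  have h2 := mul_le_mul_of_nonneg_left h1 (mul_nonneg zero_le_two (sq_nonneg κ))
  nlinarith [sq_nonneg (a - κ * ∑ i, b i)]

theorem integrable_prod_mul {μ : Measure ℝ} [SFinite μ] {w F : ℝ → E d → ℝ}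
    (hw : StronglyMeasurable (Function.uncurry w)) (hF : StronglyMeasurable (Function.uncurry F))
    {B : ℝ → ℝ} (hB : Integrable B μ)
    (h : ∀ᵐ τ ∂μ, MemLp (w τ) 2 volume ∧ MemLp (F τ) 2 volume ∧
      sqInt (w τ) + sqInt (F τ) ≤ B τ) :
    Integrable (Function.uncurry fun τ x => w τ x * F τ x) (μ.prod volume) := by
  have hm : StronglyMeasurable (Function.uncurry fun τ x => w τ x * F τ x) := hw.mul hF
  rw [integrable_prod_iff hm.aestronglyMeasurable]
  constructor
  · filter_upwards [h] with τ hτ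
    exact MemLp.integrable_mul' hτ.1 hτ.2.1
  · refine Integrable.mono' hB (hm.norm.integral_prod_right'.aestronglyMeasurable) ?_
    filter_upwards [h] with τ ⟨h1, h2, h3⟩
    rw [Real.norm_of_nonneg (integral_nonneg fun _ => norm_nonneg _)]
    refine le_trans ?_ h3
    unfold sqInt
    rw [← integral_add h1.integrable_sq h2.integrable_sq]
    refine integral_mono (MemLp.integrable_mul' h1 h2).norm
      (h1.integrable_sq.add h2.integrable_sq) fun x => ?_
    change |w τ x * F τ x| ≤ w τ x ^ 2 + F τ x ^ 2
    rw [abs_mul, ← sq_abs (w τ x), ← sq_abs (F τ x)]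
    nlinarith [sq_nonneg (|w τ x| - |F τ x|), sq_nonneg (|w τ x|), sq_nonneg (|F τ x|)]

namespace Evol

variable {κ : ℝ} {θ : ℝ → L2 d} {f : ℝ → E d → ℝ} {g : Fin d → ℝ → E d → ℝ}

theorem ae_mem (H : Evol κ θ f g) : ∀ᵐ s ∂(volume.restrict (Ioi (0 : ℝ))),
    MemLp (f s) 2 volume ∧ ∀ i, MemLp (g i s) 2 volume :=
  H.f2.and (ae_all_iff.2 H.g2)

/-- The dominating function `∫ f² + Σ ∫ g_i²`. -/
noncomputable def dom (f : ℝ → E d → ℝ) (g : Fin d → ℝ → E d → ℝ) : ℝ → ℝ :=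
  fun s => sqInt (f s) + ∑ i, sqInt (g i s)

theorem dom_nonneg (f : ℝ → E d → ℝ) (g : Fin d → ℝ → E d → ℝ) (s : ℝ) : 0 ≤ dom f g s :=
  add_nonneg (sqInt_nonneg _) (Finset.sum_nonneg fun _ _ => sqInt_nonneg _)

theorem integrableOn_dom (H : Evol κ θ f g) (T : ℝ) : IntegrableOn (dom f g) (Ioc 0 T) :=
  (H.fi T).add (integrable_finsetSum _ fun i _ => H.gi i T)

theorem sqInt_f_le_dom (f : ℝ → E d → ℝ) (g : Fin d → ℝ → E d → ℝ) (s : ℝ) :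
    sqInt (f s) ≤ dom f g s :=
  le_add_of_nonneg_right (Finset.sum_nonneg fun _ _ => sqInt_nonneg _)

theorem sqInt_g_le_dom (f : ℝ → E d → ℝ) (g : Fin d → ℝ → E d → ℝ) (i : Fin d) (s : ℝ) :
    sqInt (g i s) ≤ dom f g s :=
  (Finset.single_le_sum (f := fun i => sqInt (g i s)) (fun _ _ => sqInt_nonneg _)
    (Finset.mem_univ i)).trans (le_add_of_nonneg_left (sqInt_nonneg _))

/-- A single constant, depending only on `κ` and `k`, serves both the pointwise-in-`x` time
integrals and the Fubini argument. -/
theorem exists_rhs_bound (κ : ℝ) {k : E d → ℝ} (hk : IsTest k) :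
    ∃ C : ℝ, 0 ≤ C ∧ ∀ (f : ℝ → E d → ℝ) (g : Fin d → ℝ → E d → ℝ) (s : ℝ), MemLp (f s) 2 volume →
      (∀ i, MemLp (g i s) 2 volume) →
      (∀ x, rhs κ k (f s) (fun i => g i s) x ^ 2 ≤ C * dom f g s) ∧
      sqInt (rhs κ k (f s) (fun i => g i s)) ≤ C * dom f g s := by
  let A : ℝ := 2 * sqInt k + 2 * κ ^ 2 * (d * ∑ i, sqInt (pd i k))
  let B : ℝ := 2 * (∫ x, ‖k x‖) ^ 2 + 2 * κ ^ 2 * (d * ∑ i, (∫ x, ‖pd i k x‖) ^ 2)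
  have hA : 0 ≤ A := by
    have := sqInt_nonneg k
    have : 0 ≤ ∑ i, sqInt (pd i k) := Finset.sum_nonneg fun _ _ => sqInt_nonneg _
    positivity
  have hB : 0 ≤ B := by positivity
  refine ⟨A + B, add_nonneg hA hB, fun f g s hf hg => ⟨fun x => ?_, ?_⟩⟩
  · refine (sq_add_mul_sum_le _ _ _).trans ?_
    have h1 : cv k (f s) x ^ 2 ≤ sqInt k * dom f g s := (sq_cv_le hk hf x).trans
      (mul_le_mul_of_nonneg_left (sqInt_f_le_dom f g s) (sqInt_nonneg _))
    have h2 : ∑ i, cv (pd i k) (g i s) x ^ 2 ≤ (∑ i, sqInt (pd i k)) * dom f g s := by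
      rw [Finset.sum_mul]
      exact Finset.sum_le_sum fun i _ => (sq_cv_le (hk.pd i) (hg i) x).trans
        (mul_le_mul_of_nonneg_left (sqInt_g_le_dom f g i s) (sqInt_nonneg _))
    calc _ ≤ 2 * (sqInt k * dom f g s) +
          2 * κ ^ 2 * (d * ((∑ i, sqInt (pd i k)) * dom f g s)) := by gcongr
      _ = A * dom f g s := by ring
      _ ≤ _ := by
        have := mul_nonneg hB (dom_nonneg f g s)
        linarith
  · have m1 := (memLp_cv hk hf).integrable_sq
    have m2 := fun i => (memLp_cv (hk.pd i) (hg i)).integrable_sq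
    have m3 : Integrable (fun x => ∑ i, cv (pd i k) (g i s) x ^ 2) volume :=
      integrable_finsetSum _ fun i _ => m2 i
    have h0 : sqInt (rhs κ k (f s) (fun i => g i s)) ≤
        2 * sqInt (cv k (f s)) + 2 * κ ^ 2 * (d * ∑ i, sqInt (cv (pd i k) (g i s))) := by
      have e : 2 * sqInt (cv k (f s)) + 2 * κ ^ 2 * (d * ∑ i, sqInt (cv (pd i k) (g i s))) =
          ∫ x, (2 * cv k (f s) x ^ 2 + 2 * κ ^ 2 * (d * ∑ i, cv (pd i k) (g i s) x ^ 2)) := by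
        rw [integral_add (m1.const_mul 2) ((m3.const_mul _).const_mul _), integral_const_mul,
          integral_const_mul, integral_const_mul, integral_finsetSum _ fun i _ => m2 i]
        rfl
      rw [e]
      exact integral_mono (memLp_rhs hk hf hg).integrable_sq
        ((m1.const_mul 2).add ((m3.const_mul _).const_mul _)) fun x => sq_add_mul_sum_le _ _ _
    have h1 : sqInt (cv k (f s)) ≤ (∫ x, ‖k x‖) ^ 2 * dom f g s := (sqInt_cv_le hk hf).trans
      (mul_le_mul_of_nonneg_left (sqInt_f_le_dom f g s) (sq_nonneg _))
    have h2 : ∑ i, sqInt (cv (pd i k) (g i s)) ≤ (∑ i, (∫ x, ‖pd i k x‖) ^ 2) * dom f g s := by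
      rw [Finset.sum_mul]
      exact Finset.sum_le_sum fun i _ => (sqInt_cv_le (hk.pd i) (hg i)).trans
        (mul_le_mul_of_nonneg_left (sqInt_g_le_dom f g i s) (sq_nonneg _))
    calc _ ≤ _ := h0
      _ ≤ 2 * ((∫ x, ‖k x‖) ^ 2 * dom f g s) +
          2 * κ ^ 2 * (d * ((∑ i, (∫ x, ‖pd i k x‖) ^ 2) * dom f g s)) := by gcongr
      _ = B * dom f g s := by ring
      _ ≤ _ := by
        have := mul_nonneg hA (dom_nonneg f g s)
        linarith

theorem ae_mem_Ioc (H : Evol κ θ f g) {s t : ℝ} (hs : 0 ≤ s) :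
    ∀ᵐ τ ∂(volume.restrict (Ioc s t)), MemLp (f τ) 2 volume ∧ ∀ i, MemLp (g i τ) 2 volume :=
  ae_restrict_of_ae_restrict_of_subset (fun _ hτ => hs.trans_lt hτ.1) H.ae_mem

theorem integrableOn_rhs (H : Evol κ θ f g) {k : E d → ℝ} (hk : IsTest k) (x : E d) (T : ℝ) :
    IntegrableOn (fun s => rhs κ k (f s) (fun i => g i s) x) (Ioc 0 T) := by
  obtain ⟨C, hC0, hC⟩ := exists_rhs_bound (d := d) κ hk
  have hm := (stronglyMeasurable_rhs (κ := κ) hk H.fm H.gm).comp_measurable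
    (measurable_prodMk_right (y := x))
  -- A bound `y² ≤ Q` with `Q ≥ 0` implies `|y| ≤ 1 + Q`, and `1 + Q` is integrable on a bounded
  -- interval when `Q` is.
  refine Integrable.mono' (g := fun s => 1 + C * dom f g s)
    ((integrable_const 1).add ((H.integrableOn_dom T).const_mul C)) hm.aestronglyMeasurable ?_
  filter_upwards [H.ae_mem_Ioc (t := T) le_rfl] with s hs
  have := (hC f g s hs.1 hs.2).1 x
  rw [Real.norm_eq_abs]
  refine abs_le_of_sq_le_sq' ?_ ?_ |> abs_le.2
  · nlinarith [dom_nonneg f g s, mul_nonneg hC0 (dom_nonneg f g s)]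
  · have := mul_nonneg hC0 (dom_nonneg f g s); linarith

/-- The weak equation tested with `y ↦ k (x - y)` becomes, for each fixed `x`, a scalar integral
equation in time. -/
theorem cv_sub_eq (H : Evol κ θ f g) {k : E d → ℝ} (hk : IsTest k) (x : E d) {s t : ℝ}
    (hs : 0 ≤ s) (hst : s ≤ t) :
    cv k (θ t) x - cv k (θ s) x = ∫ τ in s..t, rhs κ k (f τ) (fun i => g i τ) x := by
  have key : ∀ t, 0 ≤ t → cv k (θ t) x - cv k (θ 0) x =
      ∫ τ in (0 : ℝ)..t, rhs κ k (f τ) (fun i => g i τ) x := fun t ht => by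
    have h := H.eqn _ (hk.comp_sub x) t ht
    have e : ∀ r, ∫ y, θ r y * k (x - y) = cv k (θ r) x := fun r =>
      integral_congr_ae (ae_of_all _ fun y => mul_comm _ _)
    rw [e, e] at h
    rw [h, intervalIntegral.integral_of_le ht, intervalIntegral.integral_of_le ht]
    refine integral_congr_ae ?_
    filter_upwards [H.ae_mem_Ioc (t := t) le_rfl] with τ hτ
    have e2 : ∀ y, f τ y * k (x - y) - κ * ∑ i, pd i (fun y => k (x - y)) y * g i τ y =
        k (x - y) * f τ y + κ * ∑ i, pd i k (x - y) * g i τ y := fun y => by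
      simp only [pd_comp_sub hk, neg_mul, Finset.sum_neg_distrib]; ring
    simp only [e2]
    have i2 := fun i => integrable_cv_integrand (hk.pd i) (MemLp.locInt (hτ.2 i)) x
    rw [integral_add (integrable_cv_integrand hk (MemLp.locInt hτ.1) x)
      ((integrable_finsetSum _ fun i _ => i2 i).const_mul κ), integral_const_mul,
      integral_finsetSum _ fun i _ => i2 i]
    rfl
  have hI : ∀ r, 0 ≤ r → IntervalIntegrable (fun τ => rhs κ k (f τ) (fun i => g i τ) x) volume 0 r :=
    fun r hr => (intervalIntegrable_iff_integrableOn_Ioc_of_le hr).2 (H.integrableOn_rhs hk x r)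
  rw [← intervalIntegral.integral_interval_sub_left (hI t (hs.trans hst)) (hI s hs),
    ← key t (hs.trans hst), ← key s hs]
  ring

/-- The `L²` balance for the mollified solution. -/
theorem sqInt_sub_eq (H : Evol κ θ f g) {k : E d → ℝ} (hk : IsTest k) {s t : ℝ}
    (hs : 0 ≤ s) (hst : s ≤ t) :
    IntegrableOn (fun τ => ∫ x, cv k (θ τ) x * rhs κ k (f τ) (fun i => g i τ) x) (Ioc s t) ∧
    sqInt (cv k (θ t)) - sqInt (cv k (θ s)) =
      ∫ τ in s..t, 2 * ∫ x, cv k (θ τ) x * rhs κ k (f τ) (fun i => g i τ) x := by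
  obtain ⟨C, hC0, hC⟩ := exists_rhs_bound (d := d) κ hk
  have hsub : Ioc s t ⊆ Ioc 0 t := Ioc_subset_Ioc_left hs
  have hw : ∀ τ, MemLp (cv k (θ τ)) 2 volume := fun τ => memLp_cv hk (Lp.memLp _)
  have hwm := stronglyMeasurable_cv_curve H.cont hk
  have hFm := stronglyMeasurable_rhs (κ := κ) hk H.fm H.gm
  obtain ⟨D, hD⟩ : ∃ D, ∀ τ ∈ Icc s t, ‖θ τ‖ ≤ D :=
    isCompact_Icc.exists_bound_of_continuousOn H.cont.continuousOn
  have hae := H.ae_mem_Ioc (t := t) hs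
  have hdomi : IntegrableOn (dom f g) (Ioc s t) := (H.integrableOn_dom t).mono_set hsub
  have hint := integrable_prod_mul (μ := volume.restrict (Ioc s t)) hwm hFm
    (B := fun τ => (∫ x, ‖k x‖) ^ 2 * D ^ 2 + C * dom f g τ)
    ((integrable_const _).add (hdomi.const_mul C)) (by
      filter_upwards [hae, ae_restrict_mem measurableSet_Ioc] with τ hτ hτm
      refine ⟨hw τ, memLp_rhs hk hτ.1 hτ.2, add_le_add ?_ (hC f g τ hτ.1 hτ.2).2⟩
      exact (sqInt_cv_le_norm hk _).trans (mul_le_mul_of_nonneg_left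
          (pow_le_pow_left₀ (norm_nonneg _) (hD τ ⟨hτm.1.le, hτm.2⟩) 2) (sq_nonneg _)))
  refine ⟨hint.integral_prod_left, ?_⟩
  -- The square is differentiated in time separately at each `x`; exchanging the `x` and time
  -- integrals gives the balance without vector-valued calculus.
  have hpt : ∀ x, cv k (θ t) x ^ 2 - cv k (θ s) x ^ 2 =
      ∫ τ in Ioc s t, 2 * (cv k (θ τ) x * rhs κ k (f τ) (fun i => g i τ) x) := fun x => by
    rw [← intervalIntegral.integral_of_le hst]
    refine sq_sub_sq_eq_intervalIntegral hst ?_ fun τ hτ => H.cv_sub_eq hk x hs hτ.1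
    exact (intervalIntegrable_iff_integrableOn_Ioc_of_le hst).2
      ((H.integrableOn_rhs hk x t).mono_set hsub)
  unfold sqInt
  rw [← integral_sub (hw t).integrable_sq (hw s).integrable_sq]
  simp only [hpt]
  rw [intervalIntegral.integral_of_le hst]
  simp only [integral_const_mul]
  congr 1
  exact (integral_integral_swap hint).symm

end Evol

/-! ### Mollification errors and their time integrals. -/

/-- The mollification error. -/
noncomputable def molErr (n : ℕ) (h : E d → ℝ) : ℝ := sqInt (fun x => cv (mol d n) h x - h x)

theorem molErr_nonneg (n : ℕ) (h : E d → ℝ) : 0 ≤ molErr n h := sqInt_nonneg _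

theorem molErr_le (n : ℕ) {h : E d → ℝ} (hh : MemLp h 2 volume) : molErr n h ≤ 4 * sqInt h := by
  have h1 := sqInt_sub_le (memLp_cv (isTest_mol n) hh) hh
  have h2 := sqInt_cv_mol_le n hh
  unfold molErr
  linarith

theorem tendsto_molErr {h : E d → ℝ} (hh : MemLp h 2 volume) :
    Tendsto (fun n => molErr n h) atTop (𝓝 0) := tendsto_sqInt_cv_mol_sub hh

theorem sqInt_cv_mol_sub_mol_le (n m : ℕ) {h : E d → ℝ} (hh : MemLp h 2 volume) :
    sqInt (cv (fun x => mol d n x - mol d m x) h) ≤ 2 * molErr n h + 2 * molErr m h := by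
  have hm := fun n => memLp_sub (memLp_cv (isTest_mol (d := d) n) hh) hh
  have h1 := sqInt_sub_le (hm n) (hm m)
  have e : cv (fun x => mol d n x - mol d m x) h =
      fun x => (cv (mol d n) h x - h x) - (cv (mol d m) h x - h x) := by
    funext x
    rw [cv_sub_left (isTest_mol n) (isTest_mol m) (MemLp.locInt hh)]; ring
  rw [e]
  exact h1

section family

variable {μ : Measure ℝ} {h : ℝ → E d → ℝ}

theorem integrable_sqInt_cv {k : E d → ℝ} (hk : IsTest k)
    (hm : StronglyMeasurable (Function.uncurry h))
    (h2 : ∀ᵐ s ∂μ, MemLp (h s) 2 volume) (hi : Integrable (fun s => sqInt (h s)) μ) :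
    Integrable (fun s => sqInt (cv k (h s))) μ := by
  refine Integrable.mono' (hi.const_mul ((∫ x, ‖k x‖) ^ 2))
    (stronglyMeasurable_sqInt (stronglyMeasurable_cv hk hm)).aestronglyMeasurable ?_
  filter_upwards [h2] with s hs
  rw [Real.norm_of_nonneg (sqInt_nonneg _)]
  exact sqInt_cv_le hk hs

theorem stronglyMeasurable_molErr (n : ℕ) (hm : StronglyMeasurable (Function.uncurry h)) :
    StronglyMeasurable (fun s => molErr n (h s)) :=
  stronglyMeasurable_sqInt (f := fun s x => cv (mol d n) (h s) x - h s x)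
    ((stronglyMeasurable_cv (isTest_mol n) hm).sub hm)

theorem integrable_molErr (n : ℕ) (hm : StronglyMeasurable (Function.uncurry h))
    (h2 : ∀ᵐ s ∂μ, MemLp (h s) 2 volume) (hi : Integrable (fun s => sqInt (h s)) μ) :
    Integrable (fun s => molErr n (h s)) μ := by
  refine Integrable.mono' (hi.const_mul 4) (stronglyMeasurable_molErr n hm).aestronglyMeasurable ?_
  filter_upwards [h2] with s hs
  rw [Real.norm_of_nonneg (molErr_nonneg _ _)]
  exact molErr_le n hs

theorem tendsto_integral_molErr (hm : StronglyMeasurable (Function.uncurry h))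
    (h2 : ∀ᵐ s ∂μ, MemLp (h s) 2 volume) (hi : Integrable (fun s => sqInt (h s)) μ) :
    Tendsto (fun n => ∫ s, molErr n (h s) ∂μ) atTop (𝓝 0) := by
  have := tendsto_integral_of_dominated_convergence (μ := μ) (F := fun n s => molErr n (h s))
    (f := fun _ => 0) (fun s => 4 * sqInt (h s))
    (fun n => (stronglyMeasurable_molErr n hm).aestronglyMeasurable) (hi.const_mul 4)
    (fun n => by
      filter_upwards [h2] with s hs
      rw [Real.norm_of_nonneg (molErr_nonneg _ _)]
      exact molErr_le n hs)
    (by filter_upwards [h2] with s hs using tendsto_molErr hs)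
  simpa using this

theorem tendsto_integral_sqInt_cv_mol (hm : StronglyMeasurable (Function.uncurry h))
    (h2 : ∀ᵐ s ∂μ, MemLp (h s) 2 volume) (hi : Integrable (fun s => sqInt (h s)) μ) :
    Tendsto (fun n => ∫ s, sqInt (cv (mol d n) (h s)) ∂μ) atTop (𝓝 (∫ s, sqInt (h s) ∂μ)) := by
  refine tendsto_integral_of_dominated_convergence (fun s => sqInt (h s))
    (fun n => (stronglyMeasurable_sqInt
      (stronglyMeasurable_cv (isTest_mol n) hm)).aestronglyMeasurable) hi (fun n => ?_) ?_
  · filter_upwards [h2] with s hs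
    rw [Real.norm_of_nonneg (sqInt_nonneg _)]
    exact sqInt_cv_mol_le n hs
  · filter_upwards [h2] with s hs using tendsto_sqInt_cv_mol hs

end family

/-! ### Energy, gradient and low frequency inequalities along the flow. -/

/-- A solution curve together with its velocity, whose Jacobian at time `s` is bounded by `A s`. -/
structure Flow (κ : ℝ) (u : ℝ → E d → E d) (A : ℝ → ℝ) (θ : ℝ → L2 d) (f : ℝ → E d → ℝ)
    (g : Fin d → ℝ → E d → ℝ) : Prop where
  pos : 0 < κ
  evol : Evol κ θ f g
  slice : ∀ T : ℝ, ∃ K : ℝ, ∀ᵐ s ∂(volume.restrict (Ioc 0 T)),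
    Slice (u s) (A s) K (θ s) (f s) (fun i => g i s)

/-- `Σ ∫ g_i²`. -/
noncomputable def gradSq (g : Fin d → ℝ → E d → ℝ) (s : ℝ) : ℝ := ∑ i, sqInt (g i s)

theorem gradSq_nonneg (g : Fin d → ℝ → E d → ℝ) (s : ℝ) : 0 ≤ gradSq g s :=
  Finset.sum_nonneg fun _ _ => sqInt_nonneg _

/-- Bound for the commutator of the `n`-th mollification. -/
noncomputable def commErr (K : ℝ) (f : ℝ → E d → ℝ) (g : Fin d → ℝ → E d → ℝ) (n : ℕ) (s : ℝ) : ℝ :=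
  2 * molErr n (f s) + 2 * (K ^ 2 * ∑ i, molErr n (g i s))

namespace Flow

variable {κ : ℝ} {u : ℝ → E d → E d} {A : ℝ → ℝ} {θ : ℝ → L2 d} {f : ℝ → E d → ℝ}
  {g : Fin d → ℝ → E d → ℝ}

theorem slice' (F : Flow κ u A θ f g) {s t : ℝ} (hs : 0 ≤ s) :
    ∃ K : ℝ, ∀ᵐ τ ∂(volume.restrict (Ioc s t)),
      Slice (u τ) (A τ) K (θ τ) (f τ) (fun i => g i τ) := by
  obtain ⟨K, hK⟩ := F.slice t
  exact ⟨K, ae_restrict_of_ae_restrict_of_subset (Ioc_subset_Ioc_left hs) hK⟩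

theorem integrableOn_f (F : Flow κ u A θ f g) {s t : ℝ} (hs : 0 ≤ s) :
    IntegrableOn (fun τ => sqInt (f τ)) (Ioc s t) :=
  (F.evol.fi t).mono_set (Ioc_subset_Ioc_left hs)

theorem integrableOn_g (F : Flow κ u A θ f g) {s t : ℝ} (hs : 0 ≤ s) (i : Fin d) :
    IntegrableOn (fun τ => sqInt (g i τ)) (Ioc s t) :=
  (F.evol.gi i t).mono_set (Ioc_subset_Ioc_left hs)

theorem integrableOn_gradSq (F : Flow κ u A θ f g) {s t : ℝ} (hs : 0 ≤ s) :
    IntegrableOn (gradSq g) (Ioc s t) :=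
  integrable_finsetSum _ fun i _ => F.integrableOn_g hs i

theorem ae_f (F : Flow κ u A θ f g) {s t : ℝ} (hs : 0 ≤ s) :
    ∀ᵐ τ ∂(volume.restrict (Ioc s t)), MemLp (f τ) 2 volume := by
  filter_upwards [F.evol.ae_mem_Ioc (t := t) hs] with τ hτ using hτ.1

theorem ae_g (F : Flow κ u A θ f g) {s t : ℝ} (hs : 0 ≤ s) (i : Fin d) :
    ∀ᵐ τ ∂(volume.restrict (Ioc s t)), MemLp (g i τ) 2 volume := by
  filter_upwards [F.evol.ae_mem_Ioc (t := t) hs] with τ hτ using hτ.2 i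

theorem integrableOn_commErr (F : Flow κ u A θ f g) {s t : ℝ} (hs : 0 ≤ s) (K : ℝ) (n : ℕ) :
    IntegrableOn (commErr K f g n) (Ioc s t) :=
  ((integrable_molErr n F.evol.fm (F.ae_f hs) (F.integrableOn_f hs)).const_mul 2).add
    (((integrable_finsetSum _ fun i _ => integrable_molErr n (F.evol.gm i) (F.ae_g hs i)
      (F.integrableOn_g hs i)).const_mul _).const_mul 2)

theorem tendsto_commErr (F : Flow κ u A θ f g) {s t : ℝ} (hs : 0 ≤ s) (K : ℝ) :
    Tendsto (fun n => ∫ τ in Ioc s t, commErr K f g n τ) atTop (𝓝 0) := by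
  have hgi := fun i n => integrable_molErr (μ := volume.restrict (Ioc s t)) n (F.evol.gm i)
    (F.ae_g hs i) (F.integrableOn_g hs i)
  have e : ∀ n, ∫ τ in Ioc s t, commErr K f g n τ = 2 * (∫ τ in Ioc s t, molErr n (f τ)) +
      2 * (K ^ 2 * ∑ i, ∫ τ in Ioc s t, molErr n (g i τ)) := fun n => by
    unfold commErr
    rw [integral_add ((integrable_molErr n F.evol.fm (F.ae_f hs) (F.integrableOn_f hs)).const_mul 2)
      (((integrable_finsetSum _ fun i _ => hgi i n).const_mul _).const_mul 2), integral_const_mul,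
      integral_const_mul, integral_const_mul, integral_finsetSum _ fun i _ => hgi i n]
  simp only [e]
  have h1 := tendsto_integral_molErr (μ := volume.restrict (Ioc s t)) F.evol.fm (F.ae_f hs)
    (F.integrableOn_f hs)
  have h2 := tendsto_finsetSum Finset.univ fun i _ =>
    tendsto_integral_molErr (μ := volume.restrict (Ioc s t)) (F.evol.gm i) (F.ae_g hs i)
    (F.integrableOn_g hs i)
  have := (h1.const_mul 2).add ((h2.const_mul (K ^ 2)).const_mul 2)
  simpa using this

theorem tendsto_gradSq (F : Flow κ u A θ f g) {s t : ℝ} (hs : 0 ≤ s) :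
    Tendsto (fun n => ∫ τ in Ioc s t, ∑ i, sqInt (cv (mol d n) (g i τ))) atTop
      (𝓝 (∫ τ in Ioc s t, gradSq g τ)) := by
  have e : ∀ n, ∫ τ in Ioc s t, ∑ i, sqInt (cv (mol d n) (g i τ)) =
      ∑ i, ∫ τ in Ioc s t, sqInt (cv (mol d n) (g i τ)) := fun n =>
    integral_finsetSum _ fun i _ => integrable_sqInt_cv (isTest_mol n) (F.evol.gm i) (F.ae_g hs i)
      (F.integrableOn_g hs i)
  have e2 : ∫ τ in Ioc s t, gradSq g τ = ∑ i, ∫ τ in Ioc s t, sqInt (g i τ) :=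
    integral_finsetSum _ fun i _ => F.integrableOn_g hs i
  simp only [e, e2]
  exact tendsto_finsetSum _ fun i _ => tendsto_integral_sqInt_cv_mol (F.evol.gm i) (F.ae_g hs i)
    (F.integrableOn_g hs i)

theorem integrableOn_gradSq_cv (F : Flow κ u A θ f g) {s t : ℝ} (hs : 0 ≤ s) {k : E d → ℝ}
    (hk : IsTest k) : IntegrableOn (fun τ => ∑ i, sqInt (cv k (g i τ))) (Ioc s t) :=
  integrable_finsetSum _ fun i _ => integrable_sqInt_cv hk (F.evol.gm i) (F.ae_g hs i)
      (F.integrableOn_g hs i)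

/-- The energy inequality. -/
theorem energy (F : Flow κ u A θ f g) {s t : ℝ} (hs : 0 ≤ s) (hst : s ≤ t) :
    ‖θ t‖ ^ 2 + 2 * κ * ∫ τ in Ioc s t, gradSq g τ ≤ ‖θ s‖ ^ 2 := by
  obtain ⟨K, hK⟩ := F.slice' (t := t) hs
  obtain ⟨D, hD⟩ : ∃ D, ∀ τ ∈ Icc s t, ‖θ τ‖ ≤ D :=
    isCompact_Icc.exists_bound_of_continuousOn F.evol.cont.continuousOn
  have hn : ∀ η : ℝ, 0 < η → ∀ n, sqInt (cv (mol d n) (θ t)) +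
      2 * κ * ∫ τ in Ioc s t, ∑ i, sqInt (cv (mol d n) (g i τ)) ≤
      sqInt (cv (mol d n) (θ s)) + (η * D ^ 2 * (t - s) +
        η⁻¹ * ∫ τ in Ioc s t, commErr K f g n τ) := fun η hη n => by
    obtain ⟨hI, hE⟩ := F.evol.sqInt_sub_eq (isTest_mol n) hs hst
    have hG := F.integrableOn_gradSq_cv (t := t) hs (isTest_mol n)
    have hC := F.integrableOn_commErr (t := t) hs K n
    have h1 : (∫ τ in Ioc s t, 2 * ∫ x, cv (mol d n) (θ τ) x *
        rhs κ (mol d n) (f τ) (fun i => g i τ) x) ≤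
        ∫ τ in Ioc s t, ((η * D ^ 2 + η⁻¹ * commErr K f g n τ) -
          2 * κ * ∑ i, sqInt (cv (mol d n) (g i τ))) := by
      refine integral_mono_ae (hI.const_mul 2)
        (((integrable_const _).add (hC.const_mul _)).sub (hG.const_mul _)) ?_
      filter_upwards [hK, ae_restrict_mem measurableSet_Ioc] with τ hτ hτm
      have h2 := hτ.energy_le (isTest_mol n) κ hη
      have h3 := hτ.sqInt_comm_le' (isTest_mol n)
      have h4 : sqInt (cv (mol d n) (θ τ)) ≤ D ^ 2 := by
        refine (sqInt_cv_mol_le n hτ.memh).trans ?_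
        rw [sqInt_eq_norm_sq]
        exact pow_le_pow_left₀ (norm_nonneg _) (hD τ ⟨hτm.1.le, hτm.2⟩) 2
      have h5 := mul_le_mul_of_nonneg_left h4 hη.le
      have h6 : η⁻¹ * sqInt (comm (u τ) (mol d n) (f τ) (fun i => g i τ)) ≤
        η⁻¹ * commErr K f g n τ := mul_le_mul_of_nonneg_left h3 (by positivity)
      change 2 * _ ≤ η * D ^ 2 + η⁻¹ * commErr K f g n τ - 2 * κ * ∑ i, sqInt (cv (mol d n) (g i τ))
      linarith
    have h7 : ∫ τ in Ioc s t, ((η * D ^ 2 + η⁻¹ * commErr K f g n τ) -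
          2 * κ * ∑ i, sqInt (cv (mol d n) (g i τ))) = η * D ^ 2 * (t - s) +
          η⁻¹ * (∫ τ in Ioc s t, commErr K f g n τ) -
          2 * κ * ∫ τ in Ioc s t, ∑ i, sqInt (cv (mol d n) (g i τ)) := by
      have i1 : Integrable (fun τ => η * D ^ 2 + η⁻¹ * commErr K f g n τ)
          (volume.restrict (Ioc s t)) := (integrable_const _).add (hC.const_mul _)
      rw [integral_sub i1 (hG.const_mul _), integral_add (integrable_const _) (hC.const_mul _),
        integral_const_mul η⁻¹, integral_const_mul (2 * κ), setIntegral_const, Real.volume_real_Ioc_of_le hst,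
        smul_eq_mul, mul_comm (t - s)]
    rw [intervalIntegral.integral_of_le hst] at hE
    rw [h7] at h1
    linarith
  -- The limit `n → ∞` comes first, for fixed `η`, because the commutator error carries the factor
  -- `η⁻¹`.
  have hη : ∀ η : ℝ, 0 < η → ‖θ t‖ ^ 2 + 2 * κ * ∫ τ in Ioc s t, gradSq g τ ≤
      ‖θ s‖ ^ 2 + η * (D ^ 2 * (t - s)) := fun η hη => by
    have hl := (tendsto_sqInt_cv_mol (Lp.memLp (θ t))).add ((F.tendsto_gradSq (t := t) hs).const_mul
      (2 * κ))
    have hr := (tendsto_sqInt_cv_mol (Lp.memLp (θ s))).add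
      (((F.tendsto_commErr (t := t) hs K).const_mul η⁻¹).const_add (η * D ^ 2 * (t - s)))
    have := le_of_tendsto_of_tendsto' hl hr (hn η hη)
    rw [sqInt_eq_norm_sq, sqInt_eq_norm_sq] at this
    linarith
  refine le_of_forall_pos_le_add fun ε hε => ?_
  have hP : 0 ≤ D ^ 2 * (t - s) := mul_nonneg (sq_nonneg _) (sub_nonneg.2 hst)
  refine (hη (ε / (D ^ 2 * (t - s) + 1)) (by positivity)).trans ?_
  gcongr
  rw [div_mul_eq_mul_div, div_le_iff₀ (by positivity)]
  nlinarith

theorem antitoneOn_norm (F : Flow κ u A θ f g) {s t : ℝ} (hs : 0 ≤ s) (hst : s ≤ t) :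
    ‖θ t‖ ≤ ‖θ s‖ := by
  have h := F.energy hs hst
  have : 0 ≤ ∫ τ in Ioc s t, gradSq g τ := integral_nonneg fun τ => gradSq_nonneg g τ
  have h2 := mul_nonneg (mul_nonneg zero_le_two F.pos.le) this
  exact le_of_sq_le_sq (by linarith) (norm_nonneg _)

/-- Growth of the mollified gradient. -/
theorem gradient_mollified_le (F : Flow κ u A θ f g) {s t a : ℝ} (hs : 0 ≤ s) (hst : s ≤ t)
    (ha : ∀ᵐ τ ∂(volume.restrict (Ioc s t)), A τ ≤ a) {k : E d → ℝ} (hk : IsTest k)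
    {R : ℝ → ℝ} (hR : IntegrableOn R (Ioc s t))
    (hRle : ∀ᵐ τ ∂(volume.restrict (Ioc s t)),
      sqInt (comm (u τ) k (f τ) (fun i => g i τ)) ≤ R τ) :
    ∑ j, sqInt (cv (pd j k) (θ t)) ≤ ∑ j, sqInt (cv (pd j k) (θ s)) +
      (2 * a * (∫ τ in Ioc s t, ∑ i, sqInt (cv k (g i τ))) +
        (2 * κ)⁻¹ * ∫ τ in Ioc s t, R τ) := by
  obtain ⟨K, hK⟩ := F.slice' (t := t) hs
  have hbal := fun j => F.evol.sqInt_sub_eq (hk.pd j) hs hst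
  have hG := F.integrableOn_gradSq_cv (t := t) hs hk
  have h1 : ∑ j, sqInt (cv (pd j k) (θ t)) - ∑ j, sqInt (cv (pd j k) (θ s)) =
      ∫ τ in Ioc s t, 2 * ∑ j, ∫ x, cv (pd j k) (θ τ) x *
        rhs κ (pd j k) (f τ) (fun i => g i τ) x := by
    rw [← Finset.sum_sub_distrib, integral_const_mul, integral_finsetSum _ fun j _ => (hbal j).1,
      Finset.mul_sum]
    refine Finset.sum_congr rfl fun j _ => ?_
    rw [(hbal j).2, intervalIntegral.integral_of_le hst, integral_const_mul]
  have h2 : (∫ τ in Ioc s t, 2 * ∑ j, ∫ x, cv (pd j k) (θ τ) x *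
        rhs κ (pd j k) (f τ) (fun i => g i τ) x) ≤
      ∫ τ in Ioc s t, (2 * a * (∑ i, sqInt (cv k (g i τ))) + (2 * κ)⁻¹ * R τ) := by
    refine integral_mono_ae ((integrable_finsetSum _ fun j _ => (hbal j).1).const_mul 2)
      ((hG.const_mul _).add (hR.const_mul _)) ?_
    filter_upwards [hK, ha, hRle] with τ hτ haτ hRτ
    refine (hτ.gradient_le hk F.pos).trans ?_
    have hS : 0 ≤ ∑ i, sqInt (cv k (g i τ)) := Finset.sum_nonneg fun _ _ => sqInt_nonneg _
    have hκ := F.pos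
    change _ ≤ 2 * a * (∑ i, sqInt (cv k (g i τ))) + (2 * κ)⁻¹ * R τ
    gcongr
  rw [integral_add (hG.const_mul _) (hR.const_mul _), integral_const_mul (2 * a),
    integral_const_mul (2 * κ)⁻¹] at h2
  linarith

/-- Growth of the low frequencies. -/
theorem lowFreq (F : Flow κ u A θ f g) {t : ℝ} {k : E d → ℝ} (hk : IsTest k)
    {β : ℝ → ℝ} (hβ : IntegrableOn β (Ioc 0 t)) (hβ0 : ∀ τ, 0 < τ → 0 ≤ β τ)
    (hβle : ∀ τ, 0 < τ → ‖θ τ‖ ^ 2 * ∑ i, sqInt (fun x => u τ x i) ≤ β τ ^ 2) {τ : ℝ}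
    (hτ0 : 0 ≤ τ) (hτt : τ ≤ t) :
    sqInt (cv k (θ τ)) ≤ 2 * sqInt (cv k (θ 0)) +
      4 * (d * ∑ i, sqInt (pd i k)) * (∫ r in Ioc 0 t, β r) ^ 2 := by
  have hc0 : 0 ≤ d * ∑ i, sqInt (pd i k) :=
    mul_nonneg (Nat.cast_nonneg _) (Finset.sum_nonneg fun _ _ => sqInt_nonneg _)
  set c := √(d * ∑ i, sqInt (pd i k)) with hc
  set B := ∫ r in Ioc 0 t, β r with hB
  have hB0 : 0 ≤ B := setIntegral_nonneg measurableSet_Ioc fun r hr => hβ0 r hr.1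
  -- The heuristic is `y' ≤ cβ`, but `y` need not be differentiable where it vanishes. The balance
  -- for `y²` is used with one factor `y` replaced by its supremum `Y`.
  let y : ℝ → ℝ := fun τ => √(sqInt (cv k (θ τ)))
  have hy2 : ∀ τ, y τ ^ 2 = sqInt (cv k (θ τ)) := fun τ => Real.sq_sqrt (sqInt_nonneg _)
  have hybdd : BddAbove (y '' Icc 0 t) := by
    obtain ⟨D, hD⟩ : ∃ D, ∀ τ ∈ Icc 0 t, ‖θ τ‖ ≤ D :=
      isCompact_Icc.exists_bound_of_continuousOn F.evol.cont.continuousOn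
    refine ⟨√((∫ x, ‖k x‖) ^ 2 * D ^ 2), ?_⟩
    rintro _ ⟨τ, hτ, rfl⟩
    refine Real.sqrt_le_sqrt ((sqInt_cv_le_norm hk _).trans ?_)
    exact mul_le_mul_of_nonneg_left (pow_le_pow_left₀ (norm_nonneg _) (hD τ hτ) 2) (sq_nonneg _)
  set Y := sSup (y '' Icc 0 t) with hY
  have hyY : ∀ τ ∈ Icc 0 t, y τ ≤ Y := fun τ hτ => le_csSup hybdd ⟨τ, hτ, rfl⟩
  have hY0 : 0 ≤ Y := (Real.sqrt_nonneg _).trans (hyY τ ⟨hτ0, hτt⟩)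
  have hstep : ∀ τ ∈ Icc 0 t, y τ ^ 2 ≤ y 0 ^ 2 + 2 * Y * (c * B) := fun τ hτ => by
    obtain ⟨hI, hE⟩ := F.evol.sqInt_sub_eq hk le_rfl hτ.1
    obtain ⟨K, hK⟩ := F.slice' (t := τ) le_rfl
    have hβτ : IntegrableOn β (Ioc 0 τ) := hβ.mono_set (Ioc_subset_Ioc_right hτ.2)
    rw [intervalIntegral.integral_of_le hτ.1] at hE
    have h1 : (∫ r in Ioc 0 τ, 2 * ∫ x, cv k (θ r) x * rhs κ k (f r) (fun i => g i r) x) ≤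
        ∫ r in Ioc 0 τ, 2 * Y * c * β r := by
      refine integral_mono_ae (hI.const_mul 2) (hβτ.const_mul _) ?_
      filter_upwards [hK, ae_restrict_mem measurableSet_Ioc] with r hr hrm
      have h2 := hr.lowFreq_le hk F.pos.le
      have h3 : √(sqInt (cv k (f r))) ≤ c * β r := by
        rw [← Real.sqrt_sq (hβ0 r hrm.1), hc, ← Real.sqrt_mul hc0]
        refine Real.sqrt_le_sqrt ((hr.sqInt_cv_f_le hk).trans ?_)
        refine mul_le_mul_of_nonneg_left ?_ hc0
        rw [sqInt_eq_norm_sq]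
        exact hβle r hrm.1
      have h4 : √(sqInt (cv k (θ r))) ≤ Y := hyY r ⟨hrm.1.le, hrm.2.trans hτ.2⟩
      have h5 := mul_le_mul h4 h3 (Real.sqrt_nonneg _) hY0
      change 2 * _ ≤ 2 * Y * c * β r
      linarith
    rw [integral_const_mul (2 * Y * c)] at h1
    have h6 : ∫ r in Ioc 0 τ, β r ≤ B :=
      setIntegral_mono_set hβ ((ae_restrict_iff' measurableSet_Ioc).2
        (ae_of_all _ fun r hr => hβ0 r hr.1)) (Ioc_subset_Ioc_right hτ.2).eventuallyLE
    have h7 : 2 * Y * c * ∫ r in Ioc 0 τ, β r ≤ 2 * Y * c * B :=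
      mul_le_mul_of_nonneg_left h6 (by positivity)
    rw [hy2, hy2]
    linarith
  have hYle : Y ^ 2 ≤ y 0 ^ 2 + 2 * Y * (c * B) := by
    have h0 : 0 ≤ y 0 ^ 2 + 2 * Y * (c * B) := by positivity
    have : Y ≤ √(y 0 ^ 2 + 2 * Y * (c * B)) := by
      refine csSup_le ⟨_, τ, ⟨hτ0, hτt⟩, rfl⟩ ?_
      rintro _ ⟨r, hr, rfl⟩
      exact Real.le_sqrt_of_sq_le (hstep r hr)
    calc Y ^ 2 ≤ √(y 0 ^ 2 + 2 * Y * (c * B)) ^ 2 := pow_le_pow_left₀ hY0 this 2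
      _ = _ := Real.sq_sqrt h0
  have hcs : c ^ 2 = d * ∑ i, sqInt (pd i k) := Real.sq_sqrt hc0
  have h8 := pow_le_pow_left₀ (Real.sqrt_nonneg _) (hyY τ ⟨hτ0, hτt⟩) 2
  have h9 : y τ ^ 2 ≤ Y ^ 2 := h8
  rw [← hy2, ← hy2, ← hcs]
  -- The square gives `2YcB ≤ Y²/2 + 2(cB)²`, so the quadratic inequality for `Y` yields `Y² ≤ 2
  -- y(0)² + 4(cB)²`.
  nlinarith [sq_nonneg (Y - 2 * (c * B))]

end Flow

/-! ### Existence of the weak gradient at every time. -/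

theorem pd_sub {k l : E d → ℝ} (hk : IsTest k) (hl : IsTest l) (j : Fin d) :
    pd j (fun x => k x - l x) = fun x => pd j k x - pd j l x := by
  funext x
  unfold pd
  rw [fderiv_fun_sub (hk.1.differentiable (by simp) x) (hl.1.differentiable (by simp) x)]
  simp

theorem isWeakGrad_of_smooth {w : E d → ℝ} (hw : ContDiff ℝ ∞ w) (hw2 : MemLp w 2 volume)
    (hwd : ∀ i, MemLp (pd i w) 2 volume) : IsWeakGrad w (fun i => pd i w) := by
  intro k hk i
  funext x
  have h := integral_mul_pd (hk.comp_sub x).1 hw ((hk.comp_sub x).memLp 2) hw2 i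
    (((hk.comp_sub x).pd i).memLp 2) (hwd i)
  simp only [pd_comp_sub hk, neg_mul, integral_neg, neg_neg] at h
  exact h.symm

theorem tendsto_cv_apply {ι : Type*} {l : Filter ι} {h : ι → E d → ℝ} {g k : E d → ℝ}
    (hk : IsTest k) (hh : ∀ n, MemLp (h n) 2 volume) (hg : MemLp g 2 volume)
    (H : Tendsto (fun n => sqInt (fun x => h n x - g x)) l (𝓝 0)) (x : E d) :
    Tendsto (fun n => cv k (h n) x) l (𝓝 (cv k g x)) :=
  tendsto_integral_mul ((hk.comp_sub x).memLp 2) hh hg H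

theorem IsWeakGrad.of_tendsto {w : ℕ → E d → ℝ} {r : ℕ → Fin d → E d → ℝ} {h : E d → ℝ}
    {q : Fin d → E d → ℝ} (hw : ∀ n, MemLp (w n) 2 volume) (hr : ∀ n i, MemLp (r n i) 2 volume)
    (hh : MemLp h 2 volume) (hq : ∀ i, MemLp (q i) 2 volume) (H : ∀ n, IsWeakGrad (w n) (r n))
    (hwh : Tendsto (fun n => sqInt (fun x => w n x - h x)) atTop (𝓝 0))
    (hrq : ∀ i, Tendsto (fun n => sqInt (fun x => r n i x - q i x)) atTop (𝓝 0)) :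
    IsWeakGrad h q := by
  intro k hk i
  funext x
  refine tendsto_nhds_unique (tendsto_cv_apply (hk.pd i) hw hh hwh x) ?_
  refine (tendsto_cv_apply hk (fun n => hr n i) (hq i) (hrq i) x).congr fun n => ?_
  rw [H n k hk i]

/-- The form-valued function with components `q`. -/
noncomputable def formOf (q : Fin d → E d → ℝ) : E d → (E d →L[ℝ] ℝ) :=
  fun x => ∑ i, q i x • (EuclideanSpace.proj i : E d →L[ℝ] ℝ)

theorem formOf_apply (q : Fin d → E d → ℝ) (x v : E d) : formOf q x v = ∑ i, v i * q i x := by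
  simp [formOf, mul_comm]

theorem norm_formOf_sq_le (q : Fin d → E d → ℝ) (x : E d) : ‖formOf q x‖ ^ 2 ≤ ∑ i, q i x ^ 2 := by
  have h0 : 0 ≤ ∑ i, q i x ^ 2 := Finset.sum_nonneg fun _ _ => sq_nonneg _
  have : ‖formOf q x‖ ≤ √(∑ i, q i x ^ 2) := by
    refine ContinuousLinearMap.opNorm_le_bound _ (Real.sqrt_nonneg _) fun v => ?_
    rw [formOf_apply, Real.norm_eq_abs]
    refine abs_le_of_sq_le_sq ?_ (by positivity)
    rw [mul_pow, Real.sq_sqrt h0, mul_comm]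
    exact sq_sum_mul_le _ _
  calc _ ≤ √(∑ i, q i x ^ 2) ^ 2 := pow_le_pow_left₀ (norm_nonneg _) this 2
    _ = _ := Real.sq_sqrt h0

theorem aestronglyMeasurable_formOf {q : Fin d → E d → ℝ} (hq : ∀ i, MemLp (q i) 2 volume) :
    AEStronglyMeasurable (formOf q) volume :=
  Finset.aestronglyMeasurable_fun_sum _ fun i _ => (hq i).1.smul_const _

theorem eLpNorm_formOf_le {q : Fin d → E d → ℝ} (hq : ∀ i, MemLp (q i) 2 volume) :
    eLpNorm (formOf q) 2 volume ≤ ENNReal.ofReal (√(∑ i, sqInt (q i))) := by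
  have h0 : 0 ≤ ∑ i, sqInt (q i) := Finset.sum_nonneg fun _ _ => sqInt_nonneg _
  have h1 : (eLpNorm (formOf q) 2 volume) ^ 2 ≤ (ENNReal.ofReal (√(∑ i, sqInt (q i)))) ^ 2 := by
    rw [← ENNReal.ofReal_pow (Real.sqrt_nonneg _), Real.sq_sqrt h0,
      eLpNorm_eq_lintegral_rpow_enorm_toReal (by simp) (by simp), ← ENNReal.rpow_natCast,
      ← ENNReal.rpow_mul]
    simp only [ENNReal.toReal_ofNat, Nat.cast_ofNat, one_div, isUnit_iff_ne_zero, ne_eq,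
      OfNat.ofNat_ne_zero, not_false_eq_true, IsUnit.inv_mul_cancel, ENNReal.rpow_one,
      ENNReal.rpow_ofNat]
    unfold sqInt
    rw [← integral_finsetSum _ fun i _ => (hq i).integrable_sq, ofReal_integral_eq_lintegral_ofReal
      (integrable_finsetSum _ fun i _ => (hq i).integrable_sq)
      (ae_of_all _ fun x => Finset.sum_nonneg fun _ _ => sq_nonneg _)]
    refine lintegral_mono fun x => ?_
    rw [← ofReal_norm, ← ENNReal.ofReal_pow (norm_nonneg _)]
    exact ENNReal.ofReal_le_ofReal (norm_formOf_sq_le q x)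
  exact (ENNReal.pow_le_pow_left_iff two_ne_zero).1 h1

theorem hasWeakFDeriv_formOf {h : E d → ℝ} {q : Fin d → E d → ℝ} (hh : MemLp h 2 volume)
    (hq : ∀ i, MemLp (q i) 2 volume) (hw : IsWeakGrad h q) : HasWeakFDeriv h (formOf q) := by
  have hmem : MemLp (formOf q) 2 volume :=
    ⟨aestronglyMeasurable_formOf hq, (eLpNorm_formOf_le hq).trans_lt ENNReal.ofReal_lt_top⟩
  refine ⟨MemLp.locInt hh, hmem.locallyIntegrable (by norm_num), fun φ hφ v => ?_⟩
  -- The mollified identity with the reflected kernel `φ(-·)`, evaluated at the origin, is the usual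
  -- weak identity for `φ`.
  have h1 : ∀ i, ∫ x, pd i φ x * h x = - ∫ x, φ x * q i x := fun i => by
    have := congrFun (hw (fun y => φ (0 - y)) (hφ.comp_sub 0) i) 0
    unfold cv at this
    simp only [pd_comp_sub hφ, sub_sub_cancel, neg_mul, integral_neg] at this
    simpa using congrArg Neg.neg this
  have i1 : ∀ i, Integrable (fun x => v i * (pd i φ x * h x)) volume := fun i =>
    (MemLp.integrable_mul' ((hφ.pd i).memLp 2) hh).const_mul _
  have i2 : ∀ i, Integrable (fun x => v i * (φ x * q i x)) volume := fun i =>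
    (MemLp.integrable_mul' (hφ.memLp 2) (hq i)).const_mul _
  have e1 : ∀ x, fderiv ℝ φ x v • h x = ∑ i, v i * (pd i φ x * h x) := fun x => by
    rw [fderiv_apply_eq_sum, smul_eq_mul, Finset.sum_mul]
    exact Finset.sum_congr rfl fun i _ => by ring
  have e2 : ∀ x, φ x • formOf q x v = ∑ i, v i * (φ x * q i x) := fun x => by
    rw [formOf_apply, smul_eq_mul, Finset.mul_sum]
    exact Finset.sum_congr rfl fun i _ => by ring
  simp only [e1, e2]
  rw [integral_finsetSum _ fun i _ => i1 i, integral_finsetSum _ fun i _ => i2 i,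
    ← Finset.sum_neg_distrib]
  refine Finset.sum_congr rfl fun i _ => ?_
  rw [integral_const_mul, integral_const_mul, h1]
  ring

theorem gradNorm_le {h : E d → ℝ} {q : Fin d → E d → ℝ} (hh : MemLp h 2 volume)
    (hq : ∀ i, MemLp (q i) 2 volume) (hw : IsWeakGrad h q) :
    gradNorm 2 h ≤ ENNReal.ofReal (√(∑ i, sqInt (q i))) :=
  (iInf₂_le (formOf q) (hasWeakFDeriv_formOf hh hq hw)).trans (eLpNorm_formOf_le hq)

namespace Flow

variable {κ : ℝ} {u : ℝ → E d → E d} {A : ℝ → ℝ} {θ : ℝ → L2 d} {f : ℝ → E d → ℝ}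
  {g : Fin d → ℝ → E d → ℝ}

/-- Propagation of the gradient bound from time `s` to time `t`. -/
theorem exists_grad (F : Flow κ u A θ f g) {s t a : ℝ} (hs : 0 ≤ s) (hst : s ≤ t) (ha0 : 0 ≤ a)
    (ha : ∀ᵐ τ ∂(volume.restrict (Ioc s t)), A τ ≤ a) {p : Fin d → E d → ℝ}
    (hp : ∀ i, MemLp (p i) 2 volume) (hpw : IsWeakGrad (θ s) p) :
    ∃ q : Fin d → E d → ℝ, (∀ i, MemLp (q i) 2 volume) ∧ IsWeakGrad (θ t) q ∧
      ∑ i, sqInt (q i) ≤ ∑ i, sqInt (p i) + 2 * a * ∫ τ in Ioc s t, gradSq g τ := by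
  obtain ⟨K, hK⟩ := F.slice' (t := t) hs
  have hκ := F.pos
  have hC := fun n => F.integrableOn_commErr (t := t) hs K n
  have hge := fun i n => integrable_molErr (μ := volume.restrict (Ioc s t)) n (F.evol.gm i)
    (F.ae_g hs i) (F.integrableOn_g hs i)
  have hgs : ∀ n, Integrable (fun τ => ∑ i, molErr n (g i τ)) (volume.restrict (Ioc s t)) :=
    fun n => integrable_finsetSum _ fun i _ => hge i n
  -- `X n` gathers the errors at the starting time, in the dissipation integral and in the
  -- commutator. By linearity in the kernel, the gradient inequality for `mol n - mol m` is bounded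
  -- by `X n + X m`.
  let X : ℕ → ℝ := fun n => 2 * ∑ i, molErr n (p i) +
    (2 * a * (2 * ∫ τ in Ioc s t, ∑ i, molErr n (g i τ)) +
      (2 * κ)⁻¹ * (2 * ∫ τ in Ioc s t, commErr K f g n τ))
  have hX : Tendsto X atTop (𝓝 0) := by
    have h1 := tendsto_finsetSum Finset.univ fun i _ => tendsto_molErr (hp i)
    have h2 : Tendsto (fun n => ∫ τ in Ioc s t, ∑ i, molErr n (g i τ)) atTop (𝓝 0) := by
      have e : ∀ n, ∫ τ in Ioc s t, ∑ i, molErr n (g i τ) =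
          ∑ i, ∫ τ in Ioc s t, molErr n (g i τ) := fun n =>
        integral_finsetSum _ fun i _ => hge i n
      simp only [e]
      simpa using tendsto_finsetSum Finset.univ fun i _ =>
        tendsto_integral_molErr (μ := volume.restrict (Ioc s t)) (F.evol.gm i) (F.ae_g hs i)
        (F.integrableOn_g hs i)
    have h3 := F.tendsto_commErr (t := t) hs K
    have := (h1.const_mul 2).add (((h2.const_mul 2).const_mul (2 * a)).add
      ((h3.const_mul 2).const_mul (2 * κ)⁻¹))
    simpa [X] using this
  have hdiff : ∀ n m, ∑ j, sqInt (fun x => cv (pd j (mol d n)) (θ t) x -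
      cv (pd j (mol d m)) (θ t) x) ≤ X n + X m := fun n m => by
    have hk := (isTest_mol (d := d) n).sub (isTest_mol m)
    have h1 := F.gradient_mollified_le hs hst ha hk
      (R := fun τ => 2 * commErr K f g n τ + 2 * commErr K f g m τ)
      (((hC n).const_mul 2).add ((hC m).const_mul 2)) (by
        filter_upwards [hK] with τ hτ
        refine (hτ.sqInt_comm_le hk).trans ?_
        have h2 := sqInt_cv_mol_sub_mol_le n m hτ.memf
        have h3 : ∑ i, sqInt (cv (fun x => mol d n x - mol d m x) (g i τ)) ≤
            ∑ i, (2 * molErr n (g i τ) + 2 * molErr m (g i τ)) :=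
          Finset.sum_le_sum fun i _ => sqInt_cv_mol_sub_mol_le n m (hτ.memg i)
        rw [Finset.sum_add_distrib, ← Finset.mul_sum, ← Finset.mul_sum] at h3
        have h4 := mul_le_mul_of_nonneg_left h3 (sq_nonneg K)
        unfold commErr
        linarith)
    have e1 : ∀ j, sqInt (fun x => cv (pd j (mol d n)) (θ t) x - cv (pd j (mol d m)) (θ t) x) =
        sqInt (cv (pd j (fun x => mol d n x - mol d m x)) (θ t)) := fun j => by
      congr 1
      funext x
      rw [pd_sub (isTest_mol n) (isTest_mol m), cv_sub_left ((isTest_mol n).pd j)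
        ((isTest_mol m).pd j) (MemLp.locInt (Lp.memLp _))]
    simp only [e1]
    refine h1.trans ?_
    have h5 : ∑ j, sqInt (cv (pd j (fun x => mol d n x - mol d m x)) (θ s)) ≤
        ∑ j, (2 * molErr n (p j) + 2 * molErr m (p j)) := by
      refine Finset.sum_le_sum fun j _ => ?_
      rw [hpw _ hk j]
      exact sqInt_cv_mol_sub_mol_le n m (hp j)
    rw [Finset.sum_add_distrib, ← Finset.mul_sum, ← Finset.mul_sum] at h5
    have h6 : ∫ τ in Ioc s t, ∑ i, sqInt (cv (fun x => mol d n x - mol d m x) (g i τ)) ≤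
        ∫ τ in Ioc s t, (2 * (∑ i, molErr n (g i τ)) + 2 * ∑ i, molErr m (g i τ)) := by
      refine integral_mono_ae (F.integrableOn_gradSq_cv hs hk)
        (((hgs n).const_mul 2).add ((hgs m).const_mul 2)) ?_
      filter_upwards [hK] with τ hτ
      have h3 : ∑ i, sqInt (cv (fun x => mol d n x - mol d m x) (g i τ)) ≤
          ∑ i, (2 * molErr n (g i τ) + 2 * molErr m (g i τ)) :=
        Finset.sum_le_sum fun i _ => sqInt_cv_mol_sub_mol_le n m (hτ.memg i)
      rwa [Finset.sum_add_distrib, ← Finset.mul_sum, ← Finset.mul_sum] at h3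
    rw [integral_add ((hgs n).const_mul 2) ((hgs m).const_mul 2), integral_const_mul,
      integral_const_mul] at h6
    have h7 : ∫ τ in Ioc s t, (2 * commErr K f g n τ + 2 * commErr K f g m τ) =
        2 * (∫ τ in Ioc s t, commErr K f g n τ) + 2 * ∫ τ in Ioc s t, commErr K f g m τ := by
      rw [integral_add ((hC n).const_mul 2) ((hC m).const_mul 2), integral_const_mul,
        integral_const_mul]
    rw [h7]
    have h8 := mul_le_mul_of_nonneg_left h6 (mul_nonneg zero_le_two ha0)
    simp only [X]
    linarith
  have hm := fun n j => memLp_cv ((isTest_mol (d := d) n).pd j) (Lp.memLp (θ t))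
  have hcau : ∀ j, CauchySeq (fun n => (hm n j).toLp _) := fun j => by
    rw [Metric.cauchySeq_iff]
    intro ε hε
    have hev := hX.eventually (gt_mem_nhds (show (0 : ℝ) < ε ^ 2 / 2 by positivity))
    obtain ⟨N, hN⟩ := eventually_atTop.1 hev
    refine ⟨N, fun n hn m hm' => ?_⟩
    rw [dist_eq_norm, ← MemLp.toLp_sub]
    refine lt_of_pow_lt_pow_left₀ 2 hε.le ?_
    rw [← sqInt_eq_norm_toLp_sq]
    have h1 := Finset.single_le_sum (f := fun j => sqInt (fun x => cv (pd j (mol d n)) (θ t) x -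
      cv (pd j (mol d m)) (θ t) x)) (fun _ _ => sqInt_nonneg _) (Finset.mem_univ j)
    have h2 := hdiff n m
    have h3 := hN n hn
    have h4 := hN m hm'
    change sqInt (fun x => cv (pd j (mol d n)) (θ t) x - cv (pd j (mol d m)) (θ t) x) < ε ^ 2
    linarith
  choose q hq using fun j => cauchySeq_tendsto_of_complete (hcau j)
  have hqm : ∀ j, MemLp (q j) 2 volume := fun j => Lp.memLp (q j)
  have hqt : ∀ j, Tendsto (fun n => sqInt (fun x => cv (pd j (mol d n)) (θ t) x - q j x)) atTop
      (𝓝 0) := fun j => by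
    have h1 := (tendsto_iff_norm_sub_tendsto_zero.1 (hq j)).pow 2
    rw [zero_pow two_ne_zero] at h1
    refine h1.congr fun n => ?_
    rw [← sqInt_eq_norm_sq]
    refine sqInt_congr ?_
    filter_upwards [Lp.coeFn_sub ((hm n j).toLp _) (q j), (hm n j).coeFn_toLp] with x h2 h3
    rw [h2, Pi.sub_apply, h3]
  have hLs : ∀ n, ContDiff ℝ ∞ (cv (mol d n) (θ t)) := fun n =>
    contDiff_cv (isTest_mol n) (MemLp.locInt (Lp.memLp _))
  have hL2 : ∀ n, MemLp (cv (mol d n) (θ t)) 2 volume := fun n =>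
    memLp_cv (isTest_mol n) (Lp.memLp _)
  have hpdm : ∀ n j, pd j (cv (mol d n) (θ t)) = cv (pd j (mol d n)) (θ t) := fun n j =>
    pd_cv (isTest_mol n) (MemLp.locInt (Lp.memLp _)) j
  refine ⟨fun j => q j, hqm, ?_, ?_⟩
  · refine IsWeakGrad.of_tendsto (w := fun n => cv (mol d n) (θ t))
      (r := fun n j => cv (pd j (mol d n)) (θ t)) hL2 hm (Lp.memLp _) hqm (fun n => ?_)
      (tendsto_sqInt_cv_mol_sub (Lp.memLp _)) hqt
    simp only [← hpdm]
    exact isWeakGrad_of_smooth (hLs n) (hL2 n) fun j => by rw [hpdm]; exact hm n j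
  -- The quantitative bound is not read off from the Cauchy estimate; it is the limit of the
  -- gradient inequality for a single mollifier.
  · have hl : Tendsto (fun n => ∑ j, sqInt (cv (pd j (mol d n)) (θ t))) atTop
        (𝓝 (∑ j, sqInt (q j))) :=
      tendsto_finsetSum _ fun j _ => tendsto_sqInt (fun n => hm n j) (hqm j) (hqt j)
    have hr := (tendsto_finsetSum Finset.univ fun i _ => tendsto_sqInt_cv_mol (hp i)).add
      (((F.tendsto_gradSq (t := t) hs).const_mul (2 * a)).add
        ((F.tendsto_commErr (t := t) hs K).const_mul (2 * κ)⁻¹))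
    rw [mul_zero, add_zero] at hr
    refine le_of_tendsto_of_tendsto' hl hr fun n => ?_
    have h1 := F.gradient_mollified_le hs hst ha (isTest_mol n) (hC n) (by
      filter_upwards [hK] with τ hτ
      exact hτ.sqInt_comm_le' (isTest_mol n))
    have h2 : ∀ j, cv (pd j (mol d n)) (θ s) = cv (mol d n) (p j) := fun j =>
      hpw _ (isTest_mol n) j
    simp only [h2] at h1
    exact h1

end Flow

/-! ### From the hypotheses to a flow. -/

/-- `gradNorm` is an infimum over weak derivatives. A strict inequality produces an actual
derivative with the bound, so its uniqueness is never needed. -/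
theorem RegVel.of_gradNorm_lt {V : E d → E d} {a : ℝ} (hV : MemLp V 2 volume) (hdiv : IsDivFree V)
    (ha : 0 ≤ a) (h : gradNorm ∞ V < ENNReal.ofReal a) : RegVel V a := by
  unfold gradNorm at h
  simp only [iInf_lt_iff] at h
  obtain ⟨A, hA, hlt⟩ := h
  refine ⟨hV, hdiv, A, hA, ?_⟩
  rw [eLpNorm_exponent_top] at hlt
  filter_upwards [ae_le_eLpNormEssSup (f := A) (μ := volume)] with x hx
  have := hx.trans hlt.le
  rw [← ofReal_norm] at this
  exact (ENNReal.ofReal_le_ofReal_iff ha).1 this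

theorem sum_sqInt_coord_le {V : E d → E d} (hV : MemLp V 2 volume) {b : ℝ} (hb : 0 ≤ b)
    (h : eLpNorm V 2 volume ≤ ENNReal.ofReal b) : ∑ i, sqInt (fun x => V x i) ≤ b ^ 2 := by
  rw [← ENNReal.ofReal_le_ofReal_iff (by positivity), ENNReal.ofReal_pow hb]
  refine le_trans ?_ (pow_le_pow_left₀ (zero_le) h 2)
  have h1 : ∑ i, sqInt (fun x => V x i) = ∫ x, ‖V x‖ ^ 2 := by
    unfold sqInt
    rw [← integral_finsetSum _ fun i _ => (memLp_coord hV i).integrable_sq]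
    exact integral_congr_ae (ae_of_all _ fun x => (EuclideanSpace.real_norm_sq_eq _).symm)
  have h2 := eLpNorm_sq_eq hV.norm
  rw [eLpNorm_norm] at h2
  rw [h1, h2]
  rfl

theorem sqInt_apply_le {A : E d → (E d →L[ℝ] ℝ)} (hA : MemLp A 2 volume) {b : ℝ} (hb : 0 ≤ b)
    (h : eLpNorm A 2 volume ≤ ENNReal.ofReal b) (i : Fin d) :
    MemLp (fun x => A x (stdE i)) 2 volume ∧ sqInt (fun x => A x (stdE i)) ≤ b ^ 2 := by
  have hm : MemLp (fun x => A x (stdE i)) 2 volume :=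
    (ContinuousLinearMap.apply ℝ ℝ (stdE i)).comp_memLp' hA
  refine ⟨hm, ?_⟩
  rw [← ENNReal.ofReal_le_ofReal_iff (by positivity), ENNReal.ofReal_pow hb, ← eLpNorm_sq_eq hm]
  refine pow_le_pow_left₀ (zero_le) (le_trans (eLpNorm_mono fun x => ?_) h) 2
  simpa [norm_stdE] using (A x).le_opNorm (stdE i)

theorem exists_weakGrad_of_gradNorm_lt {h : E d → ℝ} {b : ℝ} (hb : 0 ≤ b)
    (H : gradNorm 2 h < ENNReal.ofReal b) : ∃ p : Fin d → E d → ℝ,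
      (∀ i, MemLp (p i) 2 volume) ∧ IsWeakGrad h p ∧ ∑ i, sqInt (p i) ≤ d * b ^ 2 := by
  unfold gradNorm at H
  simp only [iInf_lt_iff] at H
  obtain ⟨A, hA, hlt⟩ := H
  have hA2 : MemLp A 2 volume := ⟨hA.2.1.aestronglyMeasurable, hlt.trans ENNReal.ofReal_lt_top⟩
  refine ⟨fun i x => A x (stdE i), fun i => (sqInt_apply_le hA2 hb hlt.le i).1,
    isWeakGrad_of_hasWeakFDeriv hA, ?_⟩
  refine (Finset.sum_le_sum fun i _ => (sqInt_apply_le hA2 hb hlt.le i).2).trans_eq ?_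
  simp

theorem gradient_eq_sum (φ : E d → ℝ) (x : E d) : gradient φ x = ∑ i, pd i φ x • stdE i := by
  conv_lhs => rw [← sum_smul_stdE (gradient φ x)]
  refine Finset.sum_congr rfl fun i _ => ?_
  congr 1
  have h : inner ℝ (stdE i) (gradient φ x) = pd i φ x := by
    rw [real_inner_comm]
    simp [gradient, pd]
  rw [← h, stdE, EuclideanSpace.inner_single_left]
  simp

theorem ae_Ioi_of_ae_Ioc {P : ℝ → Prop}
    (h : ∀ n : ℕ, ∀ᵐ s ∂(volume.restrict (Ioc (0 : ℝ) n)), P s) :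
    ∀ᵐ s ∂(volume.restrict (Ioi (0 : ℝ))), P s := by
  rw [ae_restrict_iff' measurableSet_Ioi]
  simp only [ae_restrict_iff' measurableSet_Ioc] at h
  filter_upwards [ae_all_iff.2 h] with s hs hs0
  obtain ⟨n, hn⟩ := exists_nat_ge s
  exact hs n ⟨hs0, hn⟩

theorem rpow_one_add_le {s T b : ℝ} (hs : 0 < s) (hT : s ≤ T) : (1 + s) ^ b ≤ (1 + T) ^ |b| :=
  (Real.rpow_le_rpow_of_exponent_le (by linarith) (le_abs_self b)).trans
    (Real.rpow_le_rpow (by linarith) (by linarith) (abs_nonneg b))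

/-- Jointly measurable versions of `∇θ` and `-u·∇θ` serve as `g` and `f`. The factor `2` in the
Jacobian bound creates the strict inequality required by `RegVel.of_gradNorm_lt`, and `max t 0`
extends the solution to a curve continuous on all of `ℝ`. -/
theorem Setting.exists_flow {α r c κ₀ M κ ν : ℝ} {u : ℝ → E d → E d} {θ₀ : L2 d}
    {θ : ℝ → L2 d} (S : Setting d α r c κ₀ M κ u θ₀ θ) (hc : 0 < c) (hν : 0 ≤ ν)
    (hu : DecaysLike c (fun t => gradNorm ∞ (u t)) ν) :
    ∃ (f : ℝ → E d → ℝ) (g : Fin d → ℝ → E d → ℝ),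
      Flow κ u (fun s => 2 * c * (1 + s) ^ (-ν)) (fun t => θ (max t 0)) f g := by
  obtain ⟨G, hGm, hGw, hGi, hGe⟩ := S.solution.eqn
  set μ := (volume.restrict (Ioi (0 : ℝ))).prod (volume : Measure (E d))
  have hg0 : ∀ i : Fin d, AEStronglyMeasurable (fun p : ℝ × E d => G p.1 p.2 (stdE i)) μ :=
    fun i => (ContinuousLinearMap.apply ℝ ℝ (stdE i)).continuous.comp_aestronglyMeasurable hGm
  have hf0 : AEStronglyMeasurable (fun p : ℝ × E d => - G p.1 p.2 (u p.1 p.2)) μ :=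
    (isBoundedBilinearMap_apply.continuous.comp_aestronglyMeasurable
      (hGm.prodMk S.velocity.meas)).neg
  let g : Fin d → ℝ → E d → ℝ := fun i s x => (hg0 i).mk _ (s, x)
  let f : ℝ → E d → ℝ := fun s x => hf0.mk _ (s, x)
  have hgeq : ∀ᵐ s ∂(volume.restrict (Ioi (0 : ℝ))), ∀ i, (fun x => G s x (stdE i)) =ᵐ[volume] g i s :=
    ae_all_iff.2 fun i => Measure.ae_ae_of_ae_prod (hg0 i).ae_eq_mk
  have hfeq : ∀ᵐ s ∂(volume.restrict (Ioi (0 : ℝ))), (fun x => - G s x (u s x)) =ᵐ[volume] f s :=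
    Measure.ae_ae_of_ae_prod hf0.ae_eq_mk
  have hG2 : ∀ᵐ s ∂(volume.restrict (Ioi (0 : ℝ))), MemLp (G s) 2 volume := by
    have hlt : ∀ᵐ s ∂(volume.restrict (Ioi (0 : ℝ))), eLpNorm (G s) 2 volume < ⊤ := by
      refine ae_Ioi_of_ae_Ioc fun n => ?_
      have hm : AEMeasurable (fun s => eLpNorm (G s) 2 volume ^ 2) (volume.restrict (Ioc (0 : ℝ) n)) := by
        have h1 : AEMeasurable (fun s => ∫⁻ x, ‖G s x‖ₑ ^ 2) (volume.restrict (Ioi (0 : ℝ))) :=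
          (hGm.enorm.pow_const 2).lintegral_prod_right'
        refine (h1.mono_measure (Measure.restrict_mono Ioc_subset_Ioi_self le_rfl)).congr
          (ae_of_all _ fun s => ?_)
        change ∫⁻ x, ‖G s x‖ₑ ^ 2 = eLpNorm (G s) 2 volume ^ 2
        rw [eLpNorm_eq_lintegral_rpow_enorm_toReal (by simp) (by simp), ← ENNReal.rpow_natCast,
          ← ENNReal.rpow_mul]
        simp
      filter_upwards [ae_lt_top' hm (hGi n).ne] with s hs
      exact (ENNReal.pow_lt_top_iff.1 hs).resolve_right two_ne_zero
    filter_upwards [hlt, hGw] with s h1 h2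
    exact ⟨h2.2.1.aestronglyMeasurable, h1⟩
  have hpos : ∀ᵐ s ∂(volume.restrict (Ioi (0 : ℝ))), s ∈ Ioi (0 : ℝ) :=
    ae_restrict_mem measurableSet_Ioi
  let a : ℝ → ℝ := fun s => 2 * c * (1 + s) ^ (-ν)
  -- The sup bound on `u` given by `ae_norm_le_sum`, made uniform on `(0,T]`; the absolute value on
  -- the exponent covers both signs of `α`.
  let K : ℝ → ℝ := fun T => ∑ _i : Fin d, (d * (2 * c) +
    √(sqInt (kern d 1) * (c * (1 + T) ^ |(-α)|) ^ 2))
  have hslice : ∀ᵐ s ∂(volume.restrict (Ioi (0 : ℝ))), ∀ T, s ≤ T →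
      Slice (u s) (a s) (K T) (θ (max s 0)) (f s) (fun i => g i s) := by
    filter_upwards [hpos, hG2, hgeq, hfeq, hGw] with s hs h2 h3 h4 h5 T hT
    have hs' : (0 : ℝ) < s := hs
    have hp : 0 < c * (1 + s) ^ (-ν) := mul_pos hc (Real.rpow_pos_of_pos (by linarith) _)
    have hreg : RegVel (u s) (a s) := by
      refine RegVel.of_gradNorm_lt (S.velocity.memLp s hs) (S.velocity.divFree s hs) ?_
        ((hu s hs).2.trans_lt ?_)
      · change 0 ≤ 2 * c * (1 + s) ^ (-ν)
        linarith
      · rw [ENNReal.ofReal_lt_ofReal_iff] <;>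
        · change _ < 2 * c * (1 + s) ^ (-ν)
          linarith
    have ha0 : 0 ≤ a s := by
      change 0 ≤ 2 * c * (1 + s) ^ (-ν)
      linarith
    have ha1 : a s ≤ 2 * c := by
      have : (1 + s) ^ (-ν) ≤ 1 := Real.rpow_le_one_of_one_le_of_nonpos (by linarith) (by linarith)
      change 2 * c * (1 + s) ^ (-ν) ≤ 2 * c
      nlinarith
    refine ⟨hreg, ?_, Lp.memLp _, fun i => ?_, ?_, ?_⟩
    · filter_upwards [ae_norm_le_sum hreg ha0] with x hx
      refine hx.trans (Finset.sum_le_sum fun i _ => ?_)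
      have h6 := sum_sqInt_coord_le (S.velocity.memLp s hs)
        (mul_nonneg hc.le (Real.rpow_nonneg (by linarith) _)) (S.velocity_decay s hs).2
      have h7 : sqInt (fun x => u s x i) ≤ ∑ i, sqInt (fun x => u s x i) :=
        Finset.single_le_sum (f := fun i => sqInt (fun x => u s x i))
          (fun _ _ => sqInt_nonneg _) (Finset.mem_univ i)
      have h8 : (c * (1 + s) ^ (-α)) ^ 2 ≤ (c * (1 + T) ^ |(-α)|) ^ 2 := by
        have := rpow_one_add_le (b := -α) hs' hT
        have h0 := Real.rpow_nonneg (show 0 ≤ 1 + s by linarith) (-α)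
        gcongr
      have h9 := sqInt_nonneg (kern d 1)
      gcongr
      exact h7.trans (h6.trans h8)
    · exact (memLp_congr_ae (h3 i)).1 ((ContinuousLinearMap.apply ℝ ℝ (stdE i)).comp_memLp' h2)
    · rw [max_eq_left hs'.le]
      intro k hk i
      rw [isWeakGrad_of_hasWeakFDeriv h5 k hk i]
      exact cv_congr (h3 i)
    · filter_upwards [ae_all_iff.2 h3, h4] with x h6 h7
      rw [← h7, adv]
      simp only [← h6]
      conv_lhs => rw [← sum_smul_stdE (u s x)]
      simp
  have hgm : ∀ i, StronglyMeasurable (Function.uncurry (g i)) := fun i =>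
    (hg0 i).stronglyMeasurable_mk
  have hfm : StronglyMeasurable (Function.uncurry f) := hf0.stronglyMeasurable_mk
  have hsub : ∀ {T : ℝ} {P : ℝ → Prop}, (∀ᵐ s ∂(volume.restrict (Ioi (0 : ℝ))), P s) →
      ∀ᵐ s ∂(volume.restrict (Ioc (0 : ℝ) T)), P s := fun h =>
    ae_restrict_of_ae_restrict_of_subset Ioc_subset_Ioi_self h
  have hsl : ∀ T, ∀ᵐ s ∂(volume.restrict (Ioc (0 : ℝ) T)),
      Slice (u s) (a s) (K T) (θ (max s 0)) (f s) (fun i => g i s) := fun T => by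
    filter_upwards [hsub hslice, ae_restrict_mem measurableSet_Ioc] with s hs h0 using hs T h0.2
  have hgi : ∀ i, ∀ T : ℝ, IntegrableOn (fun s => sqInt (g i s)) (Ioc 0 T) := fun i T => by
    refine ⟨(stronglyMeasurable_sqInt (hgm i)).aestronglyMeasurable, ?_⟩
    refine lt_of_le_of_lt (lintegral_mono_ae ?_) (hGi T)
    filter_upwards [hsub hG2, hsub hgeq] with s h2 h3
    obtain ⟨h4, h5⟩ := sqInt_apply_le h2 ENNReal.toReal_nonneg
      (ENNReal.ofReal_toReal h2.2.ne).ge i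
    rw [Real.enorm_of_nonneg (sqInt_nonneg _), ← sqInt_congr (h3 i)]
    refine (ENNReal.ofReal_le_ofReal h5).trans_eq ?_
    rw [ENNReal.ofReal_pow ENNReal.toReal_nonneg, ENNReal.ofReal_toReal h2.2.ne]
  refine ⟨f, g, S.kappa_pos, ⟨?_, hfm, hgm, ?_, fun i => ?_, fun T => ?_, hgi, fun φ hφ t ht => ?_⟩,
    fun T => ⟨K T, hsl T⟩⟩
  · exact S.solution.cont.comp_continuous (by fun_prop) fun t => mem_Ici.2 (le_max_right t 0)
  · filter_upwards [hslice] with s hs using (hs s le_rfl).memf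
  · filter_upwards [hslice] with s hs using (hs s le_rfl).memg i
  · refine Integrable.mono' ((integrable_finsetSum Finset.univ fun i _ => hgi i T).const_mul
      (K T ^ 2)) (stronglyMeasurable_sqInt hfm).aestronglyMeasurable ?_
    filter_upwards [hsl T] with s hs
    rw [Real.norm_of_nonneg (sqInt_nonneg _), sqInt_congr hs.feq]
    refine le_trans (le_of_eq ?_) (sqInt_adv_le hs.vel.memLp.1 hs.bdd hs.memg)
    simp [sqInt]
  · have h1 := hGe φ hφ t ht
    rw [max_eq_left ht, max_self, S.solution.init, h1]
    refine intervalIntegral.integral_congr_ae ?_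
    rw [uIoc_of_le ht, ← ae_restrict_iff' measurableSet_Ioc]
    filter_upwards [hsub hgeq, hsub hfeq] with s h3 h4
    refine integral_congr_ae ?_
    filter_upwards [ae_all_iff.2 h3, h4] with x h5 h6
    rw [← h6, gradient_eq_sum, map_sum]
    simp only [map_smul, smul_eq_mul, h5]
    ring

/-! ### Plancherel for mollifications, and low frequencies of the datum. -/

/-- A test function as a complex Schwartz function. -/
noncomputable def IsTest.schwartz {φ : E d → ℝ} (hφ : IsTest φ) : SchwartzMap (E d) ℂ :=
  HasCompactSupport.toSchwartzMap (f := fun x => (φ x : ℂ))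
    (hφ.2.comp_left (g := fun y : ℝ => (y : ℂ)) Complex.ofReal_zero)
    (Complex.ofRealCLM.contDiff.comp hφ.1)

theorem IsTest.schwartz_apply {φ : E d → ℝ} (hφ : IsTest φ) (x : E d) :
    hφ.schwartz x = (φ x : ℂ) := rfl

theorem IsTest.cv {k φ : E d → ℝ} (hk : IsTest k) (hφ : IsTest φ) : IsTest (cv k φ) := by
  refine ⟨contDiff_cv hk hφ.continuous.locallyIntegrable, ?_⟩
  rw [cv_eq_convolution]
  exact hk.2.convolution _ hφ.2

theorem schwartz_cv {k φ : E d → ℝ} (hk : IsTest k) (hφ : IsTest φ) (ξ : E d) :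
    𝓕 (hk.cv hφ).schwartz ξ = 𝓕 hk.schwartz ξ * 𝓕 hφ.schwartz ξ := by
  have h := Real.fourier_mul_convolution_eq (f₁ := fun x => hk.schwartz x)
    (f₂ := fun x => hφ.schwartz x) hk.schwartz.integrable hφ.schwartz.integrable ξ
  rw [SchwartzMap.fourier_coe, SchwartzMap.fourier_coe, SchwartzMap.fourier_coe]
  refine Eq.trans (congrFun (congrArg _ (funext fun x => ?_)) ξ) h
  rw [IsTest.schwartz_apply, cv_comm]
  change ((∫ y, φ (x - y) * k y : ℝ) : ℂ) = ∫ y, (k y : ℂ) * (φ (x - y) : ℂ)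
  rw [← integral_complex_ofReal]
  refine integral_congr_ae (ae_of_all _ fun y => ?_)
  change ((φ (x - y) * k y : ℝ) : ℂ) = (k y : ℂ) * (φ (x - y) : ℂ)
  push_cast
  ring

theorem sqInt_cv_eq_of_test {k φ : E d → ℝ} (hk : IsTest k) (hφ : IsTest φ) :
    sqInt (cv k φ) = ∫ ξ, ‖𝓕 hk.schwartz ξ‖ ^ 2 * ‖𝓕 hφ.schwartz ξ‖ ^ 2 := by
  have h := SchwartzMap.integral_norm_sq_fourier (hk.cv hφ).schwartz
  simp only [IsTest.schwartz_apply, Complex.norm_real, Real.norm_eq_abs, sq_abs] at h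
  refine h.symm.trans (integral_congr_ae (ae_of_all _ fun ξ => ?_))
  change ‖𝓕 (hk.cv hφ).schwartz ξ‖ ^ 2 = _
  rw [schwartz_cv, norm_mul, mul_pow]

theorem fourierL2_of_test {φ : E d → ℝ} (hφ : IsTest φ) {h : L2 d} (hh : h =ᵐ[volume] φ) :
    fourierL2 h =ᵐ[volume] fun ξ => 𝓕 hφ.schwartz ξ := by
  have e : Complex.ofRealCLM.compLp h = hφ.schwartz.toLp 2 := by
    refine Lp.ext ?_
    filter_upwards [Complex.ofRealCLM.coeFn_compLp h, hφ.schwartz.coeFn_toLp 2 volume, hh]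
      with x h1 h2 h3
    rw [h1, h2, h3]
    rfl
  unfold fourierL2
  rw [e, SchwartzMap.toLp_fourier_eq]
  exact SchwartzMap.coeFn_toLp (𝓕 hφ.schwartz) 2 volume

theorem norm_fourierL2 (h : L2 d) : ‖fourierL2 h‖ = ‖h‖ := by
  unfold fourierL2
  rw [Lp.norm_fourier_eq, Lp.norm_def, Lp.norm_def]
  congr 1
  refine eLpNorm_congr_norm_ae ?_
  filter_upwards [Complex.ofRealCLM.coeFn_compLp h] with x h1
  rw [h1]
  simp

theorem continuous_fourierL2 : Continuous (fourierL2 (d := d)) := by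
  have h1 : Continuous fun h : L2 d => Complex.ofRealCLM.compLp h :=
    (Complex.ofRealCLM.compLpL 2 (volume : Measure (E d))).continuous
  exact (Lp.fourierTransformₗᵢ (E d) ℂ).continuous.comp h1

theorem integral_norm_sq_Lp (b : Lp ℂ 2 (volume : Measure (E d))) :
    ∫ ξ, ‖b ξ‖ ^ 2 = ‖b‖ ^ 2 := by
  have h := eLpNorm_sq_eq (Lp.memLp b).norm
  rw [eLpNorm_norm] at h
  rw [Lp.norm_def, ← ENNReal.toReal_pow, h, ENNReal.toReal_ofReal (sqInt_nonneg _)]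
  rfl

theorem integrable_norm_sq_Lp (b : Lp ℂ 2 (volume : Measure (E d))) :
    Integrable (fun ξ => ‖b ξ‖ ^ 2) volume := (Lp.memLp b).norm.integrable_sq

theorem integrable_mul_norm_sq {w : E d → ℝ} (hw : Continuous w) {C : ℝ} (hC : ∀ ξ, |w ξ| ≤ C)
    (b : Lp ℂ 2 (volume : Measure (E d))) : Integrable (fun ξ => w ξ * ‖b ξ‖ ^ 2) volume :=
  (integrable_norm_sq_Lp b).bdd_mul hw.aestronglyMeasurable (ae_of_all _ hC)

/-- The frequency side of `sqInt_cv_eq` depends continuously on the `L²` function, since a bounded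
multiplier is Lipschitz. With `continuous_sqInt_cv` this reduces Plancherel to test functions by
density. -/
theorem continuous_integral_mul_norm_sq {w : E d → ℂ} (hw : Continuous w) {C : ℝ}
    (hC : ∀ ξ, ‖w ξ‖ ≤ C) :
    Continuous fun b : Lp ℂ 2 (volume : Measure (E d)) => ∫ ξ, ‖w ξ‖ ^ 2 * ‖b ξ‖ ^ 2 := by
  have hC0 : 0 ≤ C := (norm_nonneg _).trans (hC 0)
  have hm : ∀ b : Lp ℂ 2 (volume : Measure (E d)), MemLp (fun ξ => w ξ * b ξ) 2 volume := fun b =>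
    (Lp.memLp b).of_le_mul (c := C) (hw.aestronglyMeasurable.mul (Lp.memLp b).1)
      (ae_of_all _ fun ξ => by
        rw [norm_mul]; exact mul_le_mul_of_nonneg_right (hC ξ) (norm_nonneg _))
  have hL : LipschitzWith ⟨C, hC0⟩ fun b => (hm b).toLp _ := by
    refine LipschitzWith.of_dist_le_mul fun b b' => ?_
    rw [dist_eq_norm, dist_eq_norm]
    refine Lp.norm_le_mul_norm_of_ae_le_mul ?_
    filter_upwards [Lp.coeFn_sub ((hm b).toLp _) ((hm b').toLp _), Lp.coeFn_sub b b',
      (hm b).coeFn_toLp, (hm b').coeFn_toLp] with x h1 h2 h3 h4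
    rw [h1, h2, Pi.sub_apply, Pi.sub_apply, h3, h4, ← mul_sub, norm_mul]
    exact mul_le_mul_of_nonneg_right (hC x) (norm_nonneg _)
  refine (hL.continuous.norm.pow 2).congr fun b => ?_
  change ‖(hm b).toLp _‖ ^ 2 = _
  rw [← integral_norm_sq_Lp]
  refine integral_congr_ae ?_
  filter_upwards [(hm b).coeFn_toLp] with x h1
  rw [h1, norm_mul, mul_pow]

theorem cv_sub_right {k h h' : E d → ℝ} (hk : IsTest k) (hh : LocallyIntegrable h volume)
    (hh' : LocallyIntegrable h' volume) (x : E d) :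
    cv k (fun y => h y - h' y) x = cv k h x - cv k h' x := by
  unfold cv
  rw [← integral_sub (integrable_cv_integrand hk hh x) (integrable_cv_integrand hk hh' x)]
  simp [mul_sub]

theorem continuous_sqInt_cv {k : E d → ℝ} (hk : IsTest k) :
    Continuous fun h : L2 d => sqInt (cv k h) := by
  have hm : ∀ h : L2 d, MemLp (cv k h) 2 volume := fun h => memLp_cv hk (Lp.memLp h)
  have hL : LipschitzWith ⟨∫ x, ‖k x‖, integral_nonneg fun _ => norm_nonneg _⟩
      fun h => (hm h).toLp _ := by
    refine LipschitzWith.of_dist_le_mul fun b b' => ?_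
    rw [dist_eq_norm, dist_eq_norm, ← MemLp.toLp_sub]
    refine (pow_le_pow_iff_left₀ (norm_nonneg _) (mul_nonneg (integral_nonneg fun _ => norm_nonneg _) (norm_nonneg _)) two_ne_zero).1 ?_
    rw [← sqInt_eq_norm_toLp_sq]
    have e : cv k b - cv k b' = cv k (b - b' : L2 d) := by
      rw [cv_congr (Lp.coeFn_sub b b')]
      funext x
      exact (cv_sub_right hk (MemLp.locInt (Lp.memLp b)) (MemLp.locInt (Lp.memLp b')) x).symm
    rw [e]
    refine (sqInt_cv_le hk (Lp.memLp _)).trans_eq ?_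
    rw [sqInt_eq_norm_sq, mul_pow]
  refine (hL.continuous.norm.pow 2).congr fun b => ?_
  exact (sqInt_eq_norm_toLp_sq (hm b)).symm

theorem exists_norm_fourier_le {k : E d → ℝ} (hk : IsTest k) (n : ℕ) :
    ∃ C : ℝ, ∀ ξ, (1 + ‖ξ‖) ^ n * ‖𝓕 hk.schwartz ξ‖ ≤ C := by
  refine ⟨2 ^ n * ((Finset.Iic (n, 0)).sup fun m => SchwartzMap.seminorm ℝ m.1 m.2)
    (𝓕 hk.schwartz), fun ξ => ?_⟩
  have h := SchwartzMap.one_add_le_sup_seminorm_apply (𝕜 := ℝ) (m := (n, 0)) (k := n) (n := 0)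
    le_rfl le_rfl (𝓕 hk.schwartz) ξ
  rw [norm_iteratedFDeriv_zero] at h
  exact h

theorem norm_fourier_le {k : E d → ℝ} (hk : IsTest k) :
    ∃ C : ℝ, ∀ ξ, ‖𝓕 hk.schwartz ξ‖ ≤ C := by
  obtain ⟨C, hC⟩ := exists_norm_fourier_le hk 0
  exact ⟨C, fun ξ => by simpa using hC ξ⟩

/-- Plancherel for convolutions with a test function. -/
theorem sqInt_cv_eq {k : E d → ℝ} (hk : IsTest k) (h : L2 d) :
    sqInt (cv k h) = ∫ ξ, ‖𝓕 hk.schwartz ξ‖ ^ 2 * ‖fourierL2 h ξ‖ ^ 2 := by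
  obtain ⟨C, hC⟩ := norm_fourier_le hk
  have hc := (continuous_integral_mul_norm_sq (𝓕 hk.schwartz).continuous hC).comp
    continuous_fourierL2
  have hd := Lp.dense_hasCompactSupport_contDiff (F := ℝ) (μ := (volume : Measure (E d)))
    (p := 2) (by simp)
  refine congrFun (Continuous.ext_on hd (continuous_sqInt_cv hk) hc ?_) h
  rintro h ⟨φ, hφ, hc, hs⟩
  have hφt : IsTest φ := ⟨hs, hc⟩
  change sqInt (cv k h) = ∫ ξ, ‖𝓕 hk.schwartz ξ‖ ^ 2 * ‖fourierL2 h ξ‖ ^ 2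
  rw [cv_congr hφ, sqInt_cv_eq_of_test hk hφt]
  refine integral_congr_ae ?_
  filter_upwards [fourierL2_of_test hφt hφ] with ξ h1
  rw [h1]

theorem fourier_kern {ε : ℝ} (hε : 0 < ε) (ξ : E d) :
    𝓕 (isTest_kern (d := d) hε).schwartz ξ = 𝓕 (isTest_kern₁ d).schwartz (ε • ξ) := by
  rw [SchwartzMap.fourier_coe, SchwartzMap.fourier_coe, Real.fourier_eq, Real.fourier_eq]
  have h := Measure.integral_comp_inv_smul_of_nonneg (volume : Measure (E d))
    (fun v => Real.fourierChar (-inner ℝ v (ε • ξ)) • (isTest_kern₁ d).schwartz v) hε.le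
  simp only [finrank_euclideanSpace, Fintype.card_fin] at h
  have e : ∀ v, Real.fourierChar (-inner ℝ v ξ) • (isTest_kern (d := d) hε).schwartz v =
      (ε ^ d)⁻¹ • (Real.fourierChar (-inner ℝ (ε⁻¹ • v) (ε • ξ)) •
        (isTest_kern₁ d).schwartz (ε⁻¹ • v)) := fun v => by
    have h1 : inner ℝ (ε⁻¹ • v) (ε • ξ) = inner ℝ v ξ := by
      rw [real_inner_smul_left, real_inner_smul_right, inv_mul_cancel_left₀ hε.ne']
    rw [h1, smul_comm, IsTest.schwartz_apply, IsTest.schwartz_apply, kern]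
    congr 1
    rw [Complex.real_smul]
    push_cast
    rfl
  simp only [e]
  rw [integral_smul, h, smul_smul, inv_mul_cancel₀ (by positivity), one_smul]

/-- The weight `(1+|x|)^{-16}`. -/
noncomputable def wt (x : E d) : ℝ := ((1 + ‖x‖) ^ 16)⁻¹

theorem continuous_wt : Continuous (wt (d := d)) :=
  Continuous.inv₀ (by fun_prop) fun x => by positivity

theorem wt_nonneg (x : E d) : 0 ≤ wt x := by unfold wt; positivity

theorem wt_le_one (x : E d) : wt x ≤ 1 :=
  inv_le_one_of_one_le₀ (one_le_pow₀ (by linarith [norm_nonneg x]))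

/-- For `‖x‖ ≥ 1` one has `1 + ‖x‖ ≥ (4/3)(1 + ‖x‖/2)`, and the power `16` is large enough that
`(4/3)^16 ≥ 64`. -/
theorem wt_le_half (x : E d) (hx : 1 ≤ ‖x‖) : wt x ≤ 1 / 64 * wt ((2⁻¹ : ℝ) • x) := by
  have h : (4 / 3 * (1 + ‖x‖ / 2)) ^ 16 ≤ (1 + ‖x‖) ^ 16 := by
    gcongr
    linarith
  unfold wt
  rw [norm_smul, Real.norm_of_nonneg (by norm_num), one_div, ← mul_inv]
  refine inv_anti₀ (by positivity) (le_trans ?_ h)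
  rw [mul_pow, inv_mul_eq_div]
  gcongr
  norm_num

/-- Weighted frequency energy. -/
noncomputable def wtEnergy (h : L2 d) (ε : ℝ) : ℝ := ∫ ξ, wt (ε • ξ) * ‖fourierL2 h ξ‖ ^ 2

theorem integrable_wtEnergy (h : L2 d) (ε : ℝ) :
    Integrable (fun ξ => wt (ε • ξ) * ‖fourierL2 h ξ‖ ^ 2) volume :=
  integrable_mul_norm_sq (w := fun ξ => wt (ε • ξ)) (continuous_wt.comp (by fun_prop)) (C := 1)
    (fun ξ => by rw [abs_of_nonneg (wt_nonneg _)]; exact wt_le_one _) _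

theorem wtEnergy_le (h : L2 d) (ε : ℝ) : wtEnergy h ε ≤ ‖h‖ ^ 2 := by
  rw [← norm_fourierL2, ← integral_norm_sq_Lp]
  refine integral_mono (integrable_wtEnergy h ε) (integrable_norm_sq_Lp _) fun ξ => ?_
  exact mul_le_of_le_one_left (sq_nonneg _) (wt_le_one _)

/-- Inside the ball of radius `1/ε` the weight is at most one; outside, `wt_le_half` gains a factor
`1/64` when the scale is halved. Iteration replaces a dyadic decomposition. -/
theorem wtEnergy_le_half (h : L2 d) {ε : ℝ} (hε : 0 < ε) :
    wtEnergy h ε ≤ lowFreqEnergy h ε⁻¹ + 1 / 64 * wtEnergy h (ε / 2) := by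
  unfold wtEnergy lowFreqEnergy
  rw [← integral_indicator measurableSet_closedBall, ← integral_const_mul (1 / 64 : ℝ)]
  have i1 := (integrable_norm_sq_Lp (fourierL2 h)).indicator
    (measurableSet_closedBall (x := (0 : E d)) (ε := ε⁻¹))
  have i2 := (integrable_wtEnergy h (ε / 2)).const_mul (1 / 64)
  rw [← integral_add i1 i2]
  refine integral_mono (integrable_wtEnergy h ε) (i1.add i2) fun ξ => ?_
  have hn := sq_nonneg ‖fourierL2 h ξ‖
  have hw := wt_nonneg ((ε / 2) • ξ)
  by_cases hξ : ξ ∈ Metric.closedBall (0 : E d) ε⁻¹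
  · simp only [indicator_of_mem hξ]
    have := mul_le_of_le_one_left hn (wt_le_one (ε • ξ))
    have := mul_nonneg hw hn
    linarith
  · simp only [indicator_of_notMem hξ]
    rw [zero_add, ← mul_assoc]
    refine mul_le_mul_of_nonneg_right ?_ hn
    have h1 : 1 ≤ ‖ε • ξ‖ := by
      rw [mem_closedBall_zero_iff, not_le] at hξ
      rw [norm_smul, Real.norm_of_nonneg hε.le]
      have := mul_lt_mul_of_pos_left hξ hε
      rw [mul_inv_cancel₀ hε.ne'] at this
      exact this.le
    have h2 := wt_le_half _ h1
    rwa [smul_smul, inv_mul_eq_div] at h2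

theorem wtEnergy_le_rpow (h : L2 d) {B p : ℝ} (hp : p ≤ 5) (hB : 0 ≤ B)
    (hL : ∀ δ : ℝ, 0 < δ → lowFreqEnergy h δ ≤ B * δ ^ p) {ε : ℝ} (hε : 0 < ε) :
    wtEnergy h ε ≤ 2 * B * ε ^ (-p) := by
  have key : ∀ n : ℕ, ∀ ε : ℝ, 0 < ε →
      wtEnergy h ε ≤ 2 * B * ε ^ (-p) + (1 / 64 : ℝ) ^ n * ‖h‖ ^ 2 := by
    intro n
    induction n with
    | zero =>
      intro ε hε
      have := wtEnergy_le h ε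
      have := Real.rpow_nonneg hε.le (-p)
      have : 0 ≤ 2 * B * ε ^ (-p) := by positivity
      simp only [pow_zero, one_mul]
      linarith
    | succ n ih =>
      intro ε hε
      have h1 := wtEnergy_le_half h hε
      have h2 := ih (ε / 2) (by positivity)
      have h3 := hL ε⁻¹ (by positivity)
      rw [Real.inv_rpow hε.le, ← Real.rpow_neg hε.le] at h3
      -- Halving `ε` costs `2^p ≤ 32` because `p ≤ 5`. The induction closes since `B + 32·2B/64 =
      -- 2B`.
      have h4 : (ε / 2) ^ (-p) ≤ 32 * ε ^ (-p) := by
        rw [Real.div_rpow hε.le (by norm_num), Real.rpow_neg (by norm_num : (0 : ℝ) ≤ 2) p, div_inv_eq_mul,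
          mul_comm]
        refine mul_le_mul_of_nonneg_right ?_ (Real.rpow_nonneg hε.le _)
        refine (Real.rpow_le_rpow_of_exponent_le (by norm_num) hp).trans_eq ?_
        norm_num
      have h5 := mul_le_mul_of_nonneg_left h4 (mul_nonneg zero_le_two hB)
      rw [pow_succ]
      linarith
  have ht : Tendsto (fun n : ℕ => 2 * B * ε ^ (-p) + (1 / 64 : ℝ) ^ n * ‖h‖ ^ 2) atTop
      (𝓝 (2 * B * ε ^ (-p) + 0 * ‖h‖ ^ 2)) :=
    tendsto_const_nhds.add
      ((tendsto_pow_atTop_nhds_zero_of_lt_one (by norm_num) (by norm_num)).mul_const _)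
  rw [zero_mul, add_zero] at ht
  exact ge_of_tendsto' ht fun n => key n ε hε

/-- Smoothing at scale `ε` sees frequencies of size `1/ε`. -/
theorem exists_sqInt_cv_kern_le (d : ℕ) : ∃ C : ℝ, 0 < C ∧ ∀ (h : L2 d) (B p : ℝ), p ≤ 5 → 0 ≤ B →
    (∀ δ : ℝ, 0 < δ → lowFreqEnergy h δ ≤ B * δ ^ p) →
    ∀ ε : ℝ, 0 < ε → sqInt (cv (kern d ε) h) ≤ C * B * ε ^ (-p) := by
  -- Decay of order `8` for the transform of the kernel becomes, after squaring, the power `16` in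
  -- `wt`.
  obtain ⟨C, hC⟩ := exists_norm_fourier_le (isTest_kern₁ d) 8
  refine ⟨2 * C ^ 2 + 1, by positivity, fun h B p hp hB hL ε hε => ?_⟩
  have h1 := wtEnergy_le_rpow h hp hB hL hε
  have h2 : sqInt (cv (kern d ε) h) ≤ C ^ 2 * wtEnergy h ε := by
    rw [sqInt_cv_eq (isTest_kern hε), wtEnergy, ← integral_const_mul (C ^ 2)]
    refine integral_mono_of_nonneg (ae_of_all _ fun ξ => by positivity)
      ((integrable_wtEnergy h ε).const_mul _) (ae_of_all _ fun ξ => ?_)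
    change ‖𝓕 (isTest_kern (d := d) hε).schwartz ξ‖ ^ 2 * _ ≤ C ^ 2 * (wt (ε • ξ) * _)
    rw [← mul_assoc, fourier_kern hε]
    refine mul_le_mul_of_nonneg_right ?_ (sq_nonneg _)
    have h3 := pow_le_pow_left₀ (by positivity) (hC (ε • ξ)) 2
    rw [mul_pow, ← pow_mul] at h3
    rw [wt, ← div_eq_mul_inv, le_div_iff₀ (by positivity), mul_comm]
    exact h3
  have h4 := mul_le_mul_of_nonneg_left h1 (sq_nonneg C)
  have h5 : 0 ≤ B * ε ^ (-p) := mul_nonneg hB (Real.rpow_nonneg hε.le _)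
  linarith

theorem lowFreqEnergy_le (h : L2 d) (δ : ℝ) : lowFreqEnergy h δ ≤ ‖h‖ ^ 2 := by
  rw [← norm_fourierL2, ← integral_norm_sq_Lp]
  exact setIntegral_le_integral (integrable_norm_sq_Lp _) (ae_of_all _ fun _ => sq_nonneg _)

/-- For `δ ≤ 1` this is the decay character bound, weakened by the cap `min r 1`; for `δ > 1` the
total energy suffices because the exponent is nonnegative. The cap matches the best rate transport
allows and keeps the exponent at most `d + 2`. -/
theorem lowFreqEnergy_le_rpow {h : L2 d} {r M : ℝ} (hr : -((d : ℝ) / 2) < r) (hM : 0 ≤ M)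
    (hn : ‖h‖ ≤ M) (hL : lowFreqSize r h ≤ ENNReal.ofReal M) {δ : ℝ} (hδ : 0 < δ) :
    lowFreqEnergy h δ ≤ (M + M ^ 2) * δ ^ ((d : ℝ) + 2 * min r 1) := by
  have hδp := Real.rpow_pos_of_pos hδ ((d : ℝ) + 2 * min r 1)
  rcases le_or_gt δ 1 with h1 | h1
  · have h2 : ENNReal.ofReal (δ ^ (-2 * r - (d : ℝ)) * lowFreqEnergy h δ) ≤ ENNReal.ofReal M :=
      (le_iSup₂ (f := fun (δ : ℝ) (_ : δ ∈ Ioc (0 : ℝ) 1) =>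
        ENNReal.ofReal (δ ^ (-2 * r - (d : ℝ)) * lowFreqEnergy h δ)) δ ⟨hδ, h1⟩).trans hL
    have h3 := (ENNReal.ofReal_le_ofReal_iff hM).1 h2
    have h4 : lowFreqEnergy h δ ≤ M * δ ^ ((d : ℝ) + 2 * r) := by
      have h5 := mul_le_mul_of_nonneg_right h3 (Real.rpow_nonneg hδ.le ((d : ℝ) + 2 * r))
      have h6 : δ ^ (-2 * r - (d : ℝ)) * δ ^ ((d : ℝ) + 2 * r) = 1 := by
        rw [← Real.rpow_add hδ]
        convert Real.rpow_zero δ using 2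
        ring
      calc lowFreqEnergy h δ = (δ ^ (-2 * r - (d : ℝ)) * δ ^ ((d : ℝ) + 2 * r)) *
          lowFreqEnergy h δ := by rw [h6, one_mul]
        _ ≤ _ := by linarith
    have h7 : δ ^ ((d : ℝ) + 2 * r) ≤ δ ^ ((d : ℝ) + 2 * min r 1) :=
      Real.rpow_le_rpow_of_exponent_ge hδ h1 (by linarith [min_le_left r 1])
    have h8 := mul_le_mul_of_nonneg_left h7 hM
    have h9 : 0 ≤ M ^ 2 * δ ^ ((d : ℝ) + 2 * min r 1) := by positivity
    linarith
  · have h2 : 1 ≤ δ ^ ((d : ℝ) + 2 * min r 1) := by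
      refine Real.one_le_rpow h1.le ?_
      have hd : (0 : ℝ) ≤ d := Nat.cast_nonneg d
      rcases min_choice r 1 with e | e <;> rw [e] <;> linarith
    have h3 := (lowFreqEnergy_le h δ).trans (pow_le_pow_left₀ (norm_nonneg _) hn 2)
    nlinarith [sq_nonneg M]

/-! ### Decay of the `L²` norm by a bootstrap on the rate. -/

theorem integrableOn_one_add_rpow (b t : ℝ) :
    IntegrableOn (fun τ : ℝ => (1 + τ) ^ b) (Ioc 0 t) := by
  refine (ContinuousOn.integrableOn_Icc fun x hx => ?_).mono_set Ioc_subset_Icc_self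
  exact (ContinuousAt.rpow_const (by fun_prop) (Or.inl (by linarith [hx.1]))).continuousWithinAt

/-- The case `s = 0` would give a logarithm; the bootstrap rates are arranged to avoid it. -/
theorem integral_one_add_rpow_le {s t : ℝ} (hs : s ≠ 0) (ht : 0 ≤ t) :
    ∫ τ in Ioc 0 t, (1 + τ) ^ (s - 1) ≤ |s|⁻¹ * (1 + t) ^ max s 0 := by
  rw [← intervalIntegral.integral_of_le ht,
    intervalIntegral.integral_comp_add_left (fun x : ℝ => x ^ (s - 1)), add_zero,
    integral_rpow (Or.inr ⟨by contrapose! hs; linarith, by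
      rw [uIcc_of_le (by linarith)]; intro h; linarith [h.1]⟩), sub_add_cancel, Real.one_rpow]
  rcases lt_or_gt_of_ne hs with h | h
  · rw [max_eq_right h.le, Real.rpow_zero, mul_one, abs_of_neg h, inv_neg, ← neg_div_neg_eq,
      neg_sub, div_eq_mul_inv, inv_neg]
    have h1 := Real.rpow_nonneg (show 0 ≤ 1 + t by linarith) s
    have h2 : 0 ≤ -s⁻¹ := by
      rw [← inv_neg]
      exact (inv_pos.2 (neg_pos.2 h)).le
    nlinarith
  · rw [max_eq_left h.le, abs_of_pos h, div_eq_inv_mul]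
    have := inv_pos.2 h
    nlinarith

namespace Flow

variable {κ : ℝ} {u : ℝ → E d → E d} {A : ℝ → ℝ} {θ : ℝ → L2 d} {f : ℝ → E d → ℝ}
  {g : Fin d → ℝ → E d → ℝ}

/-- Decay of the energy between times `t / 2` and `t`. -/
theorem energy_half (F : Flow κ u A θ f g) {t ε S : ℝ} (ht : 0 < t) (hε : 0 < ε)
    (hS : ∀ τ, 0 ≤ τ → τ ≤ t → sqInt (cv (kern d ε) (θ τ)) ≤ S) :
    ‖θ t‖ ^ 2 * (1 + κ * t / (2 * ε ^ 2)) ≤ ‖θ (t / 2)‖ ^ 2 + κ * t / ε ^ 2 * S := by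
  have hκ := F.pos
  have h1 := F.energy (s := t / 2) (t := t) (by linarith) (by linarith)
  obtain ⟨K, hK⟩ := F.slice' (s := t / 2) (t := t) (by linarith)
  -- Splitting `θ` into its mollification and the remainder gives `‖θ‖² ≤ 2S + 2ε²‖∇θ‖²`, a lower
  -- bound for the dissipation.
  have h2 : ∫ _τ in Ioc (t / 2) t, (‖θ t‖ ^ 2 - 2 * S) / (2 * ε ^ 2) ≤
      ∫ τ in Ioc (t / 2) t, gradSq g τ := by
    refine integral_mono_ae (integrable_const _) (F.integrableOn_gradSq (by linarith)) ?_
    filter_upwards [hK, ae_restrict_mem measurableSet_Ioc] with τ hτ hm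
    have hτ0 : 0 ≤ τ := by linarith [hm.1]
    have h3 := sqInt_cv_kern_sub_le hτ.grad hτ.memh hτ.memg hε
    have h4 := hS τ hτ0 hm.2
    have h5 : ‖θ t‖ ^ 2 ≤ ‖θ τ‖ ^ 2 :=
      pow_le_pow_left₀ (norm_nonneg _) (F.antitoneOn_norm hτ0 hm.2) 2
    have hm1 := memLp_cv (isTest_kern (d := d) hε) hτ.memh
    have h6 : sqInt (θ τ) ≤ 2 * sqInt (cv (kern d ε) (θ τ)) +
        2 * sqInt (fun x => cv (kern d ε) (θ τ) x - θ τ x) := by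
      have := sqInt_sub_le hm1 (memLp_sub hm1 hτ.memh)
      simpa using this
    rw [sqInt_eq_norm_sq] at h6
    rw [div_le_iff₀ (by positivity)]
    have e : gradSq g τ = ∑ i, sqInt (g i τ) := rfl
    rw [e]
    linarith
  rw [setIntegral_const, Real.volume_real_Ioc_of_le (by linarith), smul_eq_mul] at h2
  have h3 := mul_le_mul_of_nonneg_left h2 (mul_nonneg zero_le_two hκ.le)
  have h4 : 2 * κ * ((t - t / 2) * ((‖θ t‖ ^ 2 - 2 * S) / (2 * ε ^ 2))) =
      ‖θ t‖ ^ 2 * (κ * t / (2 * ε ^ 2)) - κ * t / ε ^ 2 * S := by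
    field_simp
    ring
  linarith

end Flow

/-- A flow together with the quantitative information used for the decay of `‖θ(t)‖`. -/
structure Decaying (κ₀ M c α p C κ : ℝ) (u : ℝ → E d → E d) (A : ℝ → ℝ) (θ : ℝ → L2 d)
    (f : ℝ → E d → ℝ) (g : Fin d → ℝ → E d → ℝ) : Prop where
  flow : Flow κ u A θ f g
  kappa_le : κ ≤ κ₀
  norm_le : ‖θ 0‖ ≤ M
  vel : ∀ τ : ℝ, 0 < τ → ∑ i, sqInt (fun x => u τ x i) ≤ (c * (1 + τ) ^ (-α)) ^ 2
  low : ∀ ε : ℝ, 0 < ε → sqInt (cv (kern d ε) (θ 0)) ≤ C * ε ^ (-p)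

/-- Gradient energy of the reference kernel. -/
noncomputable def kernGrad (d : ℕ) : ℝ := d * ∑ i, sqInt (pd i (kern₁ d))

theorem kernGrad_nonneg (d : ℕ) : 0 ≤ kernGrad d :=
  mul_nonneg (Nat.cast_nonneg d) (Finset.sum_nonneg fun _ _ => sqInt_nonneg _)

theorem Decaying.norm_le' {κ₀ M c α p C κ : ℝ} {u : ℝ → E d → E d} {A : ℝ → ℝ} {θ : ℝ → L2 d}
    {f : ℝ → E d → ℝ} {g : Fin d → ℝ → E d → ℝ} (D : Decaying κ₀ M c α p C κ u A θ f g) {t : ℝ}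
    (ht : 0 ≤ t) : ‖θ t‖ ≤ M := (D.flow.antitoneOn_norm le_rfl ht).trans D.norm_le

theorem Decaying.lowFreq_le {κ₀ M c α p C κ : ℝ} {u : ℝ → E d → E d} {A : ℝ → ℝ} {θ : ℝ → L2 d}
    {f : ℝ → E d → ℝ} {g : Fin d → ℝ → E d → ℝ} (D : Decaying κ₀ M c α p C κ u A θ f g)
    (hc : 0 < c) {B b : ℝ} (hB : 0 ≤ B) (hs : 1 - α - b ≠ 0)
    (H : ∀ t : ℝ, 0 ≤ t → ‖θ t‖ ≤ B * (1 + t) ^ (-b)) {ε t τ : ℝ} (hε : 0 < ε)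
    (hτ : 0 ≤ τ) (hτt : τ ≤ t) :
    sqInt (cv (kern d ε) (θ τ)) ≤ 2 * (C * ε ^ (-p)) + 4 * (kernGrad d * (ε ^ (d + 2))⁻¹) *
      (B * c * (|1 - α - b|⁻¹ * (1 + t) ^ max (1 - α - b) 0)) ^ 2 := by
  have ht : 0 ≤ t := hτ.trans hτt
  have hi := integrableOn_one_add_rpow (1 - α - b - 1) t
  have h := D.flow.lowFreq (isTest_kern hε) (β := fun τ => B * c * (1 + τ) ^ (1 - α - b - 1))
    (hi.const_mul _) (fun τ hτ => by
      have := Real.rpow_nonneg (show 0 ≤ 1 + τ by linarith) (1 - α - b - 1)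
      positivity) (fun τ hτ => by
      have h1 := H τ hτ.le
      have h2 := D.vel τ hτ
      have h3 : (1 + τ) ^ (1 - α - b - 1) = (1 + τ) ^ (-b) * (1 + τ) ^ (-α) := by
        rw [← Real.rpow_add (by linarith)]
        congr 1
        ring
      have h4 : (B * c * (1 + τ) ^ (1 - α - b - 1)) ^ 2 =
          (B * (1 + τ) ^ (-b)) ^ 2 * (c * (1 + τ) ^ (-α)) ^ 2 := by rw [h3]; ring
      rw [h4]
      exact mul_le_mul (pow_le_pow_left₀ (norm_nonneg _) h1 2) h2
        (Finset.sum_nonneg fun _ _ => sqInt_nonneg _) (sq_nonneg _)) hτ hτt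
  refine h.trans ?_
  have h5 : (d : ℝ) * ∑ i, sqInt (pd i (kern d ε)) = kernGrad d * (ε ^ (d + 2))⁻¹ := by
    simp only [sqInt_pd_kern hε, ← Finset.mul_sum, kernGrad]
    ring
  rw [h5, integral_const_mul]
  have h6 := D.low ε hε
  have h7 : 0 ≤ ∫ τ in Ioc 0 t, (1 + τ) ^ (1 - α - b - 1) :=
    setIntegral_nonneg measurableSet_Ioc fun τ hτ =>
      Real.rpow_nonneg (by linarith [hτ.1]) _
  have h8 := integral_one_add_rpow_le hs ht
  have h9 := kernGrad_nonneg d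
  gcongr

/-- Induction on dyadic time ranges stands in for a differential inequality: every `t` falls below
`1` after finitely many halvings. -/
theorem sq_le_of_halving {e X : ℝ → ℝ} {W : ℝ} (hbase : ∀ t, 0 ≤ t → t ≤ 1 → e t ≤ W * X t)
    (hstep : ∀ t, 1 ≤ t → e (t / 2) ≤ W * X (t / 2) → e t ≤ W * X t) {t : ℝ} (ht : 0 ≤ t) :
    e t ≤ W * X t := by
  have key : ∀ n : ℕ, ∀ t : ℝ, 0 ≤ t → t ≤ 2 ^ n → e t ≤ W * X t := by
    intro n
    induction n with
    | zero => exact fun t h0 h1 => hbase t h0 (by simpa using h1)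
    | succ n ih =>
      intro t h0 h1
      rcases le_total t 1 with h | h
      · exact hbase t h0 h
      · exact hstep t h (ih _ (by linarith) (by rw [pow_succ] at h1; linarith))
  obtain ⟨n, hn⟩ := pow_unbounded_of_one_lt t (one_lt_two (α := ℝ))
  exact key n t ht hn.le

theorem rpow_scale_le {κ t a : ℝ} (hκ : 0 < κ) (ht : 1 ≤ t) (ha : 0 ≤ a) :
    (κ * t / 30) ^ (-a) ≤ 60 ^ a * κ ^ (-a) * (1 + t) ^ (-a) := by
  have h1 : (60 : ℝ)⁻¹ * κ * (1 + t) ≤ κ * t / 30 := by nlinarith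
  refine (Real.rpow_le_rpow_of_nonpos (by positivity) h1 (by linarith)).trans_eq ?_
  rw [Real.mul_rpow (by positivity) (by positivity), Real.mul_rpow (by positivity) hκ.le,
    Real.inv_rpow (by norm_num), Real.rpow_neg (by norm_num : (0 : ℝ) ≤ 60), inv_inv]

theorem rpow_neg_le_of_le {κ κ₀ a b : ℝ} (hκ : 0 < κ) (h : κ ≤ κ₀) (hab : a ≤ b) :
    κ ^ (-a) ≤ κ₀ ^ (b - a) * κ ^ (-b) := by
  have h1 : κ ^ (-a) = κ ^ (b - a) * κ ^ (-b) := by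
    rw [← Real.rpow_add hκ]
    congr 1
    ring
  rw [h1]
  have := Real.rpow_le_rpow hκ.le h (show 0 ≤ b - a by linarith)
  have := Real.rpow_nonneg hκ.le (-b)
  gcongr

/-- One step of the decay bootstrap. -/
theorem exists_decay_step {κ₀ M c α p C : ℝ} (hκ₀ : 0 < κ₀) (hM : 0 < M) (hc : 0 < c)
    (hC : 0 ≤ C) (hp0 : 0 ≤ p) (hp : p ≤ 5) (hpd : p ≤ d + 2) {B n b b' : ℝ} (hB : 0 < B)
    (hn : 0 ≤ n) (hs : 1 - α - b ≠ 0) (hb0 : 0 ≤ b') (hbp : b' ≤ p / 4)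
    (hbs : b' ≤ (d + 2) / 4 - max (1 - α - b) 0) :
    ∃ B' : ℝ, 0 < B' ∧ ∀ (κ : ℝ) (u : ℝ → E d → E d) (A : ℝ → ℝ) (θ : ℝ → L2 d)
      (f : ℝ → E d → ℝ) (g : Fin d → ℝ → E d → ℝ), Decaying κ₀ M c α p C κ u A θ f g →
      (∀ t : ℝ, 0 ≤ t → ‖θ t‖ ≤ B * κ ^ (-n) * (1 + t) ^ (-b)) →
      ∀ t : ℝ, 0 ≤ t → ‖θ t‖ ≤ B' * κ ^ (-(n + (d + 2) / 4)) * (1 + t) ^ (-b') := by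
  set n' : ℝ := n + (d + 2) / 4 with hn'
  set s : ℝ := max (1 - α - b) 0
  set D₁ : ℝ := 2 * C * 60 ^ (p / 2) * κ₀ ^ (2 * n' - p / 2)
  set D₂ : ℝ := 4 * kernGrad d * 60 ^ (((d : ℝ) + 2) / 2) * (B * c * |1 - α - b|⁻¹) ^ 2
  have hk := kernGrad_nonneg d
  have hD₁ : 0 ≤ D₁ := by positivity
  have hD₂ : 0 ≤ D₂ := by positivity
  have hd0 : (0 : ℝ) ≤ d := Nat.cast_nonneg d
  set W : ℝ := 4 * (D₁ + D₂) + 8 * M ^ 2 * κ₀ ^ (2 * n')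
  have hW : 0 < W := by positivity
  refine ⟨√W, Real.sqrt_pos.2 hW, fun κ u A θ f g D H t ht => ?_⟩
  have hκ := D.flow.pos
  let X : ℝ → ℝ := fun t => κ ^ (-(2 * n')) * (1 + t) ^ (-(2 * b'))
  have hX : ∀ t, 0 ≤ t → 0 ≤ X t := fun t ht => by
    have : 0 < 1 + t := by linarith
    positivity
  -- From `b' ≤ p/4 ≤ 5/4` the exponent `2b'` is at most `3`, so passing from `t/2` to `t` loses at
  -- most a factor `8`.
  have h2b : (2 : ℝ) ^ (2 * b') ≤ 8 := by
    calc (2 : ℝ) ^ (2 * b') ≤ 2 ^ (3 : ℝ) :=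
          Real.rpow_le_rpow_of_exponent_le (by norm_num) (by linarith)
      _ = 8 := by norm_num
  have h2b' : (1 : ℝ) / 8 ≤ 2 ^ (-(2 * b')) := by
    rw [Real.rpow_neg (by norm_num), one_div]
    exact inv_anti₀ (by positivity) h2b
  have key : ‖θ t‖ ^ 2 ≤ W * X t := by
    refine sq_le_of_halving (e := fun t => ‖θ t‖ ^ 2) (fun t h0 h1 => ?_) (fun t h1 h2 => ?_) ht
    · have h3 : ‖θ t‖ ^ 2 ≤ M ^ 2 := pow_le_pow_left₀ (norm_nonneg _) (D.norm_le' h0) 2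
      have h4 : (1 : ℝ) / 8 ≤ (1 + t) ^ (-(2 * b')) := h2b'.trans
        (Real.rpow_le_rpow_of_nonpos (by linarith) (by linarith) (by linarith))
      have h5 : 1 ≤ κ₀ ^ (2 * n') * κ ^ (-(2 * n')) := by
        have := rpow_neg_le_of_le (a := 0) (b := 2 * n') hκ D.kappa_le (by positivity)
        simpa using this
      have h6 : (1 : ℝ) * (1 / 8) ≤ κ₀ ^ (2 * n') * κ ^ (-(2 * n')) * (1 + t) ^ (-(2 * b')) :=
        mul_le_mul h5 h4 (by norm_num) (by positivity)
      have h7 := mul_le_mul_of_nonneg_left h6 (show 0 ≤ 8 * M ^ 2 by positivity)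
      have h8 := mul_nonneg (show 0 ≤ 4 * (D₁ + D₂) by positivity) (hX t h0)
      calc ‖θ t‖ ^ 2 ≤ 8 * M ^ 2 * (1 * (1 / 8)) := by linarith
        _ ≤ 8 * M ^ 2 * (κ₀ ^ (2 * n') * κ ^ (-(2 * n')) * (1 + t) ^ (-(2 * b'))) := h7
        _ = 8 * M ^ 2 * κ₀ ^ (2 * n') * X t := by simp only [X]; ring
        _ ≤ 4 * (D₁ + D₂) * X t + 8 * M ^ 2 * κ₀ ^ (2 * n') * X t := by linarith
        _ = W * X t := by simp only [W]; ring
    · have ht0 : 0 < t := by linarith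
      have h1t : 0 < 1 + t := by linarith
      -- At the scale `ε² = κt/30` the energy inequality reads `16 ‖θ(t)‖² ≤ ‖θ(t/2)‖² + 30 S`.
      have hε : 0 < √(κ * t / 30) := Real.sqrt_pos.2 (by positivity)
      have hε2 : √(κ * t / 30) ^ 2 = κ * t / 30 := Real.sq_sqrt (by positivity)
      have hpow : ∀ a : ℝ, √(κ * t / 30) ^ (-a) = (κ * t / 30) ^ (-(a / 2)) := fun a => by
        rw [Real.sqrt_eq_rpow, ← Real.rpow_mul (by positivity)]
        congr 1
        ring
      have e1 : (√(κ * t / 30) ^ (d + 2))⁻¹ = (κ * t / 30) ^ (-(((d : ℝ) + 2) / 2)) := by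
        rw [← hpow, Real.rpow_neg hε.le, ← Real.rpow_natCast]
        push_cast
        rfl
      have hlow : ∀ τ, 0 ≤ τ → τ ≤ t → sqInt (cv (kern d √(κ * t / 30)) (θ τ)) ≤
          (D₁ + D₂) * X t := fun τ h3 h4 => by
        refine (D.lowFreq_le hc (by positivity) hs H hε h3 h4).trans ?_
        rw [hpow, e1, add_mul]
        refine add_le_add ?_ ?_
        · have h5 := rpow_scale_le hκ h1 (show 0 ≤ p / 2 by linarith)
          have h6 : κ ^ (-(p / 2)) ≤ κ₀ ^ (2 * n' - p / 2) * κ ^ (-(2 * n')) :=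
            rpow_neg_le_of_le hκ D.kappa_le (by rw [hn']; linarith)
          have h7 : (1 + t) ^ (-(p / 2)) ≤ (1 + t) ^ (-(2 * b')) :=
            Real.rpow_le_rpow_of_exponent_le (by linarith) (by linarith)
          calc 2 * (C * (κ * t / 30) ^ (-(p / 2)))
              ≤ 2 * (C * (60 ^ (p / 2) * κ ^ (-(p / 2)) * (1 + t) ^ (-(p / 2)))) := by gcongr
            _ ≤ 2 * (C * (60 ^ (p / 2) * (κ₀ ^ (2 * n' - p / 2) * κ ^ (-(2 * n'))) *
                (1 + t) ^ (-(2 * b')))) := by gcongr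
            _ = D₁ * X t := by simp only [D₁, X]; ring
        · have h5 := rpow_scale_le hκ h1 (show 0 ≤ ((d : ℝ) + 2) / 2 by positivity)
          -- The factor `ε^{-(d+2)}` from the kernel gradient is what raises the exponent of `κ⁻¹`
          -- by `(d+2)/4` in each step.
          have h6 : κ ^ (-(((d : ℝ) + 2) / 2)) * (κ ^ (-n)) ^ 2 = κ ^ (-(2 * n')) := by
            rw [← Real.rpow_natCast, ← Real.rpow_mul hκ.le, ← Real.rpow_add hκ]
            congr 1
            rw [hn']
            push_cast
            ring
          have h7 : (1 + t) ^ (-(((d : ℝ) + 2) / 2)) * ((1 + t) ^ s) ^ 2 ≤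
              (1 + t) ^ (-(2 * b')) := by
            rw [← Real.rpow_natCast, ← Real.rpow_mul h1t.le, ← Real.rpow_add h1t]
            refine Real.rpow_le_rpow_of_exponent_le (by linarith) ?_
            push_cast
            linarith
          calc 4 * (kernGrad d * (κ * t / 30) ^ (-(((d : ℝ) + 2) / 2))) *
                (B * κ ^ (-n) * c * (|1 - α - b|⁻¹ * (1 + t) ^ s)) ^ 2
              ≤ 4 * (kernGrad d * (60 ^ (((d : ℝ) + 2) / 2) * κ ^ (-(((d : ℝ) + 2) / 2)) *
                (1 + t) ^ (-(((d : ℝ) + 2) / 2)))) *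
                (B * κ ^ (-n) * c * (|1 - α - b|⁻¹ * (1 + t) ^ s)) ^ 2 := by gcongr
            _ = D₂ * (κ ^ (-(((d : ℝ) + 2) / 2)) * (κ ^ (-n)) ^ 2) *
                ((1 + t) ^ (-(((d : ℝ) + 2) / 2)) * ((1 + t) ^ s) ^ 2) := by
              simp only [D₂]; ring
            _ ≤ D₂ * κ ^ (-(2 * n')) * (1 + t) ^ (-(2 * b')) := by rw [h6]; gcongr
            _ = D₂ * X t := by simp only [X]; ring
      have h3 := D.flow.energy_half ht0 hε hlow
      rw [hε2] at h3
      have e2 : κ * t / (2 * (κ * t / 30)) = 15 := by field_simp; norm_num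
      have e3 : κ * t / (κ * t / 30) = 30 := by field_simp
      rw [e2, e3] at h3
      have h4 : X (t / 2) ≤ 8 * X t := by
        have h5 : (1 + t / 2) ^ (-(2 * b')) ≤ 8 * (1 + t) ^ (-(2 * b')) := by
          calc (1 + t / 2) ^ (-(2 * b')) ≤ (2⁻¹ * (1 + t)) ^ (-(2 * b')) :=
                Real.rpow_le_rpow_of_nonpos (by positivity) (by linarith) (by linarith)
            _ = 2 ^ (2 * b') * (1 + t) ^ (-(2 * b')) := by
              rw [Real.mul_rpow (by norm_num) h1t.le, Real.inv_rpow (by norm_num),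
                Real.rpow_neg (by norm_num : (0 : ℝ) ≤ 2), inv_inv]
            _ ≤ _ := by gcongr
        have h6 := mul_le_mul_of_nonneg_left h5 (Real.rpow_nonneg hκ.le (-(2 * n')))
        simp only [X]
        linarith
      have h5 := mul_le_mul_of_nonneg_left h4 hW.le
      have h6 := hX t ht0.le
      -- The halving step closes because `8W + 30(D₁ + D₂) ≤ 8W + 7.5W < 16W`.
      have h7 : 4 * (D₁ + D₂) * X t ≤ W * X t := by
        refine mul_le_mul_of_nonneg_right ?_ h6
        simp only [W]
        have : 0 ≤ 8 * M ^ 2 * κ₀ ^ (2 * n') := by positivity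
        linarith
      have h8 := mul_nonneg hW.le h6
      linarith
  have h1t : 0 < 1 + t := by linarith
  refine (pow_le_pow_iff_left₀ (norm_nonneg _) (by positivity) two_ne_zero).1 (key.trans_eq ?_)
  rw [mul_pow, mul_pow, Real.sq_sqrt hW.le, ← Real.rpow_natCast, ← Real.rpow_natCast,
    ← Real.rpow_mul hκ.le, ← Real.rpow_mul h1t.le, mul_assoc]
  simp only [X]
  congr 3 <;>
  · push_cast
    ring

/-- Iterated decay at the borderline-avoiding rate `α = 1/2 - d/4 + η`. -/
theorem exists_decay_iterate {κ₀ M c p C η : ℝ} (N : ℕ) (hη : η * (N + 1 / 2) = (d : ℝ) / 4 + 1 / 2)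
    (hη0 : 0 < η) (hκ₀ : 0 < κ₀) (hM : 0 < M) (hc : 0 < c) (hC : 0 ≤ C) (hp0 : 0 ≤ p) (hp : p ≤ 5)
    (hpd : p ≤ d + 2) (j : ℕ) :
    ∃ B : ℝ, 0 < B ∧ ∀ (κ : ℝ) (u : ℝ → E d → E d) (A : ℝ → ℝ) (θ : ℝ → L2 d)
      (f : ℝ → E d → ℝ) (g : Fin d → ℝ → E d → ℝ),
      Decaying κ₀ M c (1 / 2 - (d : ℝ) / 4 + η) p C κ u A θ f g → ∀ t : ℝ, 0 ≤ t →
        ‖θ t‖ ≤ B * κ ^ (-(j * ((d + 2) / 4 : ℝ))) * (1 + t) ^ (-min (p / 4) (j * η)) := by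
  induction j with
  | zero =>
    refine ⟨M, hM, fun κ u A θ f g D t ht => ?_⟩
    have : min (p / 4) 0 = 0 := min_eq_right (by positivity)
    simpa [this] using D.norm_le' ht
  | succ j ih =>
    obtain ⟨B, hB, ih⟩ := ih
    -- Once `jη` exceeds `p/4` the final rate has been reached, and only the power of `κ` is
    -- adjusted to the stated form.
    rcases le_or_gt (j * η) (p / 4) with h | h
    · rw [min_eq_right h] at ih
      -- The half-integer normalisation of `η` makes this a half-odd multiple of `η`, so it never
      -- vanishes and no logarithm appears. When it is positive, `(d+2)/4` minus it is `(j+1)η`: the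
      -- gain is exactly `η`.
      have hs : 1 - (1 / 2 - (d : ℝ) / 4 + η) - j * η = (N - 1 / 2 - j) * η := by
        linear_combination -hη
      have hs0 : 1 - (1 / 2 - (d : ℝ) / 4 + η) - j * η ≠ 0 := by
        rw [hs]
        refine mul_ne_zero (fun h0 => ?_) hη0.ne'
        have h1 : ((2 * N : ℕ) : ℝ) = ((2 * j + 1 : ℕ) : ℝ) := by push_cast; linarith
        have := Nat.cast_injective h1
        omega
      obtain ⟨B', hB', H⟩ := exists_decay_step (d := d) (κ₀ := κ₀) (M := M) (c := c)
        (α := 1 / 2 - (d : ℝ) / 4 + η) (C := C) hκ₀ hM hc hC hp0 hp hpd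
        (n := j * ((d + 2) / 4 : ℝ)) (b' := min (p / 4) ((j + 1 : ℕ) * η)) hB (by positivity) hs0
        (by positivity) (min_le_left _ _) (by
          rcases max_choice (1 - (1 / 2 - (d : ℝ) / 4 + η) - j * η) 0 with e | e <;> rw [e]
          · refine (min_le_right _ _).trans ?_
            push_cast
            linarith
          · refine (min_le_left _ _).trans ?_
            linarith)
      refine ⟨B', hB', fun κ u A θ f g D t ht => ?_⟩
      have := H κ u A θ f g D (ih κ u A θ f g D) t ht
      have e : ((j + 1 : ℕ) : ℝ) * ((d + 2) / 4 : ℝ) = j * ((d + 2) / 4 : ℝ) + (d + 2) / 4 := by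
        push_cast; ring
      rwa [e]
    · refine ⟨B * κ₀ ^ ((d + 2) / 4 : ℝ), by positivity, fun κ u A θ f g D t ht => ?_⟩
      have h1 := ih κ u A θ f g D t ht
      have h2 : p / 4 ≤ ((j + 1 : ℕ) : ℝ) * η := by push_cast; linarith
      rw [min_eq_left h.le] at h1
      rw [min_eq_left h2]
      have h3 := rpow_neg_le_of_le (a := j * ((d + 2) / 4 : ℝ))
        (b := (j + 1 : ℕ) * ((d + 2) / 4 : ℝ)) D.flow.pos D.kappa_le (by push_cast; linarith)
      have e : ((j + 1 : ℕ) : ℝ) * ((d + 2) / 4 : ℝ) - j * ((d + 2) / 4 : ℝ) = (d + 2) / 4 := by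
        push_cast; ring
      rw [e] at h3
      have h4 := Real.rpow_nonneg (show 0 ≤ 1 + t by linarith) (-(p / 4))
      refine h1.trans (mul_le_mul_of_nonneg_right ?_ h4)
      rw [mul_assoc]
      exact mul_le_mul_of_nonneg_left h3 hB.le

/-- The velocity rate may be lowered to `α'`, which weakens its upper bound. This freedom allows a
rate that avoids the logarithmic case. -/
theorem Setting.decaying {α α' r c κ₀ M κ C : ℝ} {u : ℝ → E d → E d} {θ₀ : L2 d}
    {θ : ℝ → L2 d} (hd : d ≤ 3) (S : Setting d α r c κ₀ M κ u θ₀ θ) (hc : 0 < c) (hM : 0 < M)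
    (hα : α' ≤ α) (hC : ∀ (h : L2 d) (B p : ℝ), p ≤ 5 → 0 ≤ B →
      (∀ δ : ℝ, 0 < δ → lowFreqEnergy h δ ≤ B * δ ^ p) →
      ∀ ε : ℝ, 0 < ε → sqInt (cv (kern d ε) h) ≤ C * B * ε ^ (-p)) {A : ℝ → ℝ}
    {f : ℝ → E d → ℝ} {g : Fin d → ℝ → E d → ℝ} (F : Flow κ u A (fun t => θ (max t 0)) f g) :
    Decaying κ₀ M c α' ((d : ℝ) + 2 * min r 1) (C * (M + M ^ 2)) κ u A (fun t => θ (max t 0))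
      f g where
  flow := F
  kappa_le := S.kappa_le
  norm_le := by
    simp only [max_self]
    rw [S.solution.init]
    exact S.norm_le
  vel τ hτ := by
    have h0 := Real.rpow_nonneg (show 0 ≤ 1 + τ by linarith) (-α)
    refine (sum_sqInt_coord_le (S.velocity.memLp τ hτ) (by positivity)
      (S.velocity_decay τ hτ).2).trans ?_
    have : (1 + τ) ^ (-α) ≤ (1 + τ) ^ (-α') :=
      Real.rpow_le_rpow_of_exponent_le (by linarith) (by linarith)
    gcongr
  low ε hε := by
    simp only [max_self]
    rw [S.solution.init]
    have hd' : (d : ℝ) ≤ 3 := by exact_mod_cast hd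
    exact hC θ₀ _ _ (by linarith [min_le_right r 1]) (by positivity)
      (fun δ hδ => lowFreqEnergy_le_rpow S.decay.1 hM.le S.norm_le S.lowFreq_le hδ) ε hε

/-! ### Gradient bounds and the conclusion. -/

theorem Setting.init_grad {α r c κ₀ M κ : ℝ} {u : ℝ → E d → E d} {θ₀ : L2 d}
    {θ : ℝ → L2 d} (S : Setting d α r c κ₀ M κ u θ₀ θ) (hM : 0 < M) : ∃ p : Fin d → E d → ℝ,
      (∀ i, MemLp (p i) 2 volume) ∧ IsWeakGrad (θ 0) p ∧ ∑ i, sqInt (p i) ≤ d * (M + 1) ^ 2 := by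
  rw [S.solution.init]
  refine exists_weakGrad_of_gradNorm_lt (by positivity) (S.grad_le.trans_lt ?_)
  exact (ENNReal.ofReal_lt_ofReal_iff (by positivity)).2 (by linarith)

theorem Flow.integral_gradSq_le {κ : ℝ} {u : ℝ → E d → E d} {A : ℝ → ℝ} {θ : ℝ → L2 d}
    {f : ℝ → E d → ℝ} {g : Fin d → ℝ → E d → ℝ} (F : Flow κ u A θ f g) {s t : ℝ} (hs : 0 ≤ s)
    (hst : s ≤ t) : ∫ τ in Ioc s t, gradSq g τ ≤ ‖θ s‖ ^ 2 / (2 * κ) := by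
  have := F.energy hs hst
  rw [le_div_iff₀ (mul_pos two_pos F.pos)]
  nlinarith [sq_nonneg ‖θ t‖]

theorem sqrt_div_eq_mul_rpow {a κ : ℝ} (ha : 0 ≤ a) (hκ : 0 < κ) :
    √(a / κ) = √a * κ ^ (-(1 / 2) : ℝ) := by
  rw [Real.sqrt_div ha, Real.sqrt_eq_rpow κ, Real.rpow_neg hκ.le, div_eq_mul_inv]

/-- The gradient bound obtained from the initial datum. -/
theorem Setting.gradNorm_le_of_init {α r c κ₀ M κ ν : ℝ} {u : ℝ → E d → E d} {θ₀ : L2 d}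
    {θ : ℝ → L2 d} (S : Setting d α r c κ₀ M κ u θ₀ θ) (hc : 0 < c) (hM : 0 < M) (hν : 0 ≤ ν)
    (hu : DecaysLike c (fun t => gradNorm ∞ (u t)) ν) {t : ℝ} (ht : 0 ≤ t) :
    gradNorm 2 (θ t : E d → ℝ) ≤
      ENNReal.ofReal (√(κ₀ * (d * (M + 1) ^ 2) + 2 * c * M ^ 2) * κ ^ (-(1 / 2) : ℝ)) := by
  obtain ⟨f, g, F⟩ := S.exists_flow hc hν hu
  obtain ⟨p, hp, hpw, hps⟩ := S.init_grad hM
  have hκ := S.kappa_pos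
  have hκ₀ : 0 < κ₀ := hκ.trans_le S.kappa_le
  obtain ⟨q, hq, hqw, hqs⟩ := F.exists_grad le_rfl ht (a := 2 * c) (by positivity) (by
    filter_upwards [ae_restrict_mem measurableSet_Ioc] with τ hτ
    have : (1 + τ) ^ (-ν) ≤ 1 :=
      Real.rpow_le_one_of_one_le_of_nonpos (by linarith [hτ.1]) (by linarith)
    nlinarith) hp (by rwa [max_self])
  simp only [max_eq_left ht] at hqw
  refine (gradNorm_le (Lp.memLp _) hq hqw).trans (ENNReal.ofReal_le_ofReal ?_)
  rw [← sqrt_div_eq_mul_rpow (by positivity) hκ]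
  refine Real.sqrt_le_sqrt ?_
  have h1 := F.integral_gradSq_le le_rfl ht
  simp only [max_self] at h1
  rw [S.solution.init] at h1
  have h2 : ‖θ₀‖ ^ 2 / (2 * κ) ≤ M ^ 2 / (2 * κ) := by
    have := S.norm_le
    gcongr
  -- The energy contribution carries `κ⁻¹`. The initial contribution does not, and is brought to the
  -- same form using `1 ≤ κ₀/κ`.
  have h3 := mul_le_mul_of_nonneg_left (h1.trans h2) (show 0 ≤ 2 * (2 * c) by positivity)
  have h4 : d * (M + 1) ^ 2 ≤ κ₀ * (d * (M + 1) ^ 2) / κ := by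
    rw [le_div_iff₀ hκ, mul_comm]
    exact mul_le_mul_of_nonneg_right S.kappa_le (by positivity)
  have h5 : 2 * (2 * c) * (M ^ 2 / (2 * κ)) = 2 * c * M ^ 2 / κ := by field_simp
  rw [add_div]
  linarith

/-- The gradient bound obtained by averaging over `[t / 2, t]`. -/
theorem Setting.gradNorm_le_of_half {α r c κ₀ M κ ν : ℝ} {u : ℝ → E d → E d} {θ₀ : L2 d}
    {θ : ℝ → L2 d} (S : Setting d α r c κ₀ M κ u θ₀ θ) (hc : 0 < c) (hν : 1 ≤ ν)
    (hu : DecaysLike c (fun t => gradNorm ∞ (u t)) ν) {t : ℝ} (ht : 1 ≤ t) :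
    gradNorm 2 (θ t : E d → ℝ) ≤ ENNReal.ofReal
      (√(2 + 4 * c) * ‖θ (t / 2)‖ * (1 + t) ^ (-(1 / 2) : ℝ) * κ ^ (-(1 / 2) : ℝ)) := by
  obtain ⟨f, g, F⟩ := S.exists_flow hc (by linarith) hu
  have hκ := S.kappa_pos
  have ht0 : 0 < t := by linarith
  have ht2 : 0 ≤ t / 2 := by linarith
  obtain ⟨K, hK⟩ := F.slice' (t := t) ht2
  have hI := F.integrableOn_gradSq (t := t) ht2
  -- A time at which `‖∇θ‖²` is at most its mean over `(t/2, t]`, chosen outside the null set where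
  -- the slice relations may fail.
  obtain ⟨s, hs, hsK, hsle⟩ : ∃ s ∈ Ioc (t / 2) t,
      Slice (u s) (2 * c * (1 + s) ^ (-ν)) K (θ (max s 0)) (f s) (fun i => g i s) ∧
      gradSq g s * (t / 2) ≤ ∫ τ in Ioc (t / 2) t, gradSq g τ := by
    by_contra! hcon
    have h1 : ∀ᵐ τ ∂(volume.restrict (Ioc (t / 2) t)),
        (∫ τ in Ioc (t / 2) t, gradSq g τ) < gradSq g τ * (t / 2) := by
      filter_upwards [hK, ae_restrict_mem measurableSet_Ioc] with τ h1 h2 using hcon τ h2 h1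
    set I := ∫ τ in Ioc (t / 2) t, gradSq g τ with hIdef
    have h2 : 0 < ∫ τ in Ioc (t / 2) t, (gradSq g τ * (t / 2) - I) := by
      have h3 : 0 ≤ᵐ[volume.restrict (Ioc (t / 2) t)] fun τ => gradSq g τ * (t / 2) - I := by
        filter_upwards [h1] with τ h
        exact (sub_pos.2 h).le
      rw [integral_pos_iff_support_of_nonneg_ae h3 ((hI.mul_const _).sub (integrable_const _))]
      have h4 : (volume.restrict (Ioc (t / 2) t))
          (Function.support fun τ => gradSq g τ * (t / 2) - I)ᶜ = 0 := by
        refine measure_mono_null ?_ (ae_iff.1 h1)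
        intro τ hτ
        simp only [mem_compl_iff, Function.mem_support, ne_eq, not_not] at hτ
        simp only [mem_ofPred_eq, not_lt]
        linarith
      have h5 := measure_add_measure_compl₀ (μ := volume.restrict (Ioc (t / 2) t))
        (s := Function.support fun τ => gradSq g τ * (t / 2) - I)
        (((hI.mul_const _).sub (integrable_const _)).1.nullMeasurableSet_support)
      rw [h4, add_zero] at h5
      rw [h5, Measure.restrict_apply_univ, Real.volume_Ioc]
      exact ENNReal.ofReal_pos.2 (by linarith)
    rw [integral_sub (hI.mul_const _) (integrable_const _), integral_mul_const, setIntegral_const,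
      Real.volume_real_Ioc_of_le (by linarith), smul_eq_mul, ← hIdef] at h2
    linarith
  have hs0 : 0 ≤ s := by linarith [hs.1]
  have h1t : 0 < 1 + t := by linarith
  -- For `τ > t/2` and `ν ≥ 1` one has `(1+τ)^{-ν} ≤ 2/(1+t)`, which gives `a = 4c/(1+t)`.
  obtain ⟨q, hq, hqw, hqs⟩ := F.exists_grad hs0 hs.2 (a := 4 * c / (1 + t)) (by positivity) (by
    filter_upwards [ae_restrict_mem measurableSet_Ioc] with τ hτ
    have h1 : (1 + τ) ^ (-ν) ≤ (1 + τ) ^ (-1 : ℝ) :=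
      Real.rpow_le_rpow_of_exponent_le (by linarith [hτ.1]) (by linarith)
    have h2 : (1 + τ) ^ (-1 : ℝ) ≤ 2 / (1 + t) := by
      rw [Real.rpow_neg_one, inv_eq_one_div, div_le_div_iff₀ (by linarith [hτ.1]) h1t]
      linarith [hτ.1, hs.1]
    calc 2 * c * (1 + τ) ^ (-ν) ≤ 2 * c * (2 / (1 + t)) := by
          have := h1.trans h2
          gcongr
      _ = _ := by ring) hsK.memg hsK.grad
  simp only [max_eq_left ht0.le] at hqw
  refine (gradNorm_le (Lp.memLp _) hq hqw).trans (ENNReal.ofReal_le_ofReal ?_)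
  have h1 := F.integral_gradSq_le ht2 (show t / 2 ≤ t by linarith)
  simp only [max_eq_left ht2] at h1
  have h2 : ∫ τ in Ioc s t, gradSq g τ ≤ ∫ τ in Ioc (t / 2) t, gradSq g τ :=
    setIntegral_mono_set hI (ae_of_all _ fun τ => gradSq_nonneg g τ)
      (Ioc_subset_Ioc_left hs.1.le).eventuallyLE
  have h3 : gradSq g s ≤ 4 / (1 + t) * (‖θ (t / 2)‖ ^ 2 / (2 * κ)) := by
    have h4 : (1 + t) / 4 ≤ t / 2 := by linarith
    have h5 := (mul_le_mul_of_nonneg_left h4 (gradSq_nonneg g s)).trans (hsle.trans h1)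
    rw [div_mul_eq_mul_div, le_div_iff₀ h1t]
    linarith
  have h6 := mul_le_mul_of_nonneg_left (h2.trans h1)
    (show 0 ≤ 2 * (4 * c / (1 + t)) by positivity)
  have h7 : ∑ i, sqInt (q i) ≤ (2 + 4 * c) * ‖θ (t / 2)‖ ^ 2 / (1 + t) / κ := by
    have e : (2 + 4 * c) * ‖θ (t / 2)‖ ^ 2 / (1 + t) / κ =
        4 / (1 + t) * (‖θ (t / 2)‖ ^ 2 / (2 * κ)) +
          2 * (4 * c / (1 + t)) * (‖θ (t / 2)‖ ^ 2 / (2 * κ)) := by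
      field_simp
      ring
    rw [e]
    exact hqs.trans (add_le_add h3 h6)
  refine (Real.sqrt_le_sqrt h7).trans_eq ?_
  rw [sqrt_div_eq_mul_rpow (by positivity) hκ, sqrt_div_eq_mul_rpow (by positivity) h1t,
    Real.sqrt_mul (by positivity), Real.sqrt_sq (norm_nonneg _)]

/-- With `z = (1+t)^σ`, the power `(1+t)^β` is at most `z^k` once `k ≥ β/σ`, and one term of the
exponential series dominates `z^k`. -/
theorem rpow_one_add_le_exp {σ β : ℝ} (hσ : 0 < σ) : ∃ C : ℝ, 0 < C ∧ ∀ t : ℝ, 0 ≤ t →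
    (1 + t) ^ β ≤ C * Real.exp (((1 + t) ^ σ - 1) / σ) := by
  obtain ⟨k, hk⟩ := exists_nat_ge (β / σ)
  refine ⟨σ ^ k * k.factorial * Real.exp (1 / σ), by positivity, fun t ht => ?_⟩
  set z := (1 + t) ^ σ
  have hz : 1 ≤ z := Real.one_le_rpow (by linarith) hσ.le
  have h1 : (1 + t) ^ β ≤ z ^ k := by
    rw [← Real.rpow_natCast, ← Real.rpow_mul (by linarith)]
    refine Real.rpow_le_rpow_of_exponent_le (by linarith) ?_
    rwa [div_le_iff₀ hσ, mul_comm] at hk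
  have h2 := Real.pow_div_factorial_le_exp (z / σ) (by positivity) k
  rw [div_le_iff₀ (by positivity), div_pow, div_le_iff₀ (by positivity)] at h2
  have h3 : Real.exp (z / σ) = Real.exp (1 / σ) * Real.exp ((z - 1) / σ) := by
    rw [← Real.exp_add]
    congr 1
    ring
  rw [h3] at h2
  linarith

/-- Algebraic decay of the gradient when `‖∇u(t)‖_∞` decays at least like `(1+t)^{-1}`. -/
theorem exists_grad_decay (hd : d ≤ 3) {α : ℝ} (hα : 1 / 2 - (d : ℝ) / 4 < α) :
    ∃ m : ℚ, (d : ℝ) / 2 + 1 ≤ (m : ℝ) ∧ ∀ r : ℝ, -((d : ℝ) / 2) < r → ∀ c κ₀ M : ℝ, 0 < c →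
      0 < κ₀ → 0 < M → ∃ C : ℝ, 0 < C ∧ ∀ (ν κ : ℝ) (u : ℝ → E d → E d) (θ₀ : L2 d)
        (θ : ℝ → L2 d), 1 ≤ ν → Setting d α r c κ₀ M κ u θ₀ θ →
        DecaysLike c (fun t => gradNorm ∞ (u t)) ν → ∀ t : ℝ, 0 ≤ t →
        gradNorm 2 (θ t : E d → ℝ) ≤ ENNReal.ofReal (C * κ ^ (-((m : ℝ) + 1 / 2)) *
          (1 + t) ^ (-min ((d : ℝ) / 4 + r / 2 + 1 / 2) ((d : ℝ) / 4 + 1))) := by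
  have hd0 : (0 : ℝ) ≤ d := Nat.cast_nonneg d
  have hd3 : (d : ℝ) ≤ 3 := by exact_mod_cast hd
  -- `N` is large enough that `η = (d/4 + 1/2)/(N + 1/2)` fits in the gap between `α` and its
  -- critical value. It depends only on `d` and `α`, as `m` must.
  obtain ⟨N, hN⟩ := exists_nat_ge (((d : ℝ) / 4 + 1 / 2) / (α - (1 / 2 - (d : ℝ) / 4)))
  have hgap : 0 < α - (1 / 2 - (d : ℝ) / 4) := sub_pos.2 hα
  rw [div_le_iff₀ hgap] at hN
  set η : ℝ := ((d : ℝ) / 4 + 1 / 2) / (N + 1 / 2) with hηdef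
  have hN0 : (0 : ℝ) ≤ N := Nat.cast_nonneg N
  have hη0 : 0 < η := by positivity
  have hη : η * (N + 1 / 2) = (d : ℝ) / 4 + 1 / 2 := div_mul_cancel₀ _ (by positivity)
  have hηα : 1 / 2 - (d : ℝ) / 4 + η ≤ α := by
    have : η ≤ α - (1 / 2 - (d : ℝ) / 4) := by
      rw [hηdef, div_le_iff₀ (by positivity)]
      linarith
    linarith
  -- The first summand is the `κ` cost of `N + 1` bootstrap steps; the second secures the required
  -- lower bound on `m`.
  refine ⟨(N + 1) * ((d + 2) / 4) + (d / 2 + 1), ?_, fun r hr c κ₀ M hc hκ₀ hM => ?_⟩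
  · push_cast
    have : 0 ≤ ((N : ℝ) + 1) * ((d + 2) / 4) := by positivity
    linarith
  set m : ℝ := (((N + 1) * ((d + 2) / 4) + (d / 2 + 1) : ℚ) : ℝ) with hm
  have hm0 : 0 ≤ m := by rw [hm]; push_cast; positivity
  have hmN : ((N + 1 : ℕ) : ℝ) * ((d + 2) / 4 : ℝ) ≤ m := by
    rw [hm]; push_cast
    linarith
  set p : ℝ := (d : ℝ) + 2 * min r 1 with hp
  have hp0 : 0 ≤ p := by
    rcases min_choice r 1 with e | e <;> rw [hp, e] <;> linarith
  have hp2 : p ≤ d + 2 := by linarith [min_le_right r 1]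
  have hexp : min ((d : ℝ) / 4 + r / 2 + 1 / 2) ((d : ℝ) / 4 + 1) = p / 4 + 1 / 2 := by
    rw [hp]
    rcases le_total r 1 with h | h
    · rw [min_eq_left h, min_eq_left (by linarith)]; ring
    · rw [min_eq_right h, min_eq_right (by linarith)]; ring
  obtain ⟨C₁, hC₁, hlow⟩ := exists_sqInt_cv_kern_le d
  obtain ⟨B, hB, hdec⟩ := exists_decay_iterate (d := d) (κ₀ := κ₀) (M := M) (c := c) (p := p)
    (C := C₁ * (M + M ^ 2)) N hη hη0 hκ₀ hM hc (by positivity) hp0 (by linarith) hp2 (N + 1)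
  -- After `N + 1` steps the rate is saturated, since `(N+1)η ≥ (N + 1/2)η = d/4 + 1/2 ≥ p/4`.
  have hmin : min (p / 4) ((N + 1 : ℕ) * η) = p / 4 := by
    refine min_eq_left ?_
    push_cast
    linarith
  rw [hmin] at hdec
  set B' := B * κ₀ ^ (m - (N + 1 : ℕ) * ((d + 2) / 4 : ℝ))
  set C₂ := √(κ₀ * (d * (M + 1) ^ 2) + 2 * c * M ^ 2)
  have hC₂ : 0 < C₂ := Real.sqrt_pos.2 (by positivity)
  have hB' : 0 < B' := by positivity
  refine ⟨C₂ * κ₀ ^ m * 2 ^ (p / 4 + 1 / 2) + √(2 + 4 * c) * B' * 2 ^ (p / 4), by positivity,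
    fun ν κ u θ₀ θ hν S hu t ht => ?_⟩
  have hκ := S.kappa_pos
  have h1t : 0 < 1 + t := by linarith
  rw [hexp]
  have hX : 0 ≤ κ ^ (-(m + 1 / 2)) * (1 + t) ^ (-(p / 4 + 1 / 2)) := by positivity
  -- For `t ≤ 1` the weight in `t` is comparable to one and the bound from the datum suffices;
  -- averaging over `[t/2, t]` needs `t` bounded away from zero.
  rcases le_total t 1 with h | h
  · refine (S.gradNorm_le_of_init hc hM (by linarith) hu ht).trans (ENNReal.ofReal_le_ofReal ?_)
    have h1 := rpow_neg_le_of_le (a := 1 / 2) (b := m + 1 / 2) hκ S.kappa_le (by linarith)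
    rw [add_sub_cancel_right] at h1
    have h2 : 1 ≤ 2 ^ (p / 4 + 1 / 2) * (1 + t) ^ (-(p / 4 + 1 / 2)) := by
      have h3 : (2 : ℝ) ^ (-(p / 4 + 1 / 2)) ≤ (1 + t) ^ (-(p / 4 + 1 / 2)) :=
        Real.rpow_le_rpow_of_nonpos h1t (by linarith) (by linarith)
      have h4 := mul_le_mul_of_nonneg_left h3 (show (0 : ℝ) ≤ 2 ^ (p / 4 + 1 / 2) by positivity)
      rwa [← Real.rpow_add two_pos, add_neg_cancel, Real.rpow_zero] at h4
    calc C₂ * κ ^ (-(1 / 2) : ℝ) ≤ C₂ * (κ₀ ^ m * κ ^ (-(m + 1 / 2))) * 1 := by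
          rw [mul_one]; gcongr
      _ ≤ C₂ * (κ₀ ^ m * κ ^ (-(m + 1 / 2))) *
          (2 ^ (p / 4 + 1 / 2) * (1 + t) ^ (-(p / 4 + 1 / 2))) := by gcongr
      _ = C₂ * κ₀ ^ m * 2 ^ (p / 4 + 1 / 2) *
          (κ ^ (-(m + 1 / 2)) * (1 + t) ^ (-(p / 4 + 1 / 2))) := by ring
      _ ≤ _ := by
        rw [mul_assoc (_ + _) (κ ^ _)]
        refine mul_le_mul_of_nonneg_right ?_ hX
        have : 0 ≤ √(2 + 4 * c) * B' * 2 ^ (p / 4) := by positivity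
        linarith
  · refine (S.gradNorm_le_of_half hc hν hu h).trans (ENNReal.ofReal_le_ofReal ?_)
    obtain ⟨f, g, F⟩ := S.exists_flow hc (by linarith) hu
    have h1 := hdec κ u _ _ f g (S.decaying hd hc hM hηα hlow F) (t / 2) (by linarith)
    simp only [max_eq_left (show (0 : ℝ) ≤ t / 2 by linarith)] at h1
    have h2 := rpow_neg_le_of_le hκ S.kappa_le hmN
    have h3 : (1 + t / 2) ^ (-(p / 4)) ≤ 2 ^ (p / 4) * (1 + t) ^ (-(p / 4)) := by
      calc (1 + t / 2) ^ (-(p / 4)) ≤ (2⁻¹ * (1 + t)) ^ (-(p / 4)) :=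
            Real.rpow_le_rpow_of_nonpos (by positivity) (by linarith) (by linarith)
        _ = _ := by
          rw [Real.mul_rpow (by norm_num) h1t.le, Real.inv_rpow (by norm_num),
            Real.rpow_neg (by norm_num : (0 : ℝ) ≤ 2), inv_inv]
    have h4 : ‖θ (t / 2)‖ ≤ B' * κ ^ (-m) * (2 ^ (p / 4) * (1 + t) ^ (-(p / 4))) := by
      calc ‖θ (t / 2)‖ ≤ B * κ ^ (-((N + 1 : ℕ) * ((d + 2) / 4 : ℝ))) *
            (1 + t / 2) ^ (-(p / 4)) := h1
        _ ≤ B * (κ₀ ^ (m - (N + 1 : ℕ) * ((d + 2) / 4 : ℝ)) * κ ^ (-m)) *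
            (2 ^ (p / 4) * (1 + t) ^ (-(p / 4))) := by gcongr
        _ = _ := by simp only [B']; ring
    have e1 : κ ^ (-(m + 1 / 2)) = κ ^ (-m) * κ ^ (-(1 / 2) : ℝ) := by
      rw [← Real.rpow_add hκ]; congr 1; ring
    have e2 : (1 + t) ^ (-(p / 4 + 1 / 2)) = (1 + t) ^ (-(p / 4)) * (1 + t) ^ (-(1 / 2) : ℝ) := by
      rw [← Real.rpow_add h1t]; congr 1; ring
    calc √(2 + 4 * c) * ‖θ (t / 2)‖ * (1 + t) ^ (-(1 / 2) : ℝ) * κ ^ (-(1 / 2) : ℝ)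
        ≤ √(2 + 4 * c) * (B' * κ ^ (-m) * (2 ^ (p / 4) * (1 + t) ^ (-(p / 4)))) *
          (1 + t) ^ (-(1 / 2) : ℝ) * κ ^ (-(1 / 2) : ℝ) := by gcongr
      _ = √(2 + 4 * c) * B' * 2 ^ (p / 4) *
          (κ ^ (-(m + 1 / 2)) * (1 + t) ^ (-(p / 4 + 1 / 2))) := by rw [e1, e2]; ring
      _ ≤ _ := by
        rw [mul_assoc (_ + _) (κ ^ _)]
        refine mul_le_mul_of_nonneg_right ?_ hX
        have : 0 ≤ C₂ * κ₀ ^ m * 2 ^ (p / 4 + 1 / 2) := by positivity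
        linarith

end AdvDiff

theorem lemma3 (d : ℕ) (hd : d = 2 ∨ d = 3) (α : ℝ) (hα : 1 / 2 - (d : ℝ) / 4 < α) :
    ∃ m : ℚ, (d : ℝ) / 2 + 1 ≤ (m : ℝ) ∧
      ∀ r : ℝ, -((d : ℝ) / 2) < r → ∀ c κ₀ M : ℝ, 0 < c → 0 < κ₀ → 0 < M →
        (∀ ν : ℝ, 1 < ν → ∃ C : ℝ, 0 < C ∧
          ∀ (κ : ℝ) (u : ℝ → AdvDiff.E d → AdvDiff.E d)
            (θ₀ : AdvDiff.L2 d) (θ : ℝ → AdvDiff.L2 d),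
            AdvDiff.Setting d α r c κ₀ M κ u θ₀ θ →
            AdvDiff.DecaysLike c (fun t => AdvDiff.gradNorm ∞ (u t)) ν →
            ∀ t : ℝ, 0 ≤ t →
              AdvDiff.gradNorm 2 (θ t : AdvDiff.E d → ℝ) ≤ ENNReal.ofReal
                (C * κ ^ (-max ((d : ℝ) / 4 + r / 2) (m : ℝ) - 1 / 2)
                  * (1 + t) ^ (-min ((d : ℝ) / 4 + r / 2 + 1 / 2) ((d : ℝ) / 4 + 1))
                  * Real.exp (((1 + t) ^ (-ν + 1) - 1) / (-ν + 1)))) ∧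
        (∃ C : ℝ, 0 < C ∧
          ∀ (κ : ℝ) (u : ℝ → AdvDiff.E d → AdvDiff.E d)
            (θ₀ : AdvDiff.L2 d) (θ : ℝ → AdvDiff.L2 d),
            AdvDiff.Setting d α r c κ₀ M κ u θ₀ θ →
            AdvDiff.DecaysLike c (fun t => AdvDiff.gradNorm ∞ (u t)) 1 →
            ∀ t : ℝ, 0 ≤ t →
              AdvDiff.gradNorm 2 (θ t : AdvDiff.E d → ℝ) ≤ ENNReal.ofReal
                (C * κ ^ (-max ((d : ℝ) / 4 + r / 2) (m : ℝ) - 1 / 2)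
                  * (1 + t) ^ (-min ((d : ℝ) / 4 + r / 2 + 1 / 2) ((d : ℝ) / 4 + 1)))) ∧
        (∀ ν : ℝ, 0 ≤ ν → ν < 1 → ∃ C : ℝ, 0 < C ∧
          ∀ (κ : ℝ) (u : ℝ → AdvDiff.E d → AdvDiff.E d)
            (θ₀ : AdvDiff.L2 d) (θ : ℝ → AdvDiff.L2 d),
            AdvDiff.Setting d α r c κ₀ M κ u θ₀ θ →
            AdvDiff.DecaysLike c (fun t => AdvDiff.gradNorm ∞ (u t)) ν →
            ∀ t : ℝ, 0 ≤ t →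
              AdvDiff.gradNorm 2 (θ t : AdvDiff.E d → ℝ) ≤ ENNReal.ofReal
                (C * κ ^ (-max ((d : ℝ) / 4 + r / 2) (m : ℝ) - 1 / 2)
                  * (1 + t) ^ (-min ((d : ℝ) / 4 + r / 2 + 3 / 2) ((d : ℝ) / 4 + 2))
                  * Real.exp (((1 + t) ^ (-ν + 1) - 1) / (-ν + 1)))) := by
  have hd3 : d ≤ 3 := by omega
  obtain ⟨m, hm, H⟩ := AdvDiff.exists_grad_decay hd3 hα
  refine ⟨m, hm, fun r hr c κ₀ M hc hκ₀ hM => ?_⟩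
  obtain ⟨C, hC, H⟩ := H r hr c κ₀ M hc hκ₀ hM
  set n : ℝ := max ((d : ℝ) / 4 + r / 2) (m : ℝ) with hn
  have hd0 : (0 : ℝ) ≤ d := Nat.cast_nonneg d
  have hmn : (m : ℝ) ≤ n := le_max_right _ _
  have hn0 : 0 ≤ n := by linarith
  have hneg : -n - 1 / 2 = -(n + 1 / 2) := by ring
  have hκn : ∀ κ : ℝ, 0 < κ → κ ≤ κ₀ →
      C * κ ^ (-((m : ℝ) + 1 / 2)) ≤ C * κ₀ ^ (n - m) * κ ^ (-n - 1 / 2) := fun κ h1 h2 => by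
    have := AdvDiff.rpow_neg_le_of_le (a := (m : ℝ) + 1 / 2) (b := n + 1 / 2) h1 h2 (by linarith)
    rw [add_sub_add_right_eq_sub] at this
    rw [hneg, mul_assoc]
    exact mul_le_mul_of_nonneg_left this hC.le
  refine ⟨fun ν hν => ⟨C * κ₀ ^ (n - m), by positivity, fun κ u θ₀ θ S hu t ht => ?_⟩,
    ⟨C * κ₀ ^ (n - m), by positivity, fun κ u θ₀ θ S hu t ht => ?_⟩, fun ν hν0 hν1 => ?_⟩
  · refine (H ν κ u θ₀ θ hν.le S hu t ht).trans (ENNReal.ofReal_le_ofReal ?_)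
    have h1t : 0 < 1 + t := by linarith
    have h1 := hκn κ S.kappa_pos S.kappa_le
    -- Numerator and denominator are both nonpositive for `ν > 1`, so the exponential only enlarges
    -- the right-hand side.
    have h2 : 1 ≤ Real.exp (((1 + t) ^ (-ν + 1) - 1) / (-ν + 1)) := by
      refine Real.one_le_exp (div_nonneg_of_nonpos ?_ (by linarith))
      linarith [Real.rpow_le_one_of_one_le_of_nonpos (show 1 ≤ 1 + t by linarith)
        (show -ν + 1 ≤ 0 by linarith)]
    have h3 := S.kappa_pos
    refine le_trans ?_ (le_mul_of_one_le_right (by positivity) h2)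
    exact mul_le_mul_of_nonneg_right h1 (by positivity)
  · refine (H 1 κ u θ₀ θ le_rfl S hu t ht).trans (ENNReal.ofReal_le_ofReal ?_)
    have h1t : 0 < 1 + t := by linarith
    have h1 := hκn κ S.kappa_pos S.kappa_le
    exact mul_le_mul_of_nonneg_right h1 (by positivity)
  -- For `ν < 1` the exponential dominates `(1+t)^β`, so the uniform gradient bound from the datum
  -- suffices and no decay of `θ` is used.
  · obtain ⟨C₁, hC₁, hexp⟩ := AdvDiff.rpow_one_add_le_exp (σ := -ν + 1)
      (β := min ((d : ℝ) / 4 + r / 2 + 3 / 2) ((d : ℝ) / 4 + 2)) (by linarith)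
    set β := min ((d : ℝ) / 4 + r / 2 + 3 / 2) ((d : ℝ) / 4 + 2)
    set C₂ := √(κ₀ * (d * (M + 1) ^ 2) + 2 * c * M ^ 2)
    have hC₂ : 0 < C₂ := Real.sqrt_pos.2 (by positivity)
    refine ⟨C₂ * κ₀ ^ n * C₁, by positivity, fun κ u θ₀ θ S hu t ht => ?_⟩
    refine (S.gradNorm_le_of_init hc hM hν0 hu ht).trans (ENNReal.ofReal_le_ofReal ?_)
    have h1t : 0 < 1 + t := by linarith
    have hκ := S.kappa_pos
    have h1 := AdvDiff.rpow_neg_le_of_le (a := 1 / 2) (b := n + 1 / 2) hκ S.kappa_le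
      (by linarith)
    rw [add_sub_cancel_right, ← hneg] at h1
    have h2 : 1 ≤ C₁ * ((1 + t) ^ (-β) * Real.exp (((1 + t) ^ (-ν + 1) - 1) / (-ν + 1))) := by
      have h3 := mul_le_mul_of_nonneg_left (hexp t ht) (Real.rpow_nonneg h1t.le (-β))
      rw [← Real.rpow_add h1t, neg_add_cancel, Real.rpow_zero] at h3
      linarith
    calc C₂ * κ ^ (-(1 / 2) : ℝ) ≤ C₂ * (κ₀ ^ n * κ ^ (-n - 1 / 2)) * 1 := by
          rw [mul_one]; gcongr
      _ ≤ C₂ * (κ₀ ^ n * κ ^ (-n - 1 / 2)) *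
          (C₁ * ((1 + t) ^ (-β) * Real.exp (((1 + t) ^ (-ν + 1) - 1) / (-ν + 1)))) := by gcongr
      _ = _ := by ring
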